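/- **Proposition 3.4.** Let $n\ge 1$. For $g\in GL(2n,\mathbb R)$ let $\mathrm{Det}(g)$ denote the determinant of the Iwasawa representative of the class of $g$ in $GL(2n,\mathbb R)/(O(2n,\mathbb R)\cdot\mathbb R^\times)$; here the Iwasawa representative is the unique matrix $xy$ in the class with $x$ upper triangular unipotent and $$y=\mathrm{diag}\big(y_1y_2\cdots y_{2n-1},\; y_1y_2\cdots y_{2n-2},\;\ldots,\; y_1,\;1\big),\qquad y_i>0 .$$ Let $P_{2n-1,1}$ be the parabolic subgroup of block upper triangular matrices with diagonal blocks in $GL(2n-1)$ and $GL(1)$. The maximal parabolic Eisenstein series is defined for $\mathrm{Re}(s)>1$ by $$E_{P_{2n-1,1}}(z,s)=\sum_{\gamma\in (P_{2n-1,1}(\mathbb Z)\cap SL(2n,\mathbb Z))\backslash SL(2n,\mathbb Z)}\mathrm{Det}(\gamma z)^s ,$$ and for other $s$ by meromorphic continuation in $s\in\mathbb C$. There is a constant $C>0$ depending only on $n$ such that the following holds for every $z=xy$ as above with $y_i\ge 1$ for $1\le i\le 2n-1$. The series converges absolutely for $\mathrm{Re}(s)>1$, the continuation exists and is holomorphic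 at every point of the line $\mathrm{Re}(w)=\tfrac12$, and for every $w\in\mathbb C$ with $\mathrm{Re}(w)=\tfrac12$, $$\begin{aligned}\big|E_{P_{2n-1,1}}(z,w)\big|\;\le\; C\,\frac{e^{\frac{\pi}{2}n|w|}}{|w|^{\frac{n-1}{2}}}\sum_{1\le k\le 2n}\Big[&\big(y_1y_2^2\cdots y_{2n-k}^{2n-k}\big)^{\frac12}\big(y_{2n-k+1}^{k-1}y_{2n-k+2}^{k-2}\cdots y_{2n-1}\big)^{\frac12}\\ &+\big(y_1y_2^2\cdots y_{2n-k}^{2n-k}\big)^{\frac{k-1}{2n}}\big(y_{2n-k+1}^{k-1}y_{2n-k+2}^{k-2}\cdots y_{2n-1}\big)^{\frac{2n-k+1}{2n}}\Big]\cdot\big(1+\log(y_1\cdots y_{2n-1})\big),\end{aligned}$$ where empty products are $1$. -/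

import Mathlib

open scoped MatrixGroups

namespace MaxParabolic

/-- The upper triangular unipotent matrix `x` of the Iwasawa form: ones on the diagonal and the
real numbers `x i j` (`i < j`) above it. -/
def iwasawaX {N : ℕ} (x : Fin N → Fin N → ℝ) : Matrix (Fin N) (Fin N) ℝ :=
  Matrix.of fun i j => if i = j then 1 else if i < j then x i j else 0

/-- The diagonal matrix `y` of the Iwasawa form,
`diag (y₁ y₂ ⋯ y_{N-1}, y₁ y₂ ⋯ y_{N-2}, …, y₁, 1)`. Only `y 1, …, y (N - 1)` are used. -/
def iwasawaY (N : ℕ) (y : ℕ → ℝ) : Matrix (Fin N) (Fin N) ℝ :=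
  Matrix.diagonal fun i => ∏ j ∈ Finset.Icc 1 (N - 1 - (i : ℕ)), y j

/-- The function `Det` on `GL(m+1, ℝ) / (O(m+1) · ℝˣ)`: the determinant of the Iwasawa
representative `x y` of the class of `g`. In terms of any representative `g` it equals `|det g|`
divided by the `(m+1)`-st power of the Euclidean norm of the last row of `g`;
see `iwasawaDet_eq` below. -/
noncomputable def iwasawaDet {m : ℕ} (g : Matrix (Fin (m + 1)) (Fin (m + 1)) ℝ) : ℝ :=
  |g.det| / √(∑ j, g (Fin.last m) j ^ 2) ^ (m + 1)

theorem det_iwasawaX {N : ℕ} (x : Fin N → Fin N → ℝ) : (iwasawaX x).det = 1 := by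
  rw [Matrix.det_of_isUpperTriangular]
  · simp [iwasawaX]
  · intro i j hij
    have h : j < i := hij
    simp [iwasawaX, h.ne', h.not_gt]

/-- On every matrix with an Iwasawa decomposition `r · x y · k` (`r` a nonzero scalar, `k`
orthogonal) the function `iwasawaDet` takes the value `det (x y) = det y`. -/
theorem iwasawaDet_eq {m : ℕ} (x : Fin (m + 1) → Fin (m + 1) → ℝ) (y : ℕ → ℝ)
    (hy : ∀ i ∈ Finset.Icc 1 m, 0 < y i) (r : ℝ) (hr : r ≠ 0)
    (k : Matrix (Fin (m + 1)) (Fin (m + 1)) ℝ)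
    (hk : k ∈ Matrix.orthogonalGroup (Fin (m + 1)) ℝ) :
    iwasawaDet (r • (iwasawaX x * iwasawaY (m + 1) y * k)) =
      (iwasawaX x * iwasawaY (m + 1) y).det := by
  have hkk : k * k.transpose = 1 := by
    simpa [Matrix.star_eq_conjTranspose] using (Matrix.mem_orthogonalGroup_iff _ _).1 hk
  have hkd : |k.det| = 1 := by
    have h := congrArg Matrix.det hkk
    rw [Matrix.det_mul, Matrix.det_transpose, Matrix.det_one] at h
    have h2 : |k.det| * |k.det| = 1 := by rw [← abs_mul, h, abs_one]
    nlinarith [abs_nonneg k.det]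
  have hYpos : 0 < (iwasawaY (m + 1) y).det := by
    rw [iwasawaY, Matrix.det_diagonal]
    refine Finset.prod_pos fun i _ => Finset.prod_pos fun j hj => hy j ?_
    simp only [Finset.mem_Icc] at hj ⊢
    omega
  have hrow : ∀ j, (iwasawaX x * iwasawaY (m + 1) y * k) (Fin.last m) j = k (Fin.last m) j := by
    intro j
    rw [Matrix.mul_apply, Finset.sum_eq_single (Fin.last m)]
    · rw [iwasawaY, Matrix.mul_diagonal]
      simp [iwasawaX]
    · intro b _ hb
      rw [iwasawaY, Matrix.mul_diagonal]
      have : ¬ Fin.last m < b := (Fin.le_last b).not_gt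
      simp [iwasawaX, hb.symm, this]
    · simp
  have hnorm : ∑ j, (r • (iwasawaX x * iwasawaY (m + 1) y * k)) (Fin.last m) j ^ 2 = r ^ 2 := by
    have h1 : ∑ j, k (Fin.last m) j * k (Fin.last m) j = 1 := by
      have h := congrFun (congrFun hkk (Fin.last m)) (Fin.last m)
      simpa [Matrix.mul_apply] using h
    simp only [Matrix.smul_apply, hrow, smul_eq_mul, mul_pow]
    rw [← Finset.mul_sum]
    simp only [pow_two (k _ _), h1, mul_one]
  rw [iwasawaDet, hnorm, Real.sqrt_sq_eq_abs, Matrix.det_smul, Matrix.det_mul, abs_mul, abs_mul,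
    hkd, mul_one, abs_pow, Fintype.card_fin, mul_div_assoc, mul_comm,
    div_mul_cancel₀ _ (pow_ne_zero _ (abs_ne_zero.2 hr)), Matrix.det_mul, det_iwasawaX, one_mul,
    abs_of_pos hYpos]

/-- The group `P_{m,1}(ℤ) ∩ SL(m+1, ℤ)`, where `P_{m,1}` is the maximal parabolic subgroup of
block upper triangular matrices with diagonal blocks in `GL(m)` and `GL(1)`: the last row is zero
to the left of its last entry. -/
def parabolic (m : ℕ) : Subgroup SL(m + 1, ℤ) where
  carrier := {γ | ∀ j, j ≠ Fin.last m → γ.1 (Fin.last m) j = 0}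
  one_mem' := fun j hj => by simp [Matrix.one_apply_ne' hj]
  mul_mem' := by
    intro a b ha hb j hj
    change (a.1 * b.1) (Fin.last m) j = 0
    rw [Matrix.mul_apply]
    refine Finset.sum_eq_zero fun i _ => ?_
    by_cases hi : i = Fin.last m
    · rw [hi, hb j hj, mul_zero]
    · rw [ha i hi, zero_mul]
  inv_mem' := by
    intro a ha
    have key : ∀ j, (1 : Matrix (Fin (m + 1)) (Fin (m + 1)) ℤ) (Fin.last m) j =
        a.1 (Fin.last m) (Fin.last m) * (a⁻¹).1 (Fin.last m) j := by
      intro j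
      have h : a.1 * (a⁻¹).1 = 1 := congrArg Subtype.val (mul_inv_cancel a)
      rw [← h, Matrix.mul_apply]
      refine Finset.sum_eq_single _ (fun i _ hi => ?_) (by simp)
      rw [ha i hi, zero_mul]
    intro j hj
    have h1 := key (Fin.last m)
    have h2 := key j
    rw [Matrix.one_apply_eq] at h1
    rw [Matrix.one_apply_ne' hj] at h2
    rcases mul_eq_zero.1 h2.symm with h | h
    · rw [h, zero_mul] at h1
      exact absurd h1 one_ne_zero
    · exact h

/-- `Det (γ z)` for `γ ∈ SL(m+1, ℤ)`. -/
noncomputable def detAct {m : ℕ} (z : Matrix (Fin (m + 1)) (Fin (m + 1)) ℝ)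
    (γ : SL(m + 1, ℤ)) : ℝ :=
  iwasawaDet (γ.1.map (Int.cast : ℤ → ℝ) * z)

theorem detAct_parabolic_mul {m : ℕ} (z : Matrix (Fin (m + 1)) (Fin (m + 1)) ℝ)
    (p γ : SL(m + 1, ℤ)) (hp : p ∈ parabolic m) : detAct z (p * γ) = detAct z γ := by
  have hmap : (p * γ).1.map (Int.cast : ℤ → ℝ) * z =
      p.1.map (Int.cast : ℤ → ℝ) * (γ.1.map (Int.cast : ℤ → ℝ) * z) := by
    have : (p * γ).1.map (Int.cast : ℤ → ℝ) =
        p.1.map (Int.cast : ℤ → ℝ) * γ.1.map (Int.cast : ℤ → ℝ) :=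
      Matrix.map_mul (f := Int.castRingHom ℝ)
    rw [this, Matrix.mul_assoc]
  have hdet : (p.1.map (Int.cast : ℤ → ℝ)).det = 1 := by
    have h := (RingHom.map_det (Int.castRingHom ℝ) p.1).symm
    rw [p.2, map_one] at h
    exact h
  have hpp : (p.1 (Fin.last m) (Fin.last m) : ℝ) ^ 2 = 1 := by
    have h : p.1 * (p⁻¹).1 = 1 := congrArg Subtype.val (mul_inv_cancel p)
    have h1 := congrFun (congrFun h (Fin.last m)) (Fin.last m)
    rw [Matrix.mul_apply, Matrix.one_apply_eq, Finset.sum_eq_single (Fin.last m)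
      (fun i _ hi => by rw [hp i hi, zero_mul]) (by simp)] at h1
    rcases Int.eq_one_or_neg_one_of_mul_eq_one h1 with h2 | h2 <;> simp [h2]
  have hrow : ∀ j, (p.1.map (Int.cast : ℤ → ℝ) * (γ.1.map (Int.cast : ℤ → ℝ) * z))
      (Fin.last m) j = p.1 (Fin.last m) (Fin.last m) *
        (γ.1.map (Int.cast : ℤ → ℝ) * z) (Fin.last m) j := by
    intro j
    rw [Matrix.mul_apply]
    refine Finset.sum_eq_single _ (fun i _ hi => ?_) (by simp)
    rw [Matrix.map_apply, hp i hi, Int.cast_zero, zero_mul]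
  simp only [detAct, iwasawaDet, hmap, hrow, mul_pow, hpp, one_mul]
  rw [Matrix.det_mul, hdet, one_mul]

/-- The summand `Det (γ z) ^ s` of the Eisenstein series, as a function of the coset of `γ` in
`(P_{m,1}(ℤ) ∩ SL(m+1, ℤ)) \ SL(m+1, ℤ)`. -/
noncomputable def eisensteinTerm {m : ℕ} (z : Matrix (Fin (m + 1)) (Fin (m + 1)) ℝ) (s : ℂ) :
    Quotient (QuotientGroup.rightRel (parabolic m)) → ℂ :=
  Quotient.lift (fun γ : SL(m + 1, ℤ) => ((detAct z γ : ℝ) : ℂ) ^ s) (by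
    intro a b hab
    have h : b * a⁻¹ ∈ parabolic m := QuotientGroup.rightRel_apply.1 hab
    have h2 := detAct_parabolic_mul z (b * a⁻¹) a h
    rw [inv_mul_cancel_right] at h2
    simp only [h2])

/-- `E` is the maximal parabolic Eisenstein series `s ↦ E_{P_{m,1}}(z, s)`: it is given by the
(unconditionally) convergent series `∑ Det (γ z) ^ s` over the cosets `γ` in
`(P_{m,1}(ℤ) ∩ SL(m+1, ℤ)) \ SL(m+1, ℤ)` when `Re s > 1`, and it is meromorphic on `ℂ`. The
normal form (analytic at every point that is not a pole, value `0` at the poles) makes such a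
function unique; see `IsEisensteinSeries.unique`. -/
structure IsEisensteinSeries {m : ℕ} (z : Matrix (Fin (m + 1)) (Fin (m + 1)) ℝ) (E : ℂ → ℂ) :
    Prop where
  hasSum : ∀ s : ℂ, 1 < s.re → HasSum (eisensteinTerm z s) (E s)
  meromorphic : MeromorphicNFOn E Set.univ

theorem IsEisensteinSeries.unique {m : ℕ} {z : Matrix (Fin (m + 1)) (Fin (m + 1)) ℝ}
    {E F : ℂ → ℂ} (hE : IsEisensteinSeries z E) (hF : IsEisensteinSeries z F) : E = F := by
  have hEm : ∀ w, MeromorphicAt E w := fun w => (hE.meromorphic (Set.mem_univ w)).meromorphicAt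
  have hFm : ∀ w, MeromorphicAt F w := fun w => (hF.meromorphic (Set.mem_univ w)).meromorphicAt
  have hD : MeromorphicOn (E - F) Set.univ := fun w _ => (hEm w).sub (hFm w)
  have h2 : meromorphicOrderAt (E - F) 2 = ⊤ := by
    rw [meromorphicOrderAt_eq_top_iff]
    refine Filter.Eventually.filter_mono nhdsWithin_le_nhds ?_
    have ho : IsOpen {s : ℂ | 1 < s.re} := isOpen_lt continuous_const Complex.continuous_re
    filter_upwards [ho.mem_nhds (show (2 : ℂ) ∈ {s : ℂ | 1 < s.re} by simp)] with s hs
    rw [Pi.sub_apply, (hE.hasSum s hs).unique (hF.hasSum s hs), sub_self]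
  have hall : ∀ w, meromorphicOrderAt (E - F) w = ⊤ := by
    intro w
    by_contra hw
    exact hD.meromorphicOrderAt_ne_top_of_isPreconnected (x := w) (y := 2)
      isPreconnected_univ (Set.mem_univ _) (Set.mem_univ _) hw h2
  funext w
  have hev : E =ᶠ[nhdsWithin w {w}ᶜ] F := by
    have h := meromorphicOrderAt_eq_top_iff.1 (hall w)
    filter_upwards [h] with s hs
    exact sub_eq_zero.1 hs
  exact (((hE.meromorphic (Set.mem_univ w)).eventuallyEq_nhdsNE_iff_eventuallyEq_nhds
    (hF.meromorphic (Set.mem_univ w))).1 hev).eq_of_nhds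

/-- The sum over `1 ≤ k ≤ 2n` of
`(y₁ y₂² ⋯ y_{2n-k}^{2n-k})^{1/2} (y_{2n-k+1}^{k-1} y_{2n-k+2}^{k-2} ⋯ y_{2n-1})^{1/2}` and
`(y₁ y₂² ⋯ y_{2n-k}^{2n-k})^{(k-1)/(2n)}
  (y_{2n-k+1}^{k-1} y_{2n-k+2}^{k-2} ⋯ y_{2n-1})^{(2n-k+1)/(2n)}`. -/
noncomputable def monomialSum (n : ℕ) (y : ℕ → ℝ) : ℝ :=
  ∑ k ∈ Finset.Icc 1 (2 * n),
    ((∏ j ∈ Finset.Icc 1 (2 * n - k), y j ^ j) ^ (1 / 2 : ℝ) *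
        (∏ j ∈ Finset.Icc (2 * n - k + 1) (2 * n - 1), y j ^ (2 * n - j)) ^ (1 / 2 : ℝ) +
      (∏ j ∈ Finset.Icc 1 (2 * n - k), y j ^ j) ^ (((k : ℝ) - 1) / (2 * n)) *
        (∏ j ∈ Finset.Icc (2 * n - k + 1) (2 * n - 1), y j ^ (2 * n - j)) ^
          ((2 * (n : ℝ) - k + 1) / (2 * n)))

end MaxParabolic

/-!
The Eisenstein series is an Epstein zeta function in disguise, and the theorem is a bound for the
Mellin transform of a theta function along a rotated ray.

The cosets of the parabolic subgroup correspond to primitive integer vectors up to sign, through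
the last row of a matrix (`bijective_smul_lastRow`), and `Det (γ z)` is the `(-n)`-th power of the
value at this vector of the positive definite form `Q` of determinant one attached to `z`
(`detAct_eq`). Summing over all nonzero vectors instead of primitive ones multiplies the series by
`2 ζ(2ns)`, and the sum over all nonzero vectors is, up to a gamma factor, the Mellin transform at
`ns` of the theta series of `Q` (`hasSum_thetaPair_Λ`, `hasSum_eisensteinTerm`). Poisson summation
in the triangular coordinates (`tsum_primalForm_eq`) gives the functional equation of the theta
series, and with it the meromorphic continuation; the zeros of `ζ(2ns)` lie to the left of
`Re s = 1 / 2`, and its pole produces a zero of the Eisenstein series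
(`exists_isEisensteinSeries`).

For the bound, the Mellin transform is taken along the ray through `ω = exp (± i π / 4)` instead of
the positive reals. This multiplies it by `ω ^ (-ns)`, of absolute value `exp (π n |t| / 4)` for the
right sign. Along this ray the absolute values of the theta series and of its dual are bounded by
sums of Gaussians in the triangular coordinates, which are estimated one variable at a time; the
result is a sum of products `triWeight` of the diagonal entries of `z`, times a logarithm that comes
from the borderline integrals `∫ dt / t` (`exists_norm_thetaPair_Λ_le`). What is left are the lower
bounds for the factors divided out: `|Γ(n/2 + iτ)|` is of size `|τ| ^ ((n-1)/2) exp (-π |τ| / 2)`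
(`exists_le_norm_Gamma`), and `|ζ(n + iτ)|` is at least a constant times `(1 + |τ|) ^ (-4)`, which
for `n = 1` is a quantitative form of the nonvanishing of `ζ` on the line `Re s = 1`
(`exists_le_norm_riemannZeta`). The factor `exp (-π n |t| / 4)` gained by the rotation absorbs the
powers of `t` lost to the zeta function (`exists_norm_eisenstein_le`). Finally every `triWeight` is
one of the monomials in the statement (`triWeight_primal_le`, `triWeight_dual_le`).
-/

namespace MaxParabolic

open Real HurwitzZeta

/-! ### One-dimensional Gaussian sums -/

/-- The Gaussian sum `∑ exp (-π b m²)` over all integers `m`. -/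
noncomputable def gaussSum (b : ℝ) : ℝ := ∑' m : ℤ, exp (-π * b * (m : ℝ) ^ 2)

theorem summable_gauss_shift {b : ℝ} (hb : 0 < b) (α : ℝ) :
    Summable fun m : ℤ => exp (-π * b * ((m : ℝ) + α) ^ 2) := by
  refine (hasSum_int_evenKernel α hb).summable.congr fun m => ?_
  ring_nf

theorem summable_gauss {b : ℝ} (hb : 0 < b) :
    Summable fun m : ℤ => exp (-π * b * (m : ℝ) ^ 2) := by
  simpa using summable_gauss_shift hb 0

theorem gaussSum_inv {b : ℝ} (hb : 0 < b) : gaussSum b = (√b)⁻¹ * gaussSum b⁻¹ := by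
  have h := Real.tsum_exp_neg_mul_int_sq hb
  rw [gaussSum, h, gaussSum, sqrt_eq_rpow, one_div]
  simp only [div_eq_mul_inv]

theorem gaussSum_anti {b c : ℝ} (hb : 0 < b) (hbc : b ≤ c) : gaussSum c ≤ gaussSum b := by
  refine (summable_gauss (hb.trans_le hbc)).tsum_le_tsum (fun m => ?_) (summable_gauss hb)
  rw [exp_le_exp]
  have := mul_le_mul_of_nonneg_right hbc (mul_nonneg pi_pos.le (sq_nonneg (m : ℝ)))
  nlinarith

theorem one_le_gaussSum {b : ℝ} (hb : 0 < b) : 1 ≤ gaussSum b := by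
  have h := (summable_gauss hb).le_tsum 0 fun m _ => (exp_pos _).le
  simpa [gaussSum] using h

/-- A shift does not increase a Gaussian sum, because the Fourier coefficients of the sum as a
function of the shift are positive. -/
theorem tsum_gauss_shift_le {b : ℝ} (hb : 0 < b) (α : ℝ) :
    ∑' m : ℤ, exp (-π * b * ((m : ℝ) + α) ^ 2) ≤ gaussSum b := by
  have h1 : ∑' m : ℤ, exp (-π * b * ((m : ℝ) + α) ^ 2) = evenKernel α b := by
    rw [← (hasSum_int_evenKernel α hb).tsum_eq]
    exact tsum_congr fun m => by ring_nf
  have h2 : ‖((cosKernel α b⁻¹ : ℝ) : ℂ)‖ ≤ gaussSum b⁻¹ := by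
    have hb' : 0 < b⁻¹ := inv_pos.2 hb
    rw [← (hasSum_int_cosKernel α hb').tsum_eq]
    refine tsum_of_norm_bounded (summable_gauss hb').hasSum fun m => ?_
    rw [norm_mul, Complex.norm_real, norm_of_nonneg (exp_pos _).le,
      show (2 * π * Complex.I * α * m : ℂ) = ((2 * π * α * m : ℝ) : ℂ) * Complex.I by
        push_cast; ring, Complex.norm_exp_ofReal_mul_I, one_mul]
    exact le_of_eq (by ring_nf)
  rw [Complex.norm_real] at h2
  rw [h1, evenKernel_functional_equation, gaussSum_inv hb, ← sqrt_eq_rpow, one_div, one_div]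
  exact mul_le_mul_of_nonneg_left ((le_norm_self _).trans h2) (by positivity)

theorem gaussSum_le {b : ℝ} (hb : 0 < b) : gaussSum b ≤ gaussSum 1 * (1 + (√b)⁻¹) := by
  have h1 := one_le_gaussSum one_pos
  have h2 : 0 ≤ (√b)⁻¹ := by positivity
  rcases le_total 1 b with h | h
  · have := gaussSum_anti one_pos h
    nlinarith
  · rw [gaussSum_inv hb]
    have := gaussSum_anti one_pos ((one_le_inv₀ hb).2 h)
    nlinarith [mul_le_mul_of_nonneg_left this h2]

theorem gaussSum_sq_le {t s : ℝ} (ht : 0 < t) (hts : t ≤ s) :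
    gaussSum (t ^ 2) ≤ gaussSum 1 * (t⁻¹ * (1 + s)) := by
  refine (gaussSum_le (by positivity)).trans ?_
  rw [sqrt_sq ht.le]
  have h1 := one_le_gaussSum one_pos
  have : 1 + t⁻¹ ≤ t⁻¹ * (1 + s) := by
    rw [mul_add, mul_one, add_comm, add_le_add_iff_left, ← inv_mul_cancel₀ ht.ne']
    exact mul_le_mul_of_nonneg_left hts (by positivity)
  exact mul_le_mul_of_nonneg_left this (by linarith)

theorem gaussSum_sub_one_le {b : ℝ} (hb : 0 < b) :
    gaussSum b - 1 ≤ exp (-π * b / 2) * gaussSum (b / 2) := by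
  have hb2 : 0 < b / 2 := by positivity
  have hs : HasSum (fun m : ℤ => exp (-π * b / 2) * exp (-π * (b / 2) * (m : ℝ) ^ 2) +
      if m = 0 then 1 else 0) (exp (-π * b / 2) * gaussSum (b / 2) + 1) :=
    ((summable_gauss hb2).hasSum.mul_left _).add (hasSum_ite_eq 0 1)
  rw [sub_le_iff_le_add, ← hs.tsum_eq]
  refine (summable_gauss hb).tsum_le_tsum (fun m => ?_) hs.summable
  by_cases hm : m = 0
  · simp [hm, (exp_pos _).le]
  · simp only [hm, if_false, add_zero]
    rw [← exp_add, exp_le_exp]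
    have : (1 : ℝ) ≤ (m : ℝ) ^ 2 := by
      have : (1 : ℤ) ≤ m ^ 2 := by
        have := sq_pos_of_ne_zero hm
        omega
      exact_mod_cast this
    nlinarith [mul_pos pi_pos hb]

theorem gaussSum_sq_sub_one_le {t : ℝ} (ht : 0 < t) :
    gaussSum (t ^ 2) - 1 ≤ 2 * gaussSum 1 * (t⁻¹ * (1 + t)) * exp (-π * t ^ 2 / 2) := by
  refine (gaussSum_sub_one_le (by positivity)).trans ?_
  rw [mul_comm]
  refine mul_le_mul_of_nonneg_right ?_ (exp_pos _).le
  have h1 := one_le_gaussSum one_pos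
  have h2 : (t / 2) ^ 2 ≤ t ^ 2 / 2 := by nlinarith
  refine (gaussSum_anti (by positivity) h2).trans
    ((gaussSum_sq_le (s := t) (by positivity) (by linarith)).trans (le_of_eq ?_))
  rw [inv_div]
  ring

/-! ### Sums over triangular forms -/

/-- `IsTriForm N η Q` says that `Q` is a sum of squares
`∑ j, η j ^ 2 * (c j + αⱼ (c 0, …, c (j - 1))) ^ 2` in which the shift `αⱼ` of the `j`-th integer
coordinate is an arbitrary function of the earlier ones. -/
def IsTriForm : (N : ℕ) → (Fin N → ℝ) → ((Fin N → ℤ) → ℝ) → Prop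
  | 0, _, Q => ∀ c, Q c = 0
  | N + 1, η, Q => ∃ (α : ℝ) (R : ℤ → (Fin N → ℤ) → ℝ),
      (∀ m, IsTriForm N (Fin.tail η) (R m)) ∧
        ∀ m c, Q (Fin.cons m c) = η 0 ^ 2 * ((m : ℝ) + α) ^ 2 + R m c

/-- A triangular form in which every shift vanishes as soon as all earlier coordinates do. -/
def IsTriFormZero : (N : ℕ) → (Fin N → ℝ) → ((Fin N → ℤ) → ℝ) → Prop
  | 0, _, Q => ∀ c, Q c = 0
  | N + 1, η, Q => ∃ R : ℤ → (Fin N → ℤ) → ℝ,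
      IsTriFormZero N (Fin.tail η) (R 0) ∧ (∀ m, IsTriForm N (Fin.tail η) (R m)) ∧
        ∀ m c, Q (Fin.cons m c) = η 0 ^ 2 * (m : ℝ) ^ 2 + R m c

theorem IsTriFormZero.isTriForm {N : ℕ} {η : Fin N → ℝ} {Q : (Fin N → ℤ) → ℝ}
    (h : IsTriFormZero N η Q) : IsTriForm N η Q := by
  cases N with
  | zero => exact h
  | succ N =>
    obtain ⟨R, -, h2, h3⟩ := h
    exact ⟨0, R, h2, fun m c => by rw [h3, add_zero]⟩

theorem IsTriForm.nonneg {N : ℕ} {η : Fin N → ℝ} {Q : (Fin N → ℤ) → ℝ}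
    (h : IsTriForm N η Q) (c : Fin N → ℤ) : 0 ≤ Q c := by
  induction N with
  | zero => exact (h c).ge
  | succ N ih =>
    obtain ⟨α, R, h2, h3⟩ := h
    rw [← Fin.cons_self_tail c, h3]
    have := ih (h2 (c 0)) (Fin.tail c)
    positivity

theorem IsTriFormZero.map_zero {N : ℕ} {η : Fin N → ℝ} {Q : (Fin N → ℤ) → ℝ}
    (h : IsTriFormZero N η Q) : Q 0 = 0 := by
  induction N with
  | zero => exact h 0
  | succ N ih =>
    obtain ⟨R, h1, h2, h3⟩ := h
    rw [← Fin.cons_self_tail (0 : Fin (N + 1) → ℤ), h3]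
    have := ih h1
    have ht : Fin.tail (0 : Fin (N + 1) → ℤ) = 0 := rfl
    simpa [ht] using this

theorem IsTriFormZero.pos {N : ℕ} {η : Fin N → ℝ} {Q : (Fin N → ℤ) → ℝ}
    (h : IsTriFormZero N η Q) (hη : ∀ i, 0 < η i) {c : Fin N → ℤ} (hc : c ≠ 0) : 0 < Q c := by
  induction N with
  | zero => exact absurd (Subsingleton.elim _ _) hc
  | succ N ih =>
    obtain ⟨R, h1, h2, h3⟩ := h
    rw [← Fin.cons_self_tail c, h3]
    have hR := (h2 (c 0)).nonneg (Fin.tail c)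
    by_cases h0 : c 0 = 0
    · have ht : Fin.tail c ≠ 0 := by
        intro ht
        apply hc
        rw [← Fin.cons_self_tail c, h0, ht]
        funext i
        refine Fin.cases rfl (fun j => rfl) i
      have := ih h1 (fun i => hη i.succ) ht
      rw [h0]
      simpa using this
    · have h4 : (c 0 : ℝ) ≠ 0 := by exact_mod_cast h0
      have := hη 0
      positivity

/-- Splitting off the first coordinate in a nonnegative sum over `ℤ ^ (N + 1)`. -/
theorem summable_cons_iff {N : ℕ} {F : (Fin (N + 1) → ℤ) → ℝ} (hF : ∀ c, 0 ≤ F c) :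
    Summable F ↔ (∀ m : ℤ, Summable fun c : Fin N → ℤ => F (Fin.cons m c)) ∧
      Summable fun m : ℤ => ∑' c : Fin N → ℤ, F (Fin.cons m c) := by
  rw [← (Fin.consEquiv fun _ : Fin (N + 1) => ℤ).summable_iff, summable_prod_of_nonneg]
  · rfl
  · intro p
    exact hF _

theorem tsum_cons {N : ℕ} {F : (Fin (N + 1) → ℤ) → ℝ} (hF : ∀ c, 0 ≤ F c) (hs : Summable F) :
    ∑' c, F c = ∑' m : ℤ, ∑' c : Fin N → ℤ, F (Fin.cons m c) := by
  rw [← (Fin.consEquiv fun _ : Fin (N + 1) => ℤ).tsum_eq]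
  exact Summable.tsum_prod' ((Fin.consEquiv fun _ : Fin (N + 1) => ℤ).summable_iff.2 hs)
    ((summable_cons_iff hF).1 hs).1

theorem IsTriForm.summable_and_tsum_le {N : ℕ} {η : Fin N → ℝ} {Q : (Fin N → ℤ) → ℝ}
    (h : IsTriForm N η Q) (hη : ∀ i, 0 < η i) {a : ℝ} (ha : 0 < a) :
    (Summable fun c => exp (-π * a * Q c)) ∧
      ∑' c, exp (-π * a * Q c) ≤ ∏ i, gaussSum (a * η i ^ 2) := by
  induction N with
  | zero =>
    refine ⟨Summable.of_finite, ?_⟩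
    simp [show ∀ c, Q c = 0 from h]
  | succ N ih =>
    obtain ⟨α, R, h2, h3⟩ := h
    have hη0 := hη 0
    have hb : 0 < a * η 0 ^ 2 := by positivity
    set P := ∏ i : Fin N, gaussSum (a * Fin.tail η i ^ 2) with hP
    have key : ∀ m c, exp (-π * a * Q (Fin.cons m c)) =
        exp (-π * (a * η 0 ^ 2) * ((m : ℝ) + α) ^ 2) * exp (-π * a * R m c) := by
      intro m c
      rw [← exp_add, h3]
      ring_nf
    have hin : ∀ m, Summable fun c : Fin N → ℤ => exp (-π * a * Q (Fin.cons m c)) := by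
      intro m
      simp only [key]
      exact (ih (h2 m) fun i => hη i.succ).1.mul_left _
    have hle : ∀ m : ℤ, ∑' c : Fin N → ℤ, exp (-π * a * Q (Fin.cons m c)) ≤
        exp (-π * (a * η 0 ^ 2) * ((m : ℝ) + α) ^ 2) * P := by
      intro m
      simp only [key]
      rw [tsum_mul_left]
      exact mul_le_mul_of_nonneg_left (ih (h2 m) fun i => hη i.succ).2 (exp_pos _).le
    have hs2 := (summable_gauss_shift hb α).mul_right P
    have hs1 : Summable fun m : ℤ => ∑' c : Fin N → ℤ, exp (-π * a * Q (Fin.cons m c)) :=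
      Summable.of_nonneg_of_le (fun m => tsum_nonneg fun c => (exp_pos _).le) hle hs2
    have hs : Summable fun c => exp (-π * a * Q c) :=
      (summable_cons_iff fun c => (exp_pos _).le).2 ⟨hin, hs1⟩
    refine ⟨hs, ?_⟩
    rw [tsum_cons (fun c => (exp_pos _).le) hs, Fin.prod_univ_succ]
    refine (hs1.tsum_le_tsum hle hs2).trans ?_
    rw [tsum_mul_right]
    refine mul_le_mul_of_nonneg_right (tsum_gauss_shift_le hb α) ?_
    exact Finset.prod_nonneg fun i _ => zero_le_one.trans
      (one_le_gaussSum (mul_pos ha (pow_pos (hη i.succ) 2)))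

/-- The contribution to `∑ exp (-π a Q c)` of the integer vectors `c` whose first nonzero
coordinate is the `j`-th, up to a constant. -/
noncomputable def triTerm {N : ℕ} (η : Fin N → ℝ) (a : ℝ) (j : Fin N) : ℝ :=
  (∏ i, if j ≤ i then (√a * η i)⁻¹ else 1) * exp (-a * η j ^ 2 / 4)

theorem triTerm_nonneg {N : ℕ} {η : Fin N → ℝ} (hη : ∀ i, 0 < η i) (a : ℝ) (j : Fin N) :
    0 ≤ triTerm η a j := by
  refine mul_nonneg (Finset.prod_nonneg fun i _ => ?_) (exp_pos _).le
  have := hη i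
  split_ifs <;> positivity

theorem gauss_prod_le_triTerm {N : ℕ} {η : Fin (N + 1) → ℝ} (hη : ∀ i, 0 < η i)
    (hanti : Antitone η) {a : ℝ} (ha : 0 < a) :
    (gaussSum (a * η 0 ^ 2) - 1) * ∏ i : Fin N, gaussSum (a * η i.succ ^ 2) ≤
      2 * gaussSum 1 ^ (N + 1) * exp ((N + 1) ^ 2 / 4) * triTerm η a 0 := by
  have hsa : 0 < √a := sqrt_pos.2 ha
  have hsq : ∀ x : ℝ, a * x ^ 2 = (√a * x) ^ 2 := fun x => by rw [mul_pow, sq_sqrt ha.le]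
  have hK := one_le_gaussSum one_pos
  set t := √a * η 0 with ht
  have htpos : 0 < t := mul_pos hsa (hη 0)
  have h1 : gaussSum (a * η 0 ^ 2) - 1 ≤
      2 * gaussSum 1 * (t⁻¹ * (1 + t)) * exp (-π * t ^ 2 / 2) := by
    rw [hsq]
    exact gaussSum_sq_sub_one_le htpos
  have h2 : ∏ i : Fin N, gaussSum (a * η i.succ ^ 2) ≤
      ∏ i : Fin N, (gaussSum 1 * ((√a * η i.succ)⁻¹ * (1 + t))) := by
    refine Finset.prod_le_prod (fun i _ => ?_) fun i _ => ?_
    · have := hη i.succ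
      exact zero_le_one.trans (one_le_gaussSum (by positivity))
    · rw [hsq]
      exact gaussSum_sq_le (mul_pos hsa (hη _))
        (mul_le_mul_of_nonneg_left (hanti (Fin.zero_le _)) hsa.le)
  have h3 : (1 + t) ^ (N + 1) * exp (-π * t ^ 2 / 2) ≤
      exp ((N + 1) ^ 2 / 4) * exp (-a * η 0 ^ 2 / 4) := by
    have h4 : (1 + t) ^ (N + 1) ≤ exp ((N + 1) * t) := by
      have := pow_le_pow_left₀ (by positivity) (add_one_le_exp t) (N + 1)
      rw [← exp_nat_mul] at this
      rw [add_comm 1 t]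
      exact_mod_cast this
    refine (mul_le_mul_of_nonneg_right h4 (exp_pos _).le).trans ?_
    rw [← exp_add, ← exp_add, exp_le_exp, neg_mul a, hsq, ← ht]
    nlinarith [pi_gt_three, sq_nonneg (t - (N + 1) / 2), sq_nonneg t,
      mul_nonneg (sub_nonneg.2 pi_gt_three.le) (sq_nonneg t)]
  have h5 : (0 : ℝ) ≤ ∏ i : Fin N, gaussSum (a * η i.succ ^ 2) :=
    Finset.prod_nonneg fun i _ => by
      have := hη i.succ
      exact zero_le_one.trans (one_le_gaussSum (by positivity))
  have hprod : (0 : ℝ) ≤ ∏ i : Fin N, (√a * η i.succ)⁻¹ :=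
    Finset.prod_nonneg fun i _ => by
      have := hη i.succ
      positivity
  calc (gaussSum (a * η 0 ^ 2) - 1) * ∏ i : Fin N, gaussSum (a * η i.succ ^ 2)
      ≤ (2 * gaussSum 1 * (t⁻¹ * (1 + t)) * exp (-π * t ^ 2 / 2)) *
          ∏ i : Fin N, (gaussSum 1 * ((√a * η i.succ)⁻¹ * (1 + t))) :=
        mul_le_mul h1 h2 h5 (by positivity)
    _ = 2 * gaussSum 1 ^ (N + 1) * (t⁻¹ * ∏ i : Fin N, (√a * η i.succ)⁻¹) *
          ((1 + t) ^ (N + 1) * exp (-π * t ^ 2 / 2)) := by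
        rw [Finset.prod_mul_distrib, Finset.prod_mul_distrib]
        simp only [Finset.prod_const, Finset.card_univ, Fintype.card_fin]
        ring
    _ ≤ 2 * gaussSum 1 ^ (N + 1) * (t⁻¹ * ∏ i : Fin N, (√a * η i.succ)⁻¹) *
          (exp ((N + 1) ^ 2 / 4) * exp (-a * η 0 ^ 2 / 4)) :=
        mul_le_mul_of_nonneg_left h3 (by positivity)
    _ = _ := by
        rw [triTerm, Fin.prod_univ_succ]
        simp only [Fin.zero_le, if_true]
        ring

theorem triTerm_succ {N : ℕ} (η : Fin (N + 1) → ℝ) (a : ℝ) (j : Fin N) :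
    triTerm η a j.succ = triTerm (Fin.tail η) a j := by
  rw [triTerm, Fin.prod_univ_succ, triTerm]
  simp [Fin.tail]

/-- The sum of `exp (-π a Q)` over nonzero integer vectors is controlled, up to a constant that
depends on the dimension only, by the Gram-Schmidt lengths `η` of the form. -/
theorem exists_tsum_triForm_le (N : ℕ) : ∃ C : ℝ, 0 ≤ C ∧
    ∀ (η : Fin N → ℝ) (Q : (Fin N → ℤ) → ℝ), IsTriFormZero N η Q → (∀ i, 0 < η i) →
      Antitone η → ∀ a : ℝ, 0 < a →
        ∑' c, exp (-π * a * Q c) ≤ 1 + C * ∑ j, triTerm η a j := by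
  induction N with
  | zero =>
    refine ⟨0, le_rfl, fun η Q h _ _ a _ => ?_⟩
    simp [show ∀ c, Q c = 0 from h]
  | succ N ih =>
    obtain ⟨C, hC, ih⟩ := ih
    have hK := one_le_gaussSum one_pos
    refine ⟨C + 2 * gaussSum 1 ^ (N + 1) * exp ((N + 1) ^ 2 / 4), by positivity,
      fun η Q h hη hanti a ha => ?_⟩
    have hs := (h.isTriForm.summable_and_tsum_le hη ha).1
    obtain ⟨R, h0, h2, h3⟩ := h
    have hη0 := hη 0
    have hb : 0 < a * η 0 ^ 2 := by positivity
    set P := ∏ i : Fin N, gaussSum (a * η i.succ ^ 2) with hP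
    set B := ∑ j, triTerm (Fin.tail η) a j with hB
    have key : ∀ m c, exp (-π * a * Q (Fin.cons m c)) =
        exp (-π * (a * η 0 ^ 2) * (m : ℝ) ^ 2) * exp (-π * a * R m c) := by
      intro m c
      rw [← exp_add, h3]
      ring_nf
    have htail : Antitone (Fin.tail η) := fun i j hij => hanti (Fin.succ_le_succ_iff.2 hij)
    -- The vectors with first coordinate `0` obey the bound in dimension `N`.
    have hg : HasSum (fun m : ℤ => exp (-π * (a * η 0 ^ 2) * (m : ℝ) ^ 2) * P +
        if m = 0 then 1 + C * B - P else 0)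
        (gaussSum (a * η 0 ^ 2) * P + (1 + C * B - P)) :=
      ((summable_gauss hb).hasSum.mul_right P).add (hasSum_ite_eq 0 _)
    have hle : ∀ m : ℤ, ∑' c : Fin N → ℤ, exp (-π * a * Q (Fin.cons m c)) ≤
        exp (-π * (a * η 0 ^ 2) * (m : ℝ) ^ 2) * P + if m = 0 then 1 + C * B - P else 0 := by
      intro m
      simp only [key]
      rw [tsum_mul_left]
      by_cases hm : m = 0
      · subst hm
        have := ih _ _ h0 (fun i => hη i.succ) htail a ha
        simpa using this
      · simp only [hm, if_false, add_zero]
        exact mul_le_mul_of_nonneg_left ((h2 m).summable_and_tsum_le (fun i => hη i.succ) ha).2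
          (exp_pos _).le
    rw [tsum_cons (fun c => (exp_pos _).le) hs]
    have hs1 := ((summable_cons_iff fun c => (exp_pos _).le).1 hs).2
    refine (hs1.tsum_le_tsum hle hg.summable).trans ?_
    rw [hg.tsum_eq, Fin.sum_univ_succ]
    simp only [triTerm_succ]
    rw [← hB]
    have h6 := gauss_prod_le_triTerm hη hanti ha
    rw [← hP] at h6
    have hB0 : 0 ≤ B := Finset.sum_nonneg fun j _ => triTerm_nonneg (fun i => hη i.succ) a j
    have ht0 := triTerm_nonneg hη a 0
    set D := 2 * gaussSum 1 ^ (N + 1) * exp ((N + 1) ^ 2 / 4) with hD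
    have hD0 : 0 ≤ D := by positivity
    nlinarith [mul_nonneg hC ht0, mul_nonneg hD0 hB0]

end MaxParabolic

namespace MaxParabolic

open Real

/-! ### Triangular quadratic forms and Poisson summation -/

/-- The quadratic form `c ↦ ∑ j, η j ^ 2 * (c j + ∑ i < j, c i * X i j) ^ 2` on integer vectors. -/
noncomputable def primalForm {N : ℕ} (η : Fin N → ℝ) (X : Fin N → Fin N → ℝ) (c : Fin N → ℤ) : ℝ :=
  ∑ j, η j ^ 2 * ((c j : ℝ) + ∑ i, if i < j then (c i : ℝ) * X i j else 0) ^ 2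

/-- The form `primalForm η X` evaluated on a translate, the `j`-th square being shifted by `α j`. -/
noncomputable def shiftForm {N : ℕ} (η : Fin N → ℝ) (X : Fin N → Fin N → ℝ) (α : Fin N → ℝ)
    (c : Fin N → ℤ) : ℝ :=
  ∑ j, η j ^ 2 * ((c j : ℝ) + α j + ∑ i, if i < j then (c i : ℝ) * X i j else 0) ^ 2

theorem shiftForm_cons {N : ℕ} (η : Fin (N + 1) → ℝ) (X : Fin (N + 1) → Fin (N + 1) → ℝ)
    (α : Fin (N + 1) → ℝ) (m : ℤ) (c : Fin N → ℤ) :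
    shiftForm η X α (Fin.cons m c) = η 0 ^ 2 * ((m : ℝ) + α 0) ^ 2 +
      shiftForm (Fin.tail η) (fun i j => X i.succ j.succ)
        (fun j => α j.succ + m * X 0 j.succ) c := by
  simp only [shiftForm, Fin.sum_univ_succ, Fin.cons_zero, Fin.cons_succ, Fin.not_lt_zero, if_false,
    Finset.sum_const_zero, add_zero, Fin.succ_pos, if_true, Fin.succ_lt_succ_iff, Fin.tail,
    ← add_assoc]

theorem isTriForm_shiftForm {N : ℕ} (η : Fin N → ℝ) (X : Fin N → Fin N → ℝ) (α : Fin N → ℝ) :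
    IsTriForm N η (shiftForm η X α) := by
  induction N with
  | zero => intro c; simp [shiftForm]
  | succ N ih => exact ⟨α 0, _, fun m => ih _ _ _, fun m c => shiftForm_cons η X α m c⟩

theorem primalForm_eq_shiftForm {N : ℕ} (η : Fin N → ℝ) (X : Fin N → Fin N → ℝ) :
    primalForm η X = shiftForm η X 0 := by
  funext c
  simp [primalForm, shiftForm]

theorem isTriFormZero_primalForm {N : ℕ} (η : Fin N → ℝ) (X : Fin N → Fin N → ℝ) :
    IsTriFormZero N η (primalForm η X) := by
  induction N with
  | zero => intro c; simp [primalForm]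
  | succ N ih =>
    refine ⟨fun m => shiftForm (Fin.tail η) (fun i j => X i.succ j.succ)
      (fun j => m * X 0 j.succ), ?_, fun m => isTriForm_shiftForm _ _ _, fun m c => ?_⟩
    · have := ih (Fin.tail η) (fun i j => X i.succ j.succ)
      rw [primalForm_eq_shiftForm] at this
      convert this using 2
      funext j
      simp
    · rw [primalForm_eq_shiftForm, shiftForm_cons]
      simp

theorem primalForm_snoc {N : ℕ} (η : Fin (N + 1) → ℝ) (X : Fin (N + 1) → Fin (N + 1) → ℝ)
    (c : Fin N → ℤ) (m : ℤ) :
    primalForm η X (Fin.snoc c m) =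
      primalForm (fun i => η i.castSucc) (fun i j => X i.castSucc j.castSucc) c +
      η (Fin.last N) ^ 2 * ((m : ℝ) + ∑ i, (c i : ℝ) * X i.castSucc (Fin.last N)) ^ 2 := by
  simp only [primalForm, Fin.sum_univ_castSucc, Fin.snoc_castSucc, Fin.snoc_last,
    Fin.castSucc_lt_castSucc_iff, if_false, add_zero, Fin.castSucc_lt_last, if_true,
    (Fin.le_last _).not_gt]

/-- The form dual to `primalForm η X`, evaluated at the translate by `β` of an integer vector. The
coordinates are listed in reverse order, so that it is again a triangular form; its Gram-Schmidt
lengths are the inverses of those of `primalForm η X` in reverse order. -/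
noncomputable def dualForm : (N : ℕ) → (Fin N → ℝ) → (Fin N → Fin N → ℝ) → (Fin N → ℝ) →
    (Fin N → ℤ) → ℝ
  | 0, _, _, _, _ => 0
  | N + 1, η, X, β, e =>
      (η (Fin.last N))⁻¹ ^ 2 * ((e 0 : ℝ) + β (Fin.last N)) ^ 2 +
        dualForm N (fun i => η i.castSucc) (fun i j => X i.castSucc j.castSucc)
          (fun i => β i.castSucc - ((e 0 : ℝ) + β (Fin.last N)) * X i.castSucc (Fin.last N))
          (Fin.tail e)

theorem isTriForm_dualForm {N : ℕ} (η : Fin N → ℝ) (X : Fin N → Fin N → ℝ) (β : Fin N → ℝ) :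
    IsTriForm N (fun i => (η i.rev)⁻¹) (dualForm N η X β) := by
  induction N with
  | zero => intro c; rfl
  | succ N ih =>
    refine ⟨β (Fin.last N), fun m => dualForm N (fun i => η i.castSucc)
      (fun i j => X i.castSucc j.castSucc)
      (fun i => β i.castSucc - ((m : ℝ) + β (Fin.last N)) * X i.castSucc (Fin.last N)),
      fun m => ?_, fun m c => ?_⟩
    · have := ih (fun i => η i.castSucc) (fun i j => X i.castSucc j.castSucc)
        (fun i => β i.castSucc - ((m : ℝ) + β (Fin.last N)) * X i.castSucc (Fin.last N))
      convert this using 1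
      funext i
      simp [Fin.tail, Fin.rev_succ]
    · simp [dualForm]

theorem isTriFormZero_dualForm {N : ℕ} (η : Fin N → ℝ) (X : Fin N → Fin N → ℝ) :
    IsTriFormZero N (fun i => (η i.rev)⁻¹) (dualForm N η X 0) := by
  induction N with
  | zero => intro c; rfl
  | succ N ih =>
    refine ⟨fun m => dualForm N (fun i => η i.castSucc)
      (fun i j => X i.castSucc j.castSucc)
      (fun i => - ((m : ℝ) * X i.castSucc (Fin.last N))), ?_, fun m => ?_, fun m c => ?_⟩
    · have := ih (fun i => η i.castSucc) (fun i j => X i.castSucc j.castSucc)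
      convert this using 1
      · funext i
        simp [Fin.tail, Fin.rev_succ]
      · have h0 : (fun i : Fin N => -(((0 : ℤ) : ℝ) * X i.castSucc (Fin.last N))) = 0 := by
          funext i
          simp
        beta_reduce
        rw [h0]
    · have := isTriForm_dualForm (fun i => η i.castSucc) (fun i j => X i.castSucc j.castSucc)
        (fun i => - ((m : ℝ) * X i.castSucc (Fin.last N)))
      convert this using 1
      funext i
      simp [Fin.tail, Fin.rev_succ]
    · simp [dualForm]

theorem norm_cexp_gauss (u : ℂ) (T r : ℝ) :
    ‖Complex.exp (-π * u * T + 2 * π * Complex.I * r)‖ = exp (-π * u.re * T) := by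
  rw [Complex.norm_exp]
  congr 1
  simp

theorem inv_re_pos {u : ℂ} (hu : 0 < u.re) : 0 < u⁻¹.re := by
  rw [Complex.inv_re]
  exact div_pos hu (Complex.normSq_pos.2 fun h => by simp [h] at hu)

theorem ofReal_mul_cpow {r : ℝ} (hr : 0 < r) {u : ℂ} (hu : u ≠ 0) (s : ℂ) :
    ((r : ℂ) * u) ^ s = (r : ℂ) ^ s * u ^ s := by
  have hr0 : (r : ℂ) ≠ 0 := by exact_mod_cast hr.ne'
  rw [Complex.cpow_def_of_ne_zero (mul_ne_zero hr0 hu), Complex.cpow_def_of_ne_zero hr0,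
    Complex.cpow_def_of_ne_zero hu, ← Complex.exp_add, Complex.log_ofReal_mul hr hu,
    Complex.ofReal_log hr.le, add_mul]

theorem mul_sq_cpow_half {u : ℂ} (hu : 0 < u.re) {t : ℝ} (ht : 0 < t) :
    (u * (t : ℂ) ^ 2) ^ (1 / 2 : ℂ) = u ^ (1 / 2 : ℂ) * t := by
  have hu0 : u ≠ 0 := fun h => by simp [h] at hu
  rw [mul_comm u, mul_comm _ (t : ℂ), ← Complex.ofReal_pow, ofReal_mul_cpow (by positivity) hu0]
  congr 1
  rw [show (1 / 2 : ℂ) = ((1 / 2 : ℝ) : ℂ) by push_cast; rfl,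
    ← Complex.ofReal_cpow (by positivity), ← sqrt_eq_rpow, sqrt_sq ht.le]

/-- Poisson summation in one variable, for a shifted Gaussian with a phase. -/
theorem tsum_gauss_shift_phase {u : ℂ} (hu : 0 < u.re) {t : ℝ} (ht : 0 < t) (A β : ℝ) :
    ∑' m : ℤ, Complex.exp (-π * u * (t ^ 2 * ((m : ℝ) + A) ^ 2 : ℝ) +
        2 * π * Complex.I * (m * β : ℝ)) =
      1 / (u ^ (1 / 2 : ℂ) * t) * ∑' m : ℤ,
        Complex.exp (-π * u⁻¹ * (t⁻¹ ^ 2 * ((m : ℝ) + β) ^ 2 : ℝ) +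
          2 * π * Complex.I * (-(A * (m + β)) : ℝ)) := by
  have hu0 : u ≠ 0 := fun h => by simp [h] at hu
  have ht0 : (t : ℂ) ≠ 0 := by exact_mod_cast ht.ne'
  have ha : 0 < (u * (t : ℂ) ^ 2).re := by
    rw [← Complex.ofReal_pow, Complex.re_mul_ofReal]
    positivity
  have h := Complex.tsum_exp_neg_quadratic ha (-(u * (t : ℂ) ^ 2 * A) + Complex.I * β)
  have h1 : ∀ m : ℤ, Complex.exp (-π * u * (t ^ 2 * ((m : ℝ) + A) ^ 2 : ℝ) +
      2 * π * Complex.I * (m * β : ℝ)) =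
      Complex.exp (-π * (u * (t : ℂ) ^ 2) * (m : ℂ) ^ 2 +
        2 * π * (-(u * (t : ℂ) ^ 2 * A) + Complex.I * β) * m) *
        Complex.exp (-π * (u * t ^ 2) * A ^ 2) := by
    intro m
    rw [← Complex.exp_add]
    push_cast
    ring_nf
  have h2 : ∀ m : ℤ, Complex.exp (-π / (u * (t : ℂ) ^ 2) * ((m : ℂ) +
      Complex.I * (-(u * (t : ℂ) ^ 2 * A) + Complex.I * β)) ^ 2) *
        Complex.exp (-π * (u * t ^ 2) * A ^ 2) =
      Complex.exp (-π * u⁻¹ * (t⁻¹ ^ 2 * (((-m : ℤ) : ℝ) + β) ^ 2 : ℝ) +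
          2 * π * Complex.I * (-(A * ((-m : ℤ) + β)) : ℝ)) := by
    intro m
    rw [← Complex.exp_add]
    congr 1
    push_cast
    field_simp
    ring_nf
    simp only [Complex.I_sq, show Complex.I ^ 3 = -Complex.I by
      rw [pow_succ, Complex.I_sq]; ring, show Complex.I ^ 4 = 1 from Complex.I_pow_four]
    ring
  simp only [h1]
  rw [tsum_mul_right, h, mul_assoc, ← tsum_mul_right, mul_sq_cpow_half hu ht]
  simp only [h2]
  congr 1
  exact (Equiv.neg ℤ).tsum_eq fun m : ℤ =>
    Complex.exp (-π * u⁻¹ * (t⁻¹ ^ 2 * ((m : ℝ) + β) ^ 2 : ℝ) +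
          2 * π * Complex.I * (-(A * (m + β)) : ℝ))

theorem summable_cexp_triForm {N : ℕ} {η : Fin N → ℝ} {Q : (Fin N → ℤ) → ℝ}
    (h : IsTriForm N η Q) (hη : ∀ i, 0 < η i) {u : ℂ} (hu : 0 < u.re) (r : (Fin N → ℤ) → ℝ) :
    Summable fun c => Complex.exp (-π * u * Q c + 2 * π * Complex.I * r c) := by
  refine Summable.of_norm ?_
  simp only [norm_cexp_gauss]
  exact (h.summable_and_tsum_le hη hu).1

/-- Poisson summation for the theta series of a triangular form, with a phase `β`, one coordinate
at a time starting from the last. The phase is there for the induction: summing over the last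
coordinate turns its shift, which is linear in the others, into a phase in the others. -/
theorem tsum_primalForm_eq {N : ℕ} (η : Fin N → ℝ) (hη : ∀ i, 0 < η i)
    (X : Fin N → Fin N → ℝ) (β : Fin N → ℝ) {u : ℂ} (hu : 0 < u.re) :
    ∑' c : Fin N → ℤ, Complex.exp (-π * u * primalForm η X c +
        2 * π * Complex.I * (∑ j, (c j : ℝ) * β j : ℝ)) =
      1 / ((u ^ (1 / 2 : ℂ)) ^ N * (∏ j, η j : ℝ)) *
        ∑' e : Fin N → ℤ, Complex.exp (-π * u⁻¹ * dualForm N η X β e) := by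
  induction N with
  | zero => simp [primalForm, dualForm]
  | succ N ih =>
    set η' : Fin N → ℝ := fun i => η i.castSucc with hη'
    set X' : Fin N → Fin N → ℝ := fun i j => X i.castSucc j.castSucc with hX'
    set t := η (Fin.last N) with ht
    set b := β (Fin.last N) with hb
    have hη'0 : ∀ i, 0 < η' i := fun i => hη _
    have ht0 : 0 < t := hη _
    have hui := inv_re_pos hu
    set A : (Fin N → ℤ) → ℝ := fun c => ∑ i, (c i : ℝ) * X i.castSucc (Fin.last N) with hA
    set β' : ℤ → Fin N → ℝ := fun m i =>
      β i.castSucc - ((m : ℝ) + b) * X i.castSucc (Fin.last N) with hβ'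
    set G : ℤ → (Fin N → ℤ) → ℂ := fun m c =>
      Complex.exp (-π * u * primalForm η' X' c +
        2 * π * Complex.I * (∑ j, (c j : ℝ) * β' m j : ℝ)) *
      Complex.exp (-π * u⁻¹ * (t⁻¹ ^ 2 * ((m : ℝ) + b) ^ 2 : ℝ)) with hG
    have hlhs : ∑' c : Fin (N + 1) → ℤ, Complex.exp (-π * u * primalForm η X c +
        2 * π * Complex.I * (∑ j, (c j : ℝ) * β j : ℝ)) =
        ∑' c : Fin N → ℤ, 1 / (u ^ (1 / 2 : ℂ) * t) * ∑' m : ℤ, G m c := by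
      have hs := summable_cexp_triForm (isTriFormZero_primalForm η X).isTriForm hη hu
        (fun c => ∑ j, (c j : ℝ) * β j)
      let e : (Fin N → ℤ) × ℤ ≃ (Fin (N + 1) → ℤ) :=
        (Equiv.prodComm _ _).trans (Fin.snocEquiv fun _ : Fin (N + 1) => ℤ)
      rw [← e.tsum_eq]
      refine (Summable.tsum_prod (e.summable_iff.2 hs)).trans (tsum_congr fun c => ?_)
      have h1 : ∀ m : ℤ, Complex.exp (-π * u * primalForm η X (e (c, m)) +
          2 * π * Complex.I * (∑ j, (e (c, m) j : ℝ) * β j : ℝ)) =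
          Complex.exp (-π * u * primalForm η' X' c +
            2 * π * Complex.I * (∑ j, (c j : ℝ) * β j.castSucc : ℝ)) *
          Complex.exp (-π * u * (t ^ 2 * ((m : ℝ) + A c) ^ 2 : ℝ) +
            2 * π * Complex.I * (m * b : ℝ)) := by
        intro m
        have he : e (c, m) = Fin.snoc c m := rfl
        have hp : primalForm η X (Fin.snoc c m) =
          primalForm η' X' c + t ^ 2 * ((m : ℝ) + A c) ^ 2 := primalForm_snoc η X c m
        rw [← Complex.exp_add, he, hp, Fin.sum_univ_castSucc]
        simp only [Fin.snoc_castSucc, Fin.snoc_last, ← hb]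
        congr 1
        push_cast
        ring
      refine (tsum_congr h1).trans ?_
      rw [tsum_mul_left, tsum_gauss_shift_phase hu ht0, mul_left_comm, ← tsum_mul_left]
      congr 1
      refine tsum_congr fun m => ?_
      change _ = Complex.exp _ * Complex.exp _
      rw [← Complex.exp_add, ← Complex.exp_add]
      have h2 : ∑ j, (c j : ℝ) * β' m j = ∑ j, (c j : ℝ) * β j.castSucc - A c * (m + b) := by
        simp only [hβ', hA, mul_sub, Finset.sum_sub_distrib, Finset.sum_mul]
        congr 1
        exact Finset.sum_congr rfl fun i _ => by ring
      rw [h2]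
      congr 1
      push_cast
      ring
    have hGs : Summable (Function.uncurry G) := by
      refine Summable.of_norm ?_
      have h1 := (((isTriFormZero_primalForm η' X').isTriForm).summable_and_tsum_le hη'0 hu).1
      have h2 : Summable fun m : ℤ => exp (-π * u⁻¹.re * (t⁻¹ ^ 2 * ((m : ℝ) + b) ^ 2)) := by
        refine (summable_gauss_shift (b := u⁻¹.re * t⁻¹ ^ 2) (by positivity) b).congr fun m => ?_
        ring_nf
      refine (h2.mul_of_nonneg h1 (fun _ => (exp_pos _).le) fun _ => (exp_pos _).le).congr
        fun p => ?_
      have h3 := norm_cexp_gauss u⁻¹ (t⁻¹ ^ 2 * ((p.1 : ℝ) + b) ^ 2) 0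
      simp only [Complex.ofReal_zero, mul_zero, add_zero] at h3
      simp only [Function.uncurry, hG, norm_mul, norm_cexp_gauss, h3]
      ring
    have hrhs : ∑' e : Fin (N + 1) → ℤ, Complex.exp (-π * u⁻¹ * dualForm (N + 1) η X β e) =
        ∑' m : ℤ, Complex.exp (-π * u⁻¹ * (t⁻¹ ^ 2 * ((m : ℝ) + b) ^ 2 : ℝ)) *
          ∑' e : Fin N → ℤ, Complex.exp (-π * u⁻¹ * dualForm N η' X' (β' m) e) := by
      have hs := summable_cexp_triForm (isTriForm_dualForm η X β)
        (fun i => inv_pos.2 (hη _)) hui (fun _ => 0)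
      simp only [Complex.ofReal_zero, mul_zero, add_zero] at hs
      rw [← (Fin.consEquiv fun _ : Fin (N + 1) => ℤ).tsum_eq]
      refine (Summable.tsum_prod
        ((Fin.consEquiv fun _ : Fin (N + 1) => ℤ).summable_iff.2 hs)).trans
        (tsum_congr fun m => ?_)
      rw [← tsum_mul_left]
      refine tsum_congr fun c => ?_
      rw [← Complex.exp_add]
      change Complex.exp (-π * u⁻¹ * dualForm (N + 1) η X β (Fin.cons m c)) = _
      congr 1
      simp only [dualForm, Fin.cons_zero, Fin.tail_cons]
      push_cast
      ring
    rw [hlhs, hrhs, tsum_mul_left, Summable.tsum_comm hGs]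
    have h3 : ∀ m : ℤ, ∑' c, G m c = 1 / ((u ^ (1 / 2 : ℂ)) ^ N * (∏ j, η' j : ℝ)) *
        (Complex.exp (-π * u⁻¹ * (t⁻¹ ^ 2 * ((m : ℝ) + b) ^ 2 : ℝ)) *
          ∑' e : Fin N → ℤ, Complex.exp (-π * u⁻¹ * dualForm N η' X' (β' m) e)) := by
      intro m
      change ∑' c, Complex.exp _ * Complex.exp _ = _
      rw [tsum_mul_right, ih η' hη'0 X' (β' m)]
      ring
    simp only [h3]
    rw [tsum_mul_left, ← mul_assoc, Fin.prod_univ_castSucc, ← ht, ← hη']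
    congr 1
    rw [one_div_mul_one_div]
    congr 1
    push_cast
    ring

end MaxParabolic

namespace MaxParabolic

open Real Filter Topology Asymptotics MeasureTheory Set

/-! ### Theta series on a ray and their Mellin transforms -/

/-- The theta series `∑ exp (-π u Q c)` over all integer vectors `c`, for complex `u`. -/
noncomputable def theta {N : ℕ} (Q : (Fin N → ℤ) → ℝ) (u : ℂ) : ℂ :=
  ∑' c, Complex.exp (-π * u * Q c)

/-- The value at `a > 0` of the theta series without its constant term. -/
noncomputable def thetaTail {N : ℕ} (Q : (Fin N → ℤ) → ℝ) (a : ℝ) : ℝ :=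
  (∑' c, exp (-π * a * Q c)) - 1

theorem norm_cexp_mul (u : ℂ) (T : ℝ) : ‖Complex.exp (-π * u * T)‖ = exp (-π * u.re * T) := by
  simpa using norm_cexp_gauss u T 0

theorem summable_theta {N : ℕ} {η : Fin N → ℝ} {Q : (Fin N → ℤ) → ℝ}
    (h : IsTriForm N η Q) (hη : ∀ i, 0 < η i) {u : ℂ} (hu : 0 < u.re) :
    Summable fun c => Complex.exp (-π * u * Q c) := by
  refine Summable.of_norm ?_
  simp only [norm_cexp_mul]
  exact (h.summable_and_tsum_le hη hu).1

theorem hasSum_theta_sub_one {N : ℕ} {η : Fin N → ℝ} {Q : (Fin N → ℤ) → ℝ}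
    (h : IsTriFormZero N η Q) (hη : ∀ i, 0 < η i) {u : ℂ} (hu : 0 < u.re) :
    HasSum (fun c : {c : Fin N → ℤ // c ≠ 0} => Complex.exp (-π * u * Q c)) (theta Q u - 1) := by
  have h1 := (summable_theta h.isTriForm hη hu).hasSum
  have h2 := hasSum_ite_sub_hasSum h1 0
  rw [h.map_zero, Complex.ofReal_zero, mul_zero, Complex.exp_zero] at h2
  have h3 : Function.support (fun c : Fin N → ℤ =>
      if c = 0 then 0 else Complex.exp (-π * u * Q c)) ⊆ {c | c ≠ 0} := by
    intro c hc hc0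
    simp [hc0] at hc
  exact ((hasSum_subtype_iff_of_support_subset h3).2 h2).congr_fun fun c => (if_neg c.2).symm

theorem hasSum_thetaTail {N : ℕ} {η : Fin N → ℝ} {Q : (Fin N → ℤ) → ℝ}
    (h : IsTriFormZero N η Q) (hη : ∀ i, 0 < η i) {a : ℝ} (ha : 0 < a) :
    HasSum (fun c : {c : Fin N → ℤ // c ≠ 0} => exp (-π * a * Q c)) (thetaTail Q a) := by
  have h1 := hasSum_theta_sub_one h hη (u := a) (by simpa using ha)
  rw [← Complex.hasSum_ofReal]
  convert h1 using 1
  · funext c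
    push_cast
    rfl
  · rw [thetaTail, theta]
    push_cast
    rfl

theorem norm_theta_sub_one_le {N : ℕ} {η : Fin N → ℝ} {Q : (Fin N → ℤ) → ℝ}
    (h : IsTriFormZero N η Q) (hη : ∀ i, 0 < η i) {u : ℂ} (hu : 0 < u.re) :
    ‖theta Q u - 1‖ ≤ thetaTail Q u.re := by
  rw [← (hasSum_theta_sub_one h hη hu).tsum_eq]
  exact tsum_of_norm_bounded (hasSum_thetaTail h hη hu) fun c => (norm_cexp_mul _ _).le

theorem continuousOn_theta {N : ℕ} {η : Fin N → ℝ} {Q : (Fin N → ℤ) → ℝ}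
    (h : IsTriFormZero N η Q) (hη : ∀ i, 0 < η i) {ω : ℂ} (hω : 0 < ω.re) :
    ContinuousOn (fun x : ℝ => theta Q (ω * x)) (Ioi 0) := by
  intro x (hx : 0 < x)
  have hx2 : 0 < x / 2 := by positivity
  have hc : ContinuousOn (fun x : ℝ => theta Q (ω * x)) (Ioi (x / 2)) := by
    refine continuousOn_tsum (fun c => ?_)
      (h.isTriForm.summable_and_tsum_le hη (mul_pos hω hx2)).1 fun c y hy => ?_
    · fun_prop
    · rw [norm_cexp_mul, Complex.re_mul_ofReal, exp_le_exp]
      have h1 := h.isTriForm.nonneg c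
      have h2 : x / 2 ≤ y := le_of_lt hy
      have h3 := mul_le_mul_of_nonneg_left h2 (mul_nonneg (mul_nonneg pi_pos.le hω.le) h1)
      nlinarith
  exact (hc.continuousAt (Ioi_mem_nhds (by linarith))).continuousWithinAt

theorem thetaTail_isBigO {N : ℕ} {η : Fin N → ℝ} {Q : (Fin N → ℤ) → ℝ}
    (h : IsTriFormZero N η Q) (hη : ∀ i, 0 < η i) {κ : ℝ} (hκ : 0 < κ) (r : ℝ) :
    (fun x : ℝ => thetaTail Q (κ * x)) =O[atTop] (· ^ r) := by
  -- Every nonzero value of `Q` exceeds some `q > 0`: only finitely many are at most `1`, because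
  -- the theta series converges.
  obtain ⟨q, hq, hqQ⟩ : ∃ q > 0, ∀ c ≠ 0, q ≤ Q c := by
    have hs := (h.isTriForm.summable_and_tsum_le hη (inv_pos.2 pi_pos)).1
    have hf := hs.tendsto_cofinite_zero.eventually (gt_mem_nhds (exp_pos (-1)))
    rw [eventually_cofinite] at hf
    set S := (hf.toFinset.erase 0).image Q with hS
    have hSpos : ∀ v ∈ insert 1 S, (0 : ℝ) < v := by
      intro v hv
      rcases Finset.mem_insert.1 hv with rfl | hv
      · exact one_pos
      · obtain ⟨c, hc, rfl⟩ := Finset.mem_image.1 hv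
        exact h.pos hη (Finset.ne_of_mem_erase hc)
    refine ⟨(insert 1 S).min' (Finset.insert_nonempty _ _), hSpos _ (Finset.min'_mem _ _),
      fun c hc => ?_⟩
    by_cases h1 : Q c ≤ 1
    · refine Finset.min'_le _ _ (Finset.mem_insert_of_mem (Finset.mem_image_of_mem Q ?_))
      refine Finset.mem_erase.2 ⟨hc, hf.mem_toFinset.2 ?_⟩
      simp only [mem_ofPred_eq, not_lt, exp_le_exp]
      rw [neg_mul, mul_inv_cancel₀ pi_pos.ne']
      linarith
    · exact (Finset.min'_le _ _ (Finset.mem_insert_self _ _)).trans (not_le.1 h1).le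
  have hb : ∀ x : ℝ, 1 ≤ x → ‖thetaTail Q (κ * x)‖ ≤
      (thetaTail Q κ * exp (π * κ * q)) * ‖exp (-(π * κ * q) * x)‖ := by
    intro x hx
    have hx0 : 0 < x := one_pos.trans_le hx
    have h1 := hasSum_thetaTail h hη (mul_pos hκ hx0)
    have h2 := (hasSum_thetaTail h hη hκ).mul_right (exp (π * κ * q) * exp (-(π * κ * q) * x))
    rw [norm_of_nonneg (h1.nonneg fun c => (exp_pos _).le), norm_of_nonneg (exp_pos _).le,
      mul_assoc]
    refine hasSum_le (fun c => ?_) h1 h2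
    rw [← exp_add, ← exp_add, exp_le_exp]
    have h3 := hqQ c.1 c.2
    have h4 : 0 ≤ π * κ * (x - 1) * (Q c.1 - q) :=
      mul_nonneg (mul_nonneg (by positivity) (by linarith)) (by linarith)
    nlinarith
  refine IsBigO.trans (IsBigO.of_bound _ (eventually_atTop.2 ⟨1, hb⟩)) ?_
  exact (isLittleO_exp_neg_mul_rpow_atTop (by positivity) r).isBigO

theorem theta_sub_one_isBigO {N : ℕ} {η : Fin N → ℝ} {Q : (Fin N → ℤ) → ℝ}
    (h : IsTriFormZero N η Q) (hη : ∀ i, 0 < η i) {ω : ℂ} (hω : 0 < ω.re) (r : ℝ) :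
    (fun x : ℝ => theta Q (ω * x) - 1) =O[atTop] (· ^ r) := by
  refine IsBigO.trans (IsBigO.of_bound 1 ?_) (thetaTail_isBigO h hη hω r)
  filter_upwards [eventually_gt_atTop 0] with x hx
  have hre : (ω * x).re = ω.re * x := Complex.re_mul_ofReal _ _
  have := norm_theta_sub_one_le h hη (u := ω * x) (by rw [hre]; positivity)
  rw [hre] at this
  rw [one_mul]
  exact this.trans (le_norm_self _)

/-- The functional equation of the theta series of a form of determinant one in even dimension. -/
theorem theta_primalForm {N n : ℕ} (hN : N = 2 * n) {η : Fin N → ℝ} (hη : ∀ i, 0 < η i)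
    (hprod : ∏ i, η i = 1) (X : Fin N → Fin N → ℝ) {u : ℂ} (hu : 0 < u.re) :
    theta (primalForm η X) u = (u ^ n)⁻¹ * theta (dualForm N η X 0) u⁻¹ := by
  have h := tsum_primalForm_eq η hη X 0 hu
  have h2 : (u ^ (1 / 2 : ℂ)) ^ N = u ^ n := by
    rw [hN, pow_mul, ← Complex.cpow_nat_mul]
    norm_num
  rw [hprod, h2] at h
  simpa [theta] using h

/-- The pair of theta series of a triangular form and of its dual, on the rays through `ω` and
`ω⁻¹`. Rotating the ray by an angle `φ` multiplies the Mellin transform at `s` by `exp (-iφs)`. -/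
noncomputable def thetaPair {N n : ℕ} (hN : N = 2 * n) (hn : 1 ≤ n) {η : Fin N → ℝ}
    (hη : ∀ i, 0 < η i) (hprod : ∏ i, η i = 1) (X : Fin N → Fin N → ℝ) {ω : ℂ}
    (hω : 0 < ω.re) : WeakFEPair ℂ where
  f x := theta (primalForm η X) (ω * x)
  g x := theta (dualForm N η X 0) (ω⁻¹ * x)
  k := n
  ε := (ω ^ n)⁻¹
  f₀ := 1
  g₀ := 1
  hf_int := (continuousOn_theta (isTriFormZero_primalForm η X) hη hω).locallyIntegrableOn
    measurableSet_Ioi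
  hg_int := (continuousOn_theta (isTriFormZero_dualForm η X) (fun i => inv_pos.2 (hη _))
    (inv_re_pos hω)).locallyIntegrableOn measurableSet_Ioi
  hk := by exact_mod_cast hn
  hε := by
    have : ω ≠ 0 := fun h => by simp [h] at hω
    positivity
  h_feq x hx := by
    have hx0 : (0 : ℝ) < x := hx
    have hω0 : ω ≠ 0 := fun h => by simp [h] at hω
    have hxc : (x : ℂ) ≠ 0 := by exact_mod_cast hx0.ne'
    have hre : 0 < (ω * ((1 / x : ℝ) : ℂ)).re := by
      rw [Complex.re_mul_ofReal]
      positivity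
    rw [theta_primalForm hN hη hprod X hre, smul_eq_mul, rpow_natCast]
    congr 2
    · push_cast
      rw [mul_pow, mul_inv, one_div, inv_pow, inv_inv]
    · push_cast
      rw [mul_inv, one_div, inv_inv]
  hf_top r := theta_sub_one_isBigO (isTriFormZero_primalForm η X) hη hω r
  hg_top r := theta_sub_one_isBigO (isTriFormZero_dualForm η X) (fun i => inv_pos.2 (hη _))
    (inv_re_pos hω) r

theorem integrableOn_rpow_mul_exp {σ a : ℝ} (hσ : 0 < σ) (ha : 0 < a) :
    IntegrableOn (fun t : ℝ => t ^ (σ - 1) * exp (-a * t)) (Ioi 0) := by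
  simpa using integrableOn_rpow_mul_exp_neg_mul_rpow (p := 1) (by linarith) one_pos ha

theorem norm_cpow_mul_cexp (s r : ℂ) {t : ℝ} (ht : 0 < t) :
    ‖(t : ℂ) ^ (s - 1) * Complex.exp (-r * t)‖ = t ^ (s.re - 1) * exp (-r.re * t) := by
  rw [norm_mul, Complex.norm_cpow_eq_rpow_re_of_pos ht, Complex.norm_exp]
  simp

theorem aestronglyMeasurable_cpow_mul_cexp (s r : ℂ) :
    AEStronglyMeasurable (fun t : ℝ => (t : ℂ) ^ (s - 1) * Complex.exp (-r * t))
      (volume.restrict (Ioi 0)) := by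
  refine ContinuousOn.aestronglyMeasurable ?_ measurableSet_Ioi
  intro t ht
  have ht0 : (0 : ℝ) < t := ht
  refine ContinuousAt.continuousWithinAt (ContinuousAt.mul ?_ (by fun_prop))
  exact Complex.continuousAt_ofReal_cpow_const _ _ (Or.inr ht0.ne')

theorem integrableOn_cpow_mul_cexp {s r : ℂ} (hs : 0 < s.re) (hr : 0 < r.re) :
    IntegrableOn (fun t : ℝ => (t : ℂ) ^ (s - 1) * Complex.exp (-r * t)) (Ioi 0) := by
  refine (integrableOn_rpow_mul_exp hs hr).mono' (aestronglyMeasurable_cpow_mul_cexp s r) ?_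
  exact (ae_restrict_iff' measurableSet_Ioi).2 (ae_of_all _ fun t ht =>
    (norm_cpow_mul_cexp s r ht).le)

theorem hasDerivAt_integral_cpow_mul_cexp {s r : ℂ} (hs : 0 < s.re) (hr : 0 < r.re) :
    HasDerivAt (fun r : ℂ => ∫ t : ℝ in Ioi 0, (t : ℂ) ^ (s - 1) * Complex.exp (-r * t))
      (∫ t : ℝ in Ioi 0, (t : ℂ) ^ (s - 1) * (Complex.exp (-r * t) * (-t))) r := by
  have hr2 : 0 < r.re / 2 := by positivity
  refine (hasDerivAt_integral_of_dominated_loc_of_deriv_le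
    (bound := fun t : ℝ => t ^ ((s.re + 1) - 1) * exp (-(r.re / 2) * t))
    (F' := fun r t => (t : ℂ) ^ (s - 1) * (Complex.exp (-r * t) * (-t)))
    (Metric.ball_mem_nhds r hr2) (Eventually.of_forall fun z =>
      aestronglyMeasurable_cpow_mul_cexp s z) (integrableOn_cpow_mul_cexp hs hr) ?_ ?_
      (integrableOn_rpow_mul_exp (by linarith) hr2) ?_).2
  · have := (aestronglyMeasurable_cpow_mul_cexp s r).mul
      (f := fun t : ℝ => (t : ℂ) ^ (s - 1) * Complex.exp (-r * t)) (g := fun t : ℝ => -(t : ℂ))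
      (by fun_prop)
    refine this.congr (ae_of_all _ fun t => ?_)
    simp only [Pi.mul_apply]
    ring
  · refine (ae_restrict_iff' measurableSet_Ioi).2 (ae_of_all _ fun t ht z hz => ?_)
    have ht0 : (0 : ℝ) < t := ht
    have hz2 : r.re / 2 ≤ z.re := by
      have h1 := Complex.abs_re_le_norm (z - r)
      rw [Complex.sub_re] at h1
      have h2 := abs_le.1 (h1.trans (mem_ball_iff_norm.1 hz).le)
      linarith [h2.1]
    rw [← mul_assoc, norm_mul, norm_cpow_mul_cexp s z ht0, norm_neg, Complex.norm_real,
      norm_of_nonneg ht0.le, mul_right_comm]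
    have h3 : t ^ (s.re - 1) * t = t ^ ((s.re + 1) - 1) := by
      rw [← rpow_add_one ht0.ne']
      ring_nf
    rw [h3]
    refine mul_le_mul_of_nonneg_left (exp_le_exp.2 ?_) (rpow_nonneg ht0.le _)
    nlinarith
  · refine ae_of_all _ fun t z _ => ?_
    refine HasDerivAt.const_mul _ ?_
    have h1 : HasDerivAt (fun z : ℂ => -z * (t : ℂ)) (-t) z := by
      simpa using (hasDerivAt_id z).neg.mul_const (t : ℂ)
    exact h1.cexp

/-- The Mellin transform of `t ↦ exp (-r t)` for complex `r` in the right half plane, obtained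
from the case of real `r` by the identity theorem. -/
theorem integral_cpow_mul_cexp {s r : ℂ} (hs : 0 < s.re) (hr : 0 < r.re) :
    ∫ t : ℝ in Ioi 0, (t : ℂ) ^ (s - 1) * Complex.exp (-r * t) = r⁻¹ ^ s * Complex.Gamma s := by
  have hopen : IsOpen {z : ℂ | 0 < z.re} := isOpen_lt continuous_const Complex.continuous_re
  have hconv : Convex ℝ {z : ℂ | 0 < z.re} := convex_halfSpace_re_gt 0
  have h1 : AnalyticOnNhd ℂ
      (fun r : ℂ => ∫ t : ℝ in Ioi 0, (t : ℂ) ^ (s - 1) * Complex.exp (-r * t))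
      {z : ℂ | 0 < z.re} := by
    refine DifferentiableOn.analyticOnNhd (fun z hz => ?_) hopen
    exact (hasDerivAt_integral_cpow_mul_cexp hs hz).differentiableAt.differentiableWithinAt
  have h2 : AnalyticOnNhd ℂ (fun r : ℂ => r⁻¹ ^ s * Complex.Gamma s) {z : ℂ | 0 < z.re} := by
    refine DifferentiableOn.analyticOnNhd (fun z hz => ?_) hopen
    have hz0 : z ≠ 0 := fun h => by simp [h] at hz
    refine DifferentiableAt.differentiableWithinAt (DifferentiableAt.mul_const ?_ _)
    exact (differentiableAt_inv hz0).cpow_const (Or.inl (inv_re_pos hz))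
  have h3 : Tendsto (fun x : ℝ => (x : ℂ)) (𝓝[>] 1) (𝓝[≠] 1) := by
    refine tendsto_nhdsWithin_iff.2 ⟨?_, ?_⟩
    · exact (Complex.continuous_ofReal.tendsto' 1 1 (by simp)).mono_left nhdsWithin_le_nhds
    · filter_upwards [self_mem_nhdsWithin] with x hx h
      have : x = 1 := Complex.ofReal_eq_one.1 h
      exact (ne_of_gt hx) this
  refine h1.eqOn_of_preconnected_of_frequently_eq h2 hconv.isPreconnected
    (z₀ := 1) (by simp) (h3.frequently (Eventually.frequently ?_)) hr
  filter_upwards [self_mem_nhdsWithin] with x hx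
  have hx0 : (0 : ℝ) < x := one_pos.trans hx
  have := Complex.integral_cpow_mul_exp_neg_mul_Ioi hs hx0
  rw [one_div] at this
  rw [← this]
  simp only [neg_mul]

theorem cexp_theta_arg (u : ℂ) (x T : ℝ) :
    Complex.exp (-π * (u * x) * T) = Complex.exp (-((π * T : ℝ) * u) * x) := by
  push_cast
  ring_nf

/-- Convergence of the Epstein zeta series to the right of `n`: its partial sums are Mellin
transforms of partial sums of the theta series. -/
theorem summable_primalForm_rpow {N n : ℕ} {η : Fin N → ℝ} (X : Fin N → Fin N → ℝ)
    (hN : N = 2 * n) (hn : 1 ≤ n) (hη : ∀ i, 0 < η i) (hprod : ∏ i, η i = 1) {σ : ℝ} (hσ : n < σ) :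
    Summable fun c : {c : Fin N → ℤ // c ≠ 0} => (π * primalForm η X c)⁻¹ ^ σ := by
  have hσ0 : 0 < σ := (Nat.cast_nonneg n).trans_lt hσ
  have hone : (0 : ℝ) < (1 : ℂ).re := by simp
  have hQ := isTriFormZero_primalForm η X
  set P := thetaPair hN hn hη hprod X hone with hP
  have hc := (P.hasMellin (s := (σ : ℂ)) (by simpa [hP, thetaPair] using hσ)).1.norm
  set I := ∫ t : ℝ in Ioi 0, ‖(t : ℂ) ^ ((σ : ℂ) - 1) • (P.f t - P.f₀)‖ with hI
  have hG : 0 < Gamma σ := Gamma_pos_of_pos hσ0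
  refine summable_of_sum_le (c := I / Gamma σ) (fun c => ?_) fun S => ?_
  · have := hQ.pos hη c.2
    positivity
  · rw [le_div_iff₀ hG, Finset.sum_mul]
    have h1 : ∀ c ∈ S, (π * primalForm η X c)⁻¹ ^ σ * Gamma σ =
        ∫ t : ℝ in Ioi 0, t ^ (σ - 1) * exp (-(π * primalForm η X c * t)) := by
      intro c _
      have := hQ.pos hη c.2
      rw [integral_rpow_mul_exp_neg_mul_Ioi hσ0 (by positivity), one_div]
    have h2 : ∀ c ∈ S, IntegrableOn
        (fun t : ℝ => t ^ (σ - 1) * exp (-(π * primalForm η X c * t))) (Ioi 0) := by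
      intro c _
      have := hQ.pos hη c.2
      simpa only [neg_mul] using integrableOn_rpow_mul_exp hσ0
        (a := π * primalForm η X c) (by positivity)
    rw [Finset.sum_congr rfl h1, ← integral_finsetSum S h2]
    refine setIntegral_mono_on (integrable_finsetSum S h2) hc measurableSet_Ioi fun t ht => ?_
    have ht0 : (0 : ℝ) < t := ht
    have h3 := hasSum_thetaTail hQ hη ht0
    have h4 : P.f t - P.f₀ = (thetaTail (primalForm η X) t : ℂ) := by
      change theta (primalForm η X) (1 * t) - 1 = _
      rw [thetaTail, theta, one_mul]
      push_cast
      rfl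
    rw [h4, norm_smul, Complex.norm_cpow_eq_rpow_re_of_pos ht0, Complex.norm_real,
      norm_of_nonneg (h3.nonneg fun c => (exp_pos _).le), ← Finset.mul_sum]
    simp only [Complex.sub_re, Complex.ofReal_re, Complex.one_re]
    refine mul_le_mul_of_nonneg_left ?_ (rpow_nonneg ht0.le _)
    refine le_trans (le_of_eq ?_) (sum_le_hasSum S (fun c _ => (exp_pos _).le) h3)
    exact Finset.sum_congr rfl fun c _ => by ring_nf

/-- To the right of `n`, the Mellin transform attached to `thetaPair` is an Epstein zeta series. -/
theorem hasSum_thetaPair_Λ {N n : ℕ} {η : Fin N → ℝ} (X : Fin N → Fin N → ℝ)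
    (hN : N = 2 * n) (hn : 1 ≤ n) (hη : ∀ i, 0 < η i) (hprod : ∏ i, η i = 1) {ω : ℂ} (hω : 0 < ω.re) {s : ℂ} (hs : n < s.re) :
    HasSum (fun c : {c : Fin N → ℤ // c ≠ 0} =>
      ω⁻¹ ^ s * Complex.Gamma s * ((π * primalForm η X c : ℝ) : ℂ)⁻¹ ^ s)
      ((thetaPair hN hn hη hprod X hω).Λ s) := by
  have hs0 : 0 < s.re := (Nat.cast_nonneg n).trans_lt hs
  have hω0 : ω ≠ 0 := fun h => by simp [h] at hω
  have hQ := isTriFormZero_primalForm η X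
  set P := thetaPair hN hn hη hprod X hω with hP
  have hc := P.hasMellin (s := s) (by simpa [hP, thetaPair] using hs)
  set F : {c : Fin N → ℤ // c ≠ 0} → ℝ → ℂ := fun c t =>
    (t : ℂ) ^ (s - 1) * Complex.exp (-((π * primalForm η X c : ℝ) * ω) * t) with hF
  have hre : ∀ c : {c : Fin N → ℤ // c ≠ 0},
      0 < (((π * primalForm η X c : ℝ) : ℂ) * ω).re := by
    intro c
    have := hQ.pos hη c.2
    rw [Complex.re_ofReal_mul]
    positivity
  have hint : ∀ c, Integrable (F c) (volume.restrict (Ioi 0)) := fun c =>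
    integrableOn_cpow_mul_cexp hs0 (hre c)
  have hnorm : ∀ c : {c : Fin N → ℤ // c ≠ 0}, ∫ t : ℝ in Ioi 0, ‖F c t‖ =
      (π * primalForm η X c)⁻¹ ^ s.re * (ω.re⁻¹ ^ s.re * Gamma s.re) := by
    intro c
    have hc0 := hQ.pos hη c.2
    have h1 : ∫ t : ℝ in Ioi 0, ‖F c t‖ = ∫ t : ℝ in Ioi 0, t ^ (s.re - 1) *
        exp (-(((π * primalForm η X c : ℝ) * ω).re * t)) := by
      refine setIntegral_congr_fun measurableSet_Ioi fun t ht => ?_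
      simp only [hF]
      rw [norm_cpow_mul_cexp s _ ht, neg_mul]
    rw [h1, integral_rpow_mul_exp_neg_mul_Ioi hs0 (hre c), Complex.re_ofReal_mul, one_div,
      mul_inv, mul_rpow (by positivity) (by positivity), mul_assoc]
  have hsum := hasSum_integral_of_summable_integral_norm hint (by
    simp only [hnorm]
    exact (summable_primalForm_rpow X hN hn hη hprod hs).mul_right _)
  have htot : ∫ t : ℝ in Ioi 0, ∑' c, F c t = P.Λ s := by
    rw [← hc.2, mellin]
    refine setIntegral_congr_fun measurableSet_Ioi fun t ht => ?_
    have ht0 : (0 : ℝ) < t := ht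
    have h1 := hasSum_theta_sub_one hQ hη (u := ω * t) (by
      rw [Complex.re_mul_ofReal]
      positivity)
    simp only [cexp_theta_arg] at h1
    exact (h1.mul_left ((t : ℂ) ^ (s - 1))).tsum_eq
  rw [htot] at hsum
  refine hsum.congr_fun fun c => ?_
  have hc0 := hQ.pos hη c.2
  simp only [hF]
  rw [integral_cpow_mul_cexp hs0 (hre c), mul_inv, ← Complex.ofReal_inv,
    ofReal_mul_cpow (by positivity) (inv_ne_zero hω0)]
  ring

/-! ### Bounds for the completed Epstein zeta function on the line of symmetry -/

theorem integrableOn_and_integral_le_of_le {S : Set ℝ} (hS : MeasurableSet S) {f h : ℝ → ℝ}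
    (hf : AEStronglyMeasurable f (volume.restrict S)) (hf0 : ∀ x ∈ S, 0 ≤ f x)
    (hfh : ∀ x ∈ S, f x ≤ h x) (hh : IntegrableOn h S) :
    IntegrableOn f S ∧ ∫ x in S, f x ≤ ∫ x in S, h x := by
  have h1 : IntegrableOn f S := by
    refine hh.mono' hf ((ae_restrict_iff' hS).2 (ae_of_all _ fun x hx => ?_))
    rw [norm_of_nonneg (hf0 x hx)]
    exact hfh x hx
  exact ⟨h1, setIntegral_mono_on h1 hh hS hfh⟩

theorem aestronglyMeasurable_rpow_mul_exp (r μ : ℝ) :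
    AEStronglyMeasurable (fun x : ℝ => x ^ (r - 1) * exp (-μ * x)) (volume.restrict (Ioi 1)) := by
  have : Measurable fun x : ℝ => x ^ (r - 1) * exp (-μ * x) := by fun_prop
  exact this.aestronglyMeasurable

/-- A truncation of `∫ dx / x` at the height `T`, by which the exponential has begun to decay. This
borderline integral is the source of the logarithm in the final bound. -/
theorem integral_inv_mul_exp_le {μ T : ℝ} (hμ : 0 < μ) (hT : 1 ≤ T) (hT2 : μ⁻¹ ≤ T) :
    IntegrableOn (fun x : ℝ => x ^ ((0 : ℝ) - 1) * exp (-μ * x)) (Ioi 1) ∧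
      ∫ x in Ioi (1 : ℝ), x ^ ((0 : ℝ) - 1) * exp (-μ * x) ≤ log T + 1 := by
  have hT0 : 0 < T := one_pos.trans_le hT
  have hexp : IntegrableOn (fun x : ℝ => exp (-μ * x)) (Ioi 0) := by
    simpa using integrableOn_rpow_mul_exp one_pos hμ
  have hexp1 : IntegrableOn (fun x : ℝ => exp (-μ * x)) (Ioi 1) :=
    hexp.mono_set (Ioi_subset_Ioi zero_le_one)
  have hinv : IntegrableOn (fun x : ℝ => x⁻¹) (Ioc 1 T) := by
    refine (ContinuousOn.integrableOn_Icc
      (ContinuousOn.inv₀ continuousOn_id fun x hx => ?_)).mono_set Ioc_subset_Icc_self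
    exact (one_pos.trans_le hx.1).ne'
  have hind : IntegrableOn ((Ioc 1 T).indicator fun x : ℝ => x⁻¹) (Ioi 1) := by
    rw [integrableOn_indicator_iff measurableSet_Ioc]
    exact hinv.mono_set inter_subset_left
  have key := integrableOn_and_integral_le_of_le measurableSet_Ioi
    (aestronglyMeasurable_rpow_mul_exp 0 μ)
    (h := fun x => (Ioc 1 T).indicator (fun x : ℝ => x⁻¹) x + T⁻¹ * exp (-μ * x))
    (fun x hx => mul_nonneg (rpow_nonneg (one_pos.trans hx).le _) (exp_pos _).le)
    (fun x hx => ?_) (hind.add (hexp1.const_mul _))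
  · refine ⟨key.1, key.2.trans ?_⟩
    rw [integral_add hind (hexp1.const_mul _), setIntegral_indicator measurableSet_Ioc,
      inter_eq_right.2 Ioc_subset_Ioi_self, integral_const_mul,
      ← intervalIntegral.integral_of_le hT, integral_inv_of_pos one_pos hT0, div_one]
    have h1 : ∫ x in Ioi (1 : ℝ), exp (-μ * x) ≤ ∫ x in Ioi (0 : ℝ), exp (-μ * x) :=
      setIntegral_mono_set hexp (ae_of_all _ fun x => (exp_pos _).le)
        (Ioi_subset_Ioi zero_le_one).eventuallyLE
    have h2 : ∫ x in Ioi (0 : ℝ), exp (-μ * x) = μ⁻¹ := by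
      have := integral_rpow_mul_exp_neg_mul_Ioi one_pos hμ
      simpa using this
    have h3 : T⁻¹ * ∫ x in Ioi (1 : ℝ), exp (-μ * x) ≤ T⁻¹ * T :=
      mul_le_mul_of_nonneg_left (by linarith) (by positivity)
    rw [inv_mul_cancel₀ hT0.ne'] at h3
    linarith
  · have hx0 : (0 : ℝ) < x := one_pos.trans hx
    rw [zero_sub, rpow_neg_one]
    have he : exp (-μ * x) ≤ 1 := by
      rw [exp_le_one_iff]
      nlinarith
    have hxi : 0 < x⁻¹ := by positivity
    by_cases hxT : x ≤ T
    · rw [indicator_of_mem (show x ∈ Ioc 1 T from ⟨hx, hxT⟩)]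
      have : 0 ≤ T⁻¹ * exp (-μ * x) := by positivity
      nlinarith
    · rw [indicator_of_notMem (fun h => hxT h.2), zero_add]
      exact mul_le_mul_of_nonneg_right (inv_anti₀ hT0 (not_le.1 hxT).le) (exp_pos _).le

/-- The integral to which a `triTerm` with `A` factors under its product leads. For `A < n` the whole
gamma integral is needed, for `A = n` the integral is logarithmic, and for `A > n` it converges
without the exponential; the truncated exponent `n - A` covers the last two cases. -/
theorem exists_integral_rpow_mul_exp_le (n A : ℕ) {κ : ℝ} (hκ : 0 < κ) (hκ1 : κ ≤ 1) :
    ∃ K : ℝ, 0 ≤ K ∧ ∀ e B : ℝ, 0 < e → 0 ≤ B → exp (-B) ≤ e →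
      IntegrableOn (fun x : ℝ => x ^ (((n : ℝ) - A) / 2 - 1) * exp (-(κ * e ^ 2 / 4) * x)) (Ioi 1) ∧
        ∫ x in Ioi (1 : ℝ), x ^ (((n : ℝ) - A) / 2 - 1) * exp (-(κ * e ^ 2 / 4) * x) ≤
          K * (e⁻¹ ^ (n - A) * (1 + B)) := by
  rcases lt_trichotomy A n with h | h | h
  · have hr : 0 < ((n : ℝ) - A) / 2 := by
      have : (A : ℝ) < n := by exact_mod_cast h
      linarith
    set r := ((n : ℝ) - A) / 2 with hrdef
    have hG := Gamma_pos_of_pos hr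
    refine ⟨(4 / κ) ^ r * Gamma r, by positivity, fun e B he hB _ => ?_⟩
    have hμ : 0 < κ * e ^ 2 / 4 := by positivity
    have h0 := integrableOn_rpow_mul_exp hr hμ
    refine ⟨h0.mono_set (Ioi_subset_Ioi zero_le_one), ?_⟩
    have h1 : ∫ x in Ioi (1 : ℝ), x ^ (r - 1) * exp (-(κ * e ^ 2 / 4) * x) ≤
        ∫ x in Ioi (0 : ℝ), x ^ (r - 1) * exp (-(κ * e ^ 2 / 4) * x) :=
      setIntegral_mono_set h0 ((ae_restrict_iff' measurableSet_Ioi).2 (ae_of_all _ fun x hx =>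
        mul_nonneg (rpow_nonneg (le_of_lt hx) _) (exp_pos _).le))
        (Ioi_subset_Ioi zero_le_one).eventuallyLE
    refine h1.trans ?_
    simp only [neg_mul]
    rw [integral_rpow_mul_exp_neg_mul_Ioi hr hμ]
    have h2 : (1 / (κ * e ^ 2 / 4)) ^ r = (4 / κ) ^ r * e⁻¹ ^ (n - A) := by
      rw [show 1 / (κ * e ^ 2 / 4) = 4 / κ * e⁻¹ ^ 2 by field_simp,
        mul_rpow (by positivity) (by positivity), ← rpow_natCast e⁻¹ 2,
        ← rpow_mul (by positivity), ← rpow_natCast e⁻¹ (n - A)]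
      congr 2
      rw [Nat.cast_sub h.le, hrdef]
      push_cast
      ring
    rw [h2]
    have h3 : 0 ≤ (4 / κ) ^ r * e⁻¹ ^ (n - A) * Gamma r := by positivity
    nlinarith [mul_nonneg h3 hB]
  · subst h
    have hκ4 : 1 ≤ 4 / κ := by
      rw [le_div_iff₀ hκ]
      linarith
    have hlog := log_nonneg hκ4
    refine ⟨log (4 / κ) + 2, by positivity, fun e B he hB hBe => ?_⟩
    have hT : (1 : ℝ) ≤ 4 / κ * exp (2 * B) := by
      have : 1 ≤ exp (2 * B) := one_le_exp (by linarith)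
      nlinarith
    have hT2 : (κ * e ^ 2 / 4)⁻¹ ≤ 4 / κ * exp (2 * B) := by
      rw [show (κ * e ^ 2 / 4)⁻¹ = 4 / κ * e⁻¹ ^ 2 by field_simp]
      refine mul_le_mul_of_nonneg_left ?_ (by positivity)
      have h1 : e⁻¹ ≤ exp B := by
        rw [← inv_inv (exp B), ← exp_neg]
        exact inv_anti₀ (exp_pos _) hBe
      calc e⁻¹ ^ 2 ≤ exp B ^ 2 := pow_le_pow_left₀ (by positivity) h1 2
        _ = exp (2 * B) := by rw [← exp_nat_mul]; norm_num
    have h1 := integral_inv_mul_exp_le (by positivity) hT hT2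
    simp only [sub_self, zero_div, pow_zero, one_mul, Nat.sub_self]
    refine ⟨h1.1, h1.2.trans ?_⟩
    rw [log_mul (by positivity) (exp_pos _).ne', log_exp]
    nlinarith
  · have hr : ((n : ℝ) - A) / 2 - 1 ≤ -(3 / 2) := by
      have : (n : ℝ) + 1 ≤ A := by exact_mod_cast h
      linarith
    refine ⟨2, by norm_num, fun e B he hB _ => ?_⟩
    have h1 := integrableOn_and_integral_le_of_le measurableSet_Ioi
      (aestronglyMeasurable_rpow_mul_exp (((n : ℝ) - A) / 2) (κ * e ^ 2 / 4))
      (h := fun x => x ^ (-(3 / 2) : ℝ))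
      (fun x hx => mul_nonneg (rpow_nonneg (one_pos.trans hx).le _) (exp_pos _).le)
      (fun x hx => ?_) (integrableOn_Ioi_rpow_of_lt (by norm_num) one_pos)
    · refine ⟨h1.1, h1.2.trans ?_⟩
      rw [integral_Ioi_rpow_of_lt (by norm_num) one_pos, Nat.sub_eq_zero_of_le h.le]
      norm_num
      linarith
    · have hx1 : (1 : ℝ) < x := hx
      have he1 : exp (-(κ * e ^ 2 / 4) * x) ≤ 1 := by
        rw [exp_le_one_iff]
        have : 0 < κ * e ^ 2 / 4 * x := by positivity
        linarith
      calc x ^ (((n : ℝ) - A) / 2 - 1) * exp (-(κ * e ^ 2 / 4) * x)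
          ≤ x ^ (((n : ℝ) - A) / 2 - 1) * 1 :=
            mul_le_mul_of_nonneg_left he1 (by positivity)
        _ ≤ _ := by
            rw [mul_one]
            exact rpow_le_rpow_of_exponent_le hx1.le hr

/-- The size of the contribution to the completed Epstein zeta function, on its line of symmetry
and up to a logarithm, of the integer vectors whose first nonzero coordinate is the `j`-th. The
subtraction in the exponent is truncated. -/
noncomputable def triWeight {N : ℕ} (n : ℕ) (η : Fin N → ℝ) (j : Fin N) : ℝ :=
  (∏ i, if j ≤ i then (η i)⁻¹ else 1) * (η j)⁻¹ ^ (n - (N - (j : ℕ)))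

theorem triWeight_pos {N : ℕ} (n : ℕ) {η : Fin N → ℝ} (hη : ∀ i, 0 < η i) (j : Fin N) :
    0 < triWeight n η j := by
  have := hη j
  refine mul_pos (Finset.prod_pos fun i _ => ?_) (by positivity)
  have := hη i
  split_ifs <;> positivity

theorem prod_ite_le_const {N : ℕ} (j : Fin N) (c : ℝ) :
    (∏ i, if j ≤ i then c else 1) = c ^ (N - (j : ℕ)) := by
  rw [Finset.prod_ite, Finset.prod_const_one, mul_one, Finset.prod_const]
  congr 1
  rw [← Fin.card_Ici]
  congr 1
  ext i
  simp

theorem rpow_mul_triTerm {N : ℕ} (n : ℕ) (η : Fin N → ℝ) {κ x : ℝ} (hκ : 0 < κ)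
    (hx : 0 < x) (j : Fin N) :
    x ^ ((n : ℝ) / 2 - 1) * triTerm η (κ * x) j =
      ((√κ)⁻¹ ^ (N - (j : ℕ)) * ∏ i, if j ≤ i then (η i)⁻¹ else 1) *
        (x ^ (((n : ℝ) - (N - (j : ℕ) : ℕ)) / 2 - 1) * exp (-(κ * η j ^ 2 / 4) * x)) := by
  have h1 : (∏ i, if j ≤ i then (√(κ * x) * η i)⁻¹ else 1) =
      (√κ)⁻¹ ^ (N - (j : ℕ)) * (√x)⁻¹ ^ (N - (j : ℕ)) * ∏ i, if j ≤ i then (η i)⁻¹ else 1 := by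
    rw [← prod_ite_le_const, ← prod_ite_le_const, ← Finset.prod_mul_distrib,
      ← Finset.prod_mul_distrib]
    refine Finset.prod_congr rfl fun i _ => ?_
    split_ifs
    · rw [sqrt_mul hκ.le, mul_inv, mul_inv]
    · simp
  have h2 : x ^ ((n : ℝ) / 2 - 1) * (√x)⁻¹ ^ (N - (j : ℕ)) =
      x ^ (((n : ℝ) - (N - (j : ℕ) : ℕ)) / 2 - 1) := by
    rw [sqrt_eq_rpow, ← rpow_neg hx.le, ← rpow_natCast, ← rpow_mul hx.le, ← rpow_add hx]
    congr 1
    ring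
  rw [triTerm, h1, ← h2, show -(κ * x) * η j ^ 2 / 4 = -(κ * η j ^ 2 / 4) * x by ring]
  ring

theorem exists_integral_triTerm_le (N n : ℕ) {κ : ℝ} (hκ : 0 < κ) (hκ1 : κ ≤ 1) :
    ∃ K : ℝ, 0 ≤ K ∧ ∀ (η : Fin N → ℝ) (B : ℝ), (∀ i, 0 < η i) → 0 ≤ B →
      (∀ i, exp (-B) ≤ η i) → ∀ j,
        IntegrableOn (fun x : ℝ => x ^ ((n : ℝ) / 2 - 1) * triTerm η (κ * x) j) (Ioi 1) ∧
        ∫ x in Ioi (1 : ℝ), x ^ ((n : ℝ) / 2 - 1) * triTerm η (κ * x) j ≤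
          K * (triWeight n η j * (1 + B)) := by
  choose K hK0 hK using fun A : ℕ => exists_integral_rpow_mul_exp_le n A hκ hκ1
  refine ⟨∑ j : Fin N, (√κ)⁻¹ ^ (N - (j : ℕ)) * K (N - (j : ℕ)),
    Finset.sum_nonneg fun j _ => mul_nonneg (by positivity) (hK0 _), fun η B hη hB hBη j => ?_⟩
  obtain ⟨h1, h2⟩ := hK (N - (j : ℕ)) (η j) B (hη j) hB (hBη j)
  have hcongr : ∀ x ∈ Ioi (1 : ℝ), x ^ ((n : ℝ) / 2 - 1) * triTerm η (κ * x) j = _ :=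
    fun x hx => rpow_mul_triTerm n η hκ (one_pos.trans hx) j
  have hP : 0 ≤ ∏ i, if j ≤ i then (η i)⁻¹ else 1 := Finset.prod_nonneg fun i _ => by
    have := hη i
    split_ifs <;> positivity
  refine ⟨IntegrableOn.congr_fun (h1.const_mul _) (fun x hx => (hcongr x hx).symm)
    measurableSet_Ioi, ?_⟩
  rw [setIntegral_congr_fun measurableSet_Ioi hcongr, integral_const_mul]
  refine (mul_le_mul_of_nonneg_left h2 (mul_nonneg (by positivity) hP)).trans ?_
  have h3 : (√κ)⁻¹ ^ (N - (j : ℕ)) * K (N - (j : ℕ)) ≤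
      ∑ j : Fin N, (√κ)⁻¹ ^ (N - (j : ℕ)) * K (N - (j : ℕ)) :=
    Finset.single_le_sum (f := fun j : Fin N => (√κ)⁻¹ ^ (N - (j : ℕ)) * K (N - (j : ℕ)))
      (fun j _ => mul_nonneg (by positivity) (hK0 _)) (Finset.mem_univ j)
  have h4 : 0 ≤ triWeight n η j * (1 + B) :=
    mul_nonneg (triWeight_pos n hη j).le (by linarith)
  refine le_trans (le_of_eq ?_) (mul_le_mul_of_nonneg_right h3 h4)
  rw [triWeight]
  ring

theorem exists_thetaTail_le (N : ℕ) : ∃ C : ℝ, 0 ≤ C ∧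
    ∀ (η : Fin N → ℝ) (Q : (Fin N → ℤ) → ℝ), IsTriFormZero N η Q → (∀ i, 0 < η i) →
      Antitone η → ∀ a : ℝ, 0 < a → thetaTail Q a ≤ C * ∑ j, triTerm η a j := by
  obtain ⟨C, hC, h⟩ := exists_tsum_triForm_le N
  exact ⟨C, hC, fun η Q hQ hη hanti a ha => by
    have := h η Q hQ hη hanti a ha
    rw [thetaTail]
    linarith⟩

/-- An integrable majorant on `(1, ∞)` for a theta series without its constant term. -/
theorem exists_majorant (N n : ℕ) {κ : ℝ} (hκ : 0 < κ) (hκ1 : κ ≤ 1) :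
    ∃ K : ℝ, 0 ≤ K ∧ ∀ (η : Fin N → ℝ) (Q : (Fin N → ℤ) → ℝ) (B : ℝ), IsTriFormZero N η Q →
      (∀ i, 0 < η i) → Antitone η → 0 ≤ B → (∀ i, exp (-B) ≤ η i) → ∃ a : ℝ → ℝ,
        IntegrableOn a (Ioi 0) ∧ (∀ x, 0 ≤ a x) ∧
        (∀ x, 1 < x → x ^ ((n : ℝ) / 2 - 1) * thetaTail Q (κ * x) ≤ a x) ∧
        ∫ x in Ioi (0 : ℝ), a x ≤ K * ((∑ j, triWeight n η j) * (1 + B)) := by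
  obtain ⟨C, hC, hCb⟩ := exists_thetaTail_le N
  obtain ⟨K, hK, hKb⟩ := exists_integral_triTerm_le N n hκ hκ1
  refine ⟨C * K, by positivity, fun η Q B hQ hη hanti hB hBη => ?_⟩
  set b : ℝ → ℝ := fun x => C * ∑ j, x ^ ((n : ℝ) / 2 - 1) * triTerm η (κ * x) j with hb
  have hbi : IntegrableOn b (Ioi 1) :=
    Integrable.const_mul (integrable_finsetSum _ fun j _ => (hKb η B hη hB hBη j).1) C
  refine ⟨(Ioi 1).indicator b, ?_, fun x => ?_, fun x hx => ?_, ?_⟩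
  · rw [integrableOn_indicator_iff measurableSet_Ioi]
    exact hbi.mono_set inter_subset_left
  · refine indicator_nonneg (fun x hx => mul_nonneg hC (Finset.sum_nonneg fun j _ => ?_)) x
    exact mul_nonneg (rpow_nonneg (one_pos.trans hx).le _) (triTerm_nonneg hη _ _)
  · have hx0 : 0 < x := one_pos.trans hx
    rw [indicator_of_mem (mem_Ioi.2 hx), hb]
    simp only
    rw [← Finset.mul_sum, mul_left_comm]
    exact mul_le_mul_of_nonneg_left (hCb η Q hQ hη hanti _ (by positivity)) (by positivity)
  · rw [setIntegral_indicator measurableSet_Ioi,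
      inter_eq_right.2 (Ioi_subset_Ioi zero_le_one), hb, integral_const_mul,
      integral_finsetSum _ fun j _ => (hKb η B hη hB hBη j).1, mul_assoc]
    refine mul_le_mul_of_nonneg_left ?_ hC
    rw [Finset.sum_mul, Finset.mul_sum]
    exact Finset.sum_le_sum fun j _ => (hKb η B hη hB hBη j).2

/-- The completed Epstein zeta function on its line of symmetry, bounded by absolute values along a
fixed ray: the weights of the form come from the integral over `(1, ∞)`, those of the dual form from
the integral over `(0, 1)`, and the summand `1` from the two polar terms. -/
theorem exists_norm_thetaPair_Λ_le {N n : ℕ} (hN : N = 2 * n) (hn : 1 ≤ n) {κ : ℝ} (hκ : 0 < κ)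
    (hκ1 : κ ≤ 1) : ∃ K : ℝ, 0 ≤ K ∧ ∀ (η : Fin N → ℝ) (hη : ∀ i, 0 < η i)
      (hprod : ∏ i, η i = 1) (X : Fin N → Fin N → ℝ) (ω : ℂ) (hω : 0 < ω.re) (B : ℝ) (s : ℂ),
      Antitone η → ω.re = κ → ‖ω‖ = 1 → 0 ≤ B → (∀ i, exp (-B) ≤ η i) → (∀ i, η i ≤ exp B) →
      s.re = n / 2 →
      ‖(thetaPair hN hn hη hprod X hω).Λ s‖ ≤
        K * ((1 + ∑ j, triWeight n η j + ∑ j, triWeight n (fun i => (η i.rev)⁻¹) j) * (1 + B)) := by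
  obtain ⟨K, hK, hKb⟩ := exists_majorant N n hκ hκ1
  refine ⟨K + 4, by positivity, fun η hη hprod X ω hω B s hanti hωκ hω1 hB hB1 hB2 hs => ?_⟩
  have hn0 : (1 : ℝ) ≤ n := by exact_mod_cast hn
  have hω0 : ω ≠ 0 := fun h => by simp [h] at hω
  set η' : Fin N → ℝ := fun i => (η i.rev)⁻¹ with hη'def
  have hη' : ∀ i, 0 < η' i := fun i => inv_pos.2 (hη _)
  have hanti' : Antitone η' := fun i j hij => inv_anti₀ (hη _) (hanti (Fin.rev_le_rev.2 hij))
  have hB1' : ∀ i, exp (-B) ≤ η' i := fun i => by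
    rw [exp_neg]
    exact inv_anti₀ (hη _) (hB2 _)
  have hωinv : ω⁻¹.re = κ := by
    rw [Complex.inv_re, Complex.normSq_eq_norm_sq, hω1, hωκ]
    simp
  have hQ := isTriFormZero_primalForm η X
  have hQ' := isTriFormZero_dualForm η X
  obtain ⟨a, hai, ha0, hab, haI⟩ := hKb η _ B hQ hη hanti hB hB1
  obtain ⟨a', hai', ha0', hab', haI'⟩ := hKb η' _ B hQ' hη' hanti' hB hB1'
  set P := thetaPair hN hn hη hprod X hω with hP
  have hε : ‖P.ε‖ = 1 := by
    change ‖(ω ^ n)⁻¹‖ = 1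
    rw [norm_inv, norm_pow, hω1, one_pow, inv_one]
  have hPk : P.k = n := rfl
  have hf : ∀ x : ℝ, 0 < x → ‖P.f x - P.f₀‖ ≤ thetaTail (primalForm η X) (κ * x) := by
    intro x hx
    have hre : (ω * x).re = κ * x := by rw [Complex.re_mul_ofReal, hωκ]
    have := norm_theta_sub_one_le hQ hη (u := ω * x) (by rw [hre]; positivity)
    rwa [hre] at this
  have hg : ∀ x : ℝ, 0 < x → ‖P.g x - P.g₀‖ ≤ thetaTail (dualForm N η X 0) (κ * x) := by
    intro x hx
    have hre : (ω⁻¹ * x).re = κ * x := by rw [Complex.re_mul_ofReal, hωinv]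
    have := norm_theta_sub_one_le hQ' hη' (u := ω⁻¹ * x) (by rw [hre]; positivity)
    rwa [hre] at this
  have hneg : (-1 : ℝ) ≠ 0 := by norm_num
  -- the majorant of the dual theta series, transported to `(0, 1)` by `x ↦ x⁻¹`
  set b : ℝ → ℝ := fun x => (|(-1 : ℝ)| * x ^ ((-1 : ℝ) - 1)) • a' (x ^ (-1 : ℝ)) with hb
  have hbi : IntegrableOn b (Ioi 0) := (integrableOn_Ioi_comp_rpow_iff a' hneg).2 hai'
  have hbI : ∫ x in Ioi (0 : ℝ), b x = ∫ x in Ioi (0 : ℝ), a' x :=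
    integral_comp_rpow_Ioi a' hneg
  have hb0 : ∀ x ∈ Ioi (0 : ℝ), 0 ≤ b x := fun x hx =>
    mul_nonneg (mul_nonneg (abs_nonneg _) (rpow_nonneg (le_of_lt hx) _)) (ha0' _)
  have hbound : ∀ x ∈ Ioi (0 : ℝ), ‖(x : ℂ) ^ (s - 1) • P.f_modif x‖ ≤ a x + b x := by
    intro x hx
    have hx0 : (0 : ℝ) < x := hx
    rw [norm_smul, Complex.norm_cpow_eq_rpow_re_of_pos hx0, Complex.sub_re, hs, Complex.one_re,
      WeakFEPair.f_modif, Pi.add_apply]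
    rcases lt_trichotomy x 1 with h1 | h1 | h1
    · rw [indicator_of_notMem (show x ∉ Ioi 1 from fun h => absurd h1 (not_lt.2 (le_of_lt h))),
        indicator_of_mem (show x ∈ Ioo 0 1 from ⟨hx0, h1⟩), zero_add]
      have hxi : 1 < x⁻¹ := (one_lt_inv₀ hx0).2 h1
      have h2 : P.f x - (P.ε * ((x ^ (-P.k) : ℝ) : ℂ)) • P.g₀ =
          (P.ε * ((x ^ (-P.k) : ℝ) : ℂ)) • (P.g x⁻¹ - P.g₀) := by
        have h3 := P.h_feq x⁻¹ (inv_pos.2 hx0)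
        rw [one_div, inv_inv, inv_rpow hx0.le, ← rpow_neg hx0.le] at h3
        rw [h3, smul_sub]
      rw [h2, norm_smul, norm_mul, hε, one_mul, Complex.norm_real,
        norm_of_nonneg (rpow_nonneg hx0.le _), hPk]
      have h4 := (mul_le_mul_of_nonneg_left (hg x⁻¹ (inv_pos.2 hx0))
        (rpow_nonneg (inv_pos.2 hx0).le ((n : ℝ) / 2 - 1))).trans (hab' x⁻¹ hxi)
      have h5 : b x = x ^ (-2 : ℝ) * a' x⁻¹ := by
        simp only [hb, abs_neg, abs_one, one_mul, smul_eq_mul, rpow_neg_one]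
        norm_num
      have h6 : x ^ ((n : ℝ) / 2 - 1) * x ^ (-(n : ℝ)) =
          x ^ (-2 : ℝ) * x⁻¹ ^ ((n : ℝ) / 2 - 1) := by
        rw [inv_rpow hx0.le, ← rpow_neg hx0.le, ← rpow_add hx0, ← rpow_add hx0]
        congr 1
        ring
      rw [← mul_assoc, h6, h5, mul_assoc]
      have h7 := mul_le_mul_of_nonneg_left h4 (rpow_nonneg hx0.le (-2))
      linarith [ha0 x]
    · rw [indicator_of_notMem (by simp [h1]), indicator_of_notMem (by simp [h1]), add_zero,
        norm_zero, mul_zero]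
      exact add_nonneg (ha0 x) (hb0 x hx)
    · rw [indicator_of_mem (mem_Ioi.2 h1),
        indicator_of_notMem (show x ∉ Ioo 0 1 from fun h => absurd h1 (not_lt.2 (le_of_lt h.2))),
        add_zero]
      have h2 := (mul_le_mul_of_nonneg_left (hf x hx0)
        (rpow_nonneg hx0.le ((n : ℝ) / 2 - 1))).trans (hab x h1)
      linarith [hb0 x hx]
  have hΛ₀ : ‖P.Λ₀ s‖ ≤ (∫ x in Ioi (0 : ℝ), a x) + ∫ x in Ioi (0 : ℝ), a' x := by
    rw [← hbI, ← integral_add hai hbi]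
    exact norm_integral_le_of_norm_le (hai.add hbi)
      ((ae_restrict_iff' measurableSet_Ioi).2 (ae_of_all _ hbound))
  have hpole : ∀ z : ℂ, z.re = n / 2 → ‖1 / z‖ ≤ 2 := by
    intro z hz
    have h1 : (n : ℝ) / 2 ≤ ‖z‖ := by
      rw [← hz]
      exact Complex.re_le_norm z
    rw [norm_div, norm_one, div_le_iff₀ (by linarith)]
    linarith
  have hΛ : ‖P.Λ s‖ ≤ ‖P.Λ₀ s‖ + 2 + 2 := by
    have h1 : P.Λ s = P.Λ₀ s - 1 / s - P.ε * (1 / (n - s)) := by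
      rw [WeakFEPair.Λ]
      change P.Λ₀ s - (1 / s) • (1 : ℂ) - (P.ε / (((n : ℝ) : ℂ) - s)) • (1 : ℂ) = _
      simp only [smul_eq_mul, mul_one, Complex.ofReal_natCast]
      ring
    rw [h1]
    refine (norm_sub_le _ _).trans (add_le_add ((norm_sub_le _ _).trans
      (add_le_add le_rfl (hpole s hs))) ?_)
    rw [norm_mul, hε, one_mul]
    refine hpole _ ?_
    rw [Complex.sub_re, Complex.natCast_re, hs]
    ring
  have hw : 0 ≤ ∑ j, triWeight n η j :=
    Finset.sum_nonneg fun j _ => (triWeight_pos n hη j).le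
  have hw' : 0 ≤ ∑ j, triWeight n η' j :=
    Finset.sum_nonneg fun j _ => (triWeight_pos n hη' j).le
  nlinarith [mul_nonneg hw hB, mul_nonneg hw' hB, mul_nonneg hK hB]

end MaxParabolic

namespace MaxParabolic

open Real Filter Topology MeasureTheory Set

/-! ### A lower bound for the Riemann zeta function -/

/-- The Mellin transform of the fractional part, in terms of which
`ζ(s) = s / (s - 1) - s * fractIntegral s`. -/
noncomputable def fractIntegral (s : ℂ) : ℂ :=
  ∫ t in Ioi (1 : ℝ), ((Int.fract t : ℝ) : ℂ) * (t : ℂ) ^ (-(s + 1))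

theorem norm_fract_mul_cpow_le {s : ℂ} {t : ℝ} (ht : 1 < t) :
    ‖((Int.fract t : ℝ) : ℂ) * (t : ℂ) ^ (-(s + 1))‖ ≤ t ^ (-(s.re + 1)) := by
  have ht0 : 0 < t := one_pos.trans ht
  rw [norm_mul, Complex.norm_real, norm_of_nonneg (Int.fract_nonneg t),
    Complex.norm_cpow_eq_rpow_re_of_pos ht0]
  simp only [Complex.neg_re, Complex.add_re, Complex.one_re]
  exact mul_le_of_le_one_left (rpow_nonneg ht0.le _) (Int.fract_lt_one t).le

theorem integrableOn_fract_mul_cpow {s : ℂ} (hs : 0 < s.re) :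
    IntegrableOn (fun t : ℝ => ((Int.fract t : ℝ) : ℂ) * (t : ℂ) ^ (-(s + 1))) (Ioi 1) := by
  have h : IntegrableOn (fun t : ℝ => t ^ (-(s.re + 1))) (Ioi 1) :=
    integrableOn_Ioi_rpow_of_lt (by linarith) one_pos
  refine h.mono' ?_ ((ae_restrict_iff' measurableSet_Ioi).2
    (ae_of_all _ fun t ht => norm_fract_mul_cpow_le ht))
  have : Measurable fun t : ℝ => ((Int.fract t : ℝ) : ℂ) * (t : ℂ) ^ (-(s + 1)) := by fun_prop
  exact this.aestronglyMeasurable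

theorem riemannZeta_eq_sub_fractIntegral {s : ℂ} (hs : 1 < s.re) :
    riemannZeta s = 1 + 1 / (s - 1) - s * fractIntegral s := by
  have hs1 : s - 1 ≠ 0 := fun h => by
    rw [sub_eq_zero.1 h] at hs
    simp at hs
  have h1 := LSeries_eq_mul_integral_of_nonneg (fun _ => (1 : ℝ)) zero_le_one hs (by
    refine Asymptotics.isBigO_of_le _ fun m => ?_
    simp) fun _ => zero_le_one
  have h2 : LSeries (fun _ => ((1 : ℝ) : ℂ)) s = riemannZeta s := by
    rw [← LSeries_one_eq_riemannZeta hs]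
    congr 1
  have h3 : ∫ t in Ioi (1 : ℝ), (t : ℂ) ^ (-s) = 1 / (s - 1) := by
    rw [integral_Ioi_cpow_of_lt (by simpa using hs) one_pos]
    simp only [Complex.ofReal_one, Complex.one_cpow]
    rw [show -s + 1 = -(s - 1) by ring, neg_div_neg_eq]
  have h4 : IntegrableOn (fun t : ℝ => (t : ℂ) ^ (-s)) (Ioi 1) :=
    integrableOn_Ioi_cpow_of_lt (by simpa using hs) one_pos
  have h5 : ∫ t in Ioi (1 : ℝ), (∑ k ∈ Finset.Icc 1 ⌊t⌋₊, ((1 : ℝ) : ℂ)) * (t : ℂ) ^ (-(s + 1)) =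
      1 / (s - 1) - fractIntegral s := by
    rw [← h3, fractIntegral, ← integral_sub h4 (integrableOn_fract_mul_cpow (by linarith))]
    refine setIntegral_congr_fun measurableSet_Ioi fun t ht => ?_
    have ht0 : (0 : ℝ) < t := one_pos.trans ht
    have htc : (t : ℂ) ≠ 0 := by exact_mod_cast ht0.ne'
    have h6 : (t : ℂ) ^ (-s) = t * (t : ℂ) ^ (-(s + 1)) := by
      rw [show -s = 1 + -(s + 1) by ring, Complex.cpow_add _ _ htc, Complex.cpow_one]
    have h7 : ((⌊t⌋₊ : ℕ) : ℂ) = (t : ℂ) - ((Int.fract t : ℝ) : ℂ) := by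
      rw [← Complex.ofReal_sub, Int.self_sub_fract, ← Complex.ofReal_natCast,
        natCast_floor_eq_intCast_floor ht0.le]
    simp only [Complex.ofReal_one, Finset.sum_const, Nat.card_Icc, nsmul_eq_mul, mul_one,
      add_tsub_cancel_right]
    rw [h6, h7]
    ring
  rw [h5, h2] at h1
  rw [h1]
  field_simp
  ring

theorem norm_fractIntegral_le {s : ℂ} (hs : 1 ≤ s.re) : ‖fractIntegral s‖ ≤ 1 := by
  have h : IntegrableOn (fun t : ℝ => t ^ (-(s.re + 1))) (Ioi 1) :=
    integrableOn_Ioi_rpow_of_lt (by linarith) one_pos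
  refine (norm_integral_le_of_norm_le h ((ae_restrict_iff' measurableSet_Ioi).2
    (ae_of_all _ fun t ht => norm_fract_mul_cpow_le ht))).trans ?_
  rw [integral_Ioi_rpow_of_lt (by linarith) one_pos, one_rpow,
    show -(s.re + 1) + 1 = -s.re by ring, neg_div_neg_eq]
  exact (div_le_one (by linarith)).2 hs

theorem norm_cpow_sub_cpow_le {s s' : ℂ} (hs : 1 ≤ s.re) (hs' : 1 ≤ s'.re) {t : ℝ} (ht : 1 < t) :
    ‖(t : ℂ) ^ (-(s + 1)) - (t : ℂ) ^ (-(s' + 1))‖ ≤ 2 * t ^ (-(3 / 2) : ℝ) * ‖s - s'‖ := by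
  have ht0 : 0 < t := one_pos.trans ht
  have htc : (t : ℂ) ≠ 0 := by exact_mod_cast ht0.ne'
  have hd : ∀ z ∈ {z : ℂ | 1 ≤ z.re}, HasDerivWithinAt (fun z : ℂ => (t : ℂ) ^ (-(z + 1)))
      ((t : ℂ) ^ (-(z + 1)) * Complex.log t * (-1)) {z : ℂ | 1 ≤ z.re} z := by
    intro z _
    have h1 : HasDerivAt (fun z : ℂ => -(z + 1)) (-1) z := ((hasDerivAt_id z).add_const 1).neg
    exact (h1.const_cpow (Or.inl htc)).hasDerivWithinAt
  have hb : ∀ z ∈ {z : ℂ | 1 ≤ z.re},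
      ‖(t : ℂ) ^ (-(z + 1)) * Complex.log t * (-1)‖ ≤ 2 * t ^ (-(3 / 2) : ℝ) := by
    intro z hz
    have hz1 : 1 ≤ z.re := hz
    rw [norm_mul, norm_mul, norm_neg, norm_one, mul_one, Complex.norm_cpow_eq_rpow_re_of_pos ht0,
      ← Complex.ofReal_log ht0.le, Complex.norm_real, norm_of_nonneg (log_nonneg ht.le)]
    simp only [Complex.neg_re, Complex.add_re, Complex.one_re]
    have h1 : log t ≤ 2 * t ^ (1 / 2 : ℝ) := by
      have := log_le_rpow_div ht0.le (ε := 1 / 2) (by norm_num)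
      linarith
    have h2 : t ^ (-(z.re + 1)) ≤ t ^ (-2 : ℝ) := rpow_le_rpow_of_exponent_le ht.le (by linarith)
    calc t ^ (-(z.re + 1)) * log t ≤ t ^ (-2 : ℝ) * (2 * t ^ (1 / 2 : ℝ)) :=
          mul_le_mul h2 h1 (log_nonneg ht.le) (by positivity)
      _ = 2 * t ^ (-(3 / 2) : ℝ) := by
          rw [mul_left_comm, ← rpow_add ht0]
          norm_num
  exact Convex.norm_image_sub_le_of_norm_hasDerivWithin_le hd hb (convex_halfSpace_re_ge 1) hs' hs

theorem norm_fractIntegral_sub_le {s s' : ℂ} (hs : 1 ≤ s.re) (hs' : 1 ≤ s'.re) :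
    ‖fractIntegral s - fractIntegral s'‖ ≤ 4 * ‖s - s'‖ := by
  have h : IntegrableOn (fun t : ℝ => t ^ (-(3 / 2) : ℝ) * (2 * ‖s - s'‖)) (Ioi 1) :=
    (integrableOn_Ioi_rpow_of_lt (by norm_num) one_pos).mul_const _
  rw [fractIntegral, fractIntegral, ← integral_sub (integrableOn_fract_mul_cpow (by linarith))
    (integrableOn_fract_mul_cpow (by linarith))]
  refine (norm_integral_le_of_norm_le h ((ae_restrict_iff' measurableSet_Ioi).2
    (ae_of_all _ fun t ht => ?_))).trans ?_
  · rw [← mul_sub, norm_mul, Complex.norm_real, norm_of_nonneg (Int.fract_nonneg t)]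
    refine (mul_le_of_le_one_left (norm_nonneg _) (Int.fract_lt_one t).le).trans
      ((norm_cpow_sub_cpow_le hs hs' ht).trans (le_of_eq ?_))
    ring
  · rw [integral_mul_const, integral_Ioi_rpow_of_lt (by norm_num) one_pos]
    norm_num
    linarith

theorem norm_riemannZeta_le {s : ℂ} (hs : 1 < s.re) :
    ‖riemannZeta s‖ ≤ 1 + ‖s - 1‖⁻¹ + ‖s‖ := by
  rw [riemannZeta_eq_sub_fractIntegral hs]
  refine (norm_sub_le _ _).trans (add_le_add ((norm_add_le _ _).trans ?_) ?_)
  · rw [norm_one, norm_div, norm_one, one_div]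
  · rw [norm_mul]
    exact mul_le_of_le_one_right (norm_nonneg _) (norm_fractIntegral_le hs.le)

theorem norm_riemannZeta_sub_le {s s' : ℂ} (hs : 1 < s.re) (hs' : 1 < s'.re) :
    ‖riemannZeta s - riemannZeta s'‖ ≤
      ‖s - s'‖ * (‖s - 1‖⁻¹ * ‖s' - 1‖⁻¹ + 1 + 4 * ‖s'‖) := by
  have hs1 : s - 1 ≠ 0 := fun h => by
    rw [sub_eq_zero.1 h] at hs
    simp at hs
  have hs1' : s' - 1 ≠ 0 := fun h => by
    rw [sub_eq_zero.1 h] at hs'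
    simp at hs'
  have key : riemannZeta s - riemannZeta s' = -((s - s') * ((s - 1)⁻¹ * (s' - 1)⁻¹)) -
      (s - s') * fractIntegral s - s' * (fractIntegral s - fractIntegral s') := by
    rw [riemannZeta_eq_sub_fractIntegral hs, riemannZeta_eq_sub_fractIntegral hs']
    field_simp
    ring
  rw [key]
  refine (norm_sub_le _ _).trans ((add_le_add (norm_sub_le _ _) le_rfl).trans ?_)
  rw [norm_neg, norm_mul, norm_mul, norm_mul, norm_mul, norm_inv, norm_inv]
  have h1 := mul_le_mul_of_nonneg_left (norm_fractIntegral_le hs.le) (norm_nonneg (s - s'))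
  have h2 := mul_le_mul_of_nonneg_left (norm_fractIntegral_sub_le hs.le hs'.le) (norm_nonneg s')
  linarith

/-- The classical `3-4-1` inequality. -/
theorem one_le_norm_riemannZeta_product {x : ℝ} (hx : 0 < x) (τ : ℝ) :
    1 ≤ ‖riemannZeta (1 + x)‖ ^ 3 * ‖riemannZeta (1 + x + Complex.I * τ)‖ ^ 4 *
      ‖riemannZeta (1 + x + 2 * Complex.I * τ)‖ := by
  have h := DirichletCharacter.norm_LFunction_product_ge_one (N := 1) (1 : DirichletCharacter ℂ 1)
    hx τ
  simpa [DirichletCharacter.LFunctionTrivChar, DirichletCharacter.LFunction_modOne_eq] using h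

theorem tendsto_riemannZeta_vertical {τ : ℝ} (hτ : τ ≠ 0) :
    Tendsto (fun x : ℝ => riemannZeta (1 + x + Complex.I * τ)) (𝓝[>] 0)
      (𝓝 (riemannZeta (1 + Complex.I * τ))) := by
  have h1 : (1 + Complex.I * τ : ℂ) ≠ 1 := by
    simp [Complex.ext_iff, hτ]
  have h2 : Tendsto (fun x : ℝ => (1 + x + Complex.I * τ : ℂ)) (𝓝[>] 0)
      (𝓝 (1 + Complex.I * τ)) := by
    refine Tendsto.mono_left ?_ nhdsWithin_le_nhds
    refine Continuous.tendsto' (by fun_prop) _ _ ?_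
    simp
  exact (differentiableAt_riemannZeta h1).continuousAt.tendsto.comp h2

theorem half_le_norm_riemannZeta_of_abs_le {τ : ℝ} (hτ : τ ≠ 0) (hτ2 : |τ| ≤ 1 / 2) :
    1 / 2 ≤ ‖riemannZeta (1 + Complex.I * τ)‖ := by
  have hτ0 : 0 < |τ| := abs_pos.2 hτ
  have h1 : Tendsto (fun x : ℝ => ‖(1 + x + Complex.I * τ : ℂ)‖ *
      (‖(x + Complex.I * τ : ℂ)‖⁻¹ - 1)) (𝓝[>] 0)
      (𝓝 (‖(1 + Complex.I * τ : ℂ)‖ * (|τ|⁻¹ - 1))) := by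
    refine Tendsto.mono_left ?_ nhdsWithin_le_nhds
    have hc : ContinuousAt (fun x : ℝ => ‖(1 + x + Complex.I * τ : ℂ)‖ *
        (‖(x + Complex.I * τ : ℂ)‖⁻¹ - 1)) 0 := by
      refine ContinuousAt.mul (by fun_prop) (ContinuousAt.sub (ContinuousAt.inv₀ (by fun_prop) ?_)
        continuousAt_const)
      simp [hτ]
    have := hc.tendsto
    simpa using this
  have h2 : ∀ᶠ x : ℝ in 𝓝[>] 0, ‖(1 + x + Complex.I * τ : ℂ)‖ *
      (‖(x + Complex.I * τ : ℂ)‖⁻¹ - 1) ≤ ‖riemannZeta (1 + x + Complex.I * τ)‖ := by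
    filter_upwards [self_mem_nhdsWithin] with x hx
    have hx0 : (0 : ℝ) < x := hx
    set s : ℂ := 1 + x + Complex.I * τ with hs
    have hre : s.re = 1 + x := by simp [hs]
    have hs1 : s - 1 = x + Complex.I * τ := by
      rw [hs]
      ring
    have hs0 : s - 1 ≠ 0 := fun h => by
      have := congrArg Complex.re h
      rw [hs1] at this
      simp at this
      exact hx0.ne' this
    have h3 := riemannZeta_eq_sub_fractIntegral (s := s) (by linarith)
    have h4 : riemannZeta s = s * (s - 1)⁻¹ - s * fractIntegral s := by
      rw [h3]
      field_simp
      ring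
    rw [← hs1, h4]
    have h5 := norm_sub_norm_le (s * (s - 1)⁻¹) (s * fractIntegral s)
    rw [norm_mul, norm_mul, norm_inv] at h5
    have h6 := mul_le_mul_of_nonneg_left (norm_fractIntegral_le (s := s) (by linarith))
      (norm_nonneg s)
    linarith
  have h3 := le_of_tendsto_of_tendsto h1 (tendsto_riemannZeta_vertical hτ).norm h2
  have h4 : (1 : ℝ) ≤ ‖(1 + Complex.I * τ : ℂ)‖ := by
    have := Complex.re_le_norm (1 + Complex.I * τ : ℂ)
    simpa using this
  have h5 : (2 : ℝ) ≤ |τ|⁻¹ := by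
    rw [le_inv_comm₀ two_pos hτ0]
    linarith
  nlinarith

theorem norm_add_I_mul_le (σ τ : ℝ) (hσ : 0 ≤ σ) : ‖(σ + Complex.I * τ : ℂ)‖ ≤ σ + |τ| := by
  refine (norm_add_le _ _).trans ?_
  simp [abs_of_nonneg hσ]

theorem norm_riemannZeta_sub_vertical_le {τ x : ℝ} (hτ : 1 / 2 ≤ |τ|) (hx : 0 < x) (hx1 : x ≤ 1) :
    ‖riemannZeta (1 + x + Complex.I * τ) - riemannZeta (1 + Complex.I * τ)‖ ≤ 30 * |τ| * x := by
  have hτ0 : τ ≠ 0 := fun h => by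
    rw [h] at hτ
    norm_num at hτ
  have h1 : Tendsto (fun y : ℝ => ‖riemannZeta (1 + x + Complex.I * τ) -
      riemannZeta (1 + y + Complex.I * τ)‖) (𝓝[>] 0)
      (𝓝 ‖riemannZeta (1 + x + Complex.I * τ) - riemannZeta (1 + Complex.I * τ)‖) :=
    (tendsto_const_nhds.sub (tendsto_riemannZeta_vertical hτ0)).norm
  refine le_of_tendsto h1 ?_
  filter_upwards [Ioo_mem_nhdsGT hx] with y hy
  have hy0 : 0 < y := hy.1
  have hi : ∀ v : ℝ, ‖(1 + v + Complex.I * τ : ℂ) - 1‖⁻¹ ≤ 2 := by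
    intro v
    have : |τ| ≤ ‖(1 + v + Complex.I * τ : ℂ) - 1‖ := by
      have := Complex.abs_im_le_norm ((1 + v + Complex.I * τ : ℂ) - 1)
      simpa using this
    rw [inv_le_comm₀ (by linarith) two_pos]
    linarith
  have h2 := norm_riemannZeta_sub_le (s := 1 + x + Complex.I * τ) (s' := 1 + y + Complex.I * τ)
    (by simpa using hx) (by simpa using hy0)
  have h3 : ‖(1 + x + Complex.I * τ : ℂ) - (1 + y + Complex.I * τ)‖ ≤ x := by
    rw [show (1 + x + Complex.I * τ : ℂ) - (1 + y + Complex.I * τ) = ((x - y : ℝ) : ℂ) by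
      push_cast; ring, Complex.norm_real, norm_of_nonneg (by linarith [hy.2])]
    linarith
  have h4 : ‖(1 + y + Complex.I * τ : ℂ)‖ ≤ 2 + |τ| := by
    have := norm_add_I_mul_le (1 + y) τ (by linarith)
    push_cast at this
    linarith [hy.2]
  have h5 : ‖(1 + x + Complex.I * τ : ℂ) - 1‖⁻¹ * ‖(1 + y + Complex.I * τ : ℂ) - 1‖⁻¹ ≤ 2 * 2 :=
    mul_le_mul (hi x) (hi y) (by positivity) two_pos.le
  refine h2.trans ((mul_le_mul h3 (b := x) (d := 30 * |τ|) (by linarith) (by positivity)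
    hx.le).trans (le_of_eq (by ring)))

/-- A lower bound on the line `Re s = 1`. Near the pole it comes from the pole; elsewhere the
`3-4-1` inequality bounds the zeta function from below slightly to the right of the line, and the
elementary bound for its variation carries this over to the line. The exponent `4` is not optimal. -/
theorem exists_le_norm_riemannZeta_one :
    ∃ c : ℝ, 0 < c ∧ ∀ τ : ℝ, τ ≠ 0 → c ≤ ‖riemannZeta (1 + Complex.I * τ)‖ * (1 + |τ|) ^ 4 := by
  set M : ℝ := 60 ^ 4 * 768 with hM
  have hM0 : 0 < M := by norm_num [hM]
  refine ⟨30 / M, by positivity, fun τ hτ => ?_⟩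
  have hpow : (1 : ℝ) ≤ (1 + |τ|) ^ 4 := one_le_pow₀ (by linarith [abs_nonneg τ])
  rcases le_total (|τ|) (1 / 2) with h | h
  · have h1 := half_le_norm_riemannZeta_of_abs_le hτ h
    have h2 : 30 / M ≤ 1 / 2 := by norm_num [hM]
    nlinarith
  -- The shift `x` is chosen so that the `3-4-1` bound at `1 + x + iτ` is twice the variation of
  -- the zeta function between `1 + iτ` and `1 + x + iτ`.
  set T := |τ| with hT
  have hT0 : 0 < T := by linarith
  set x := 1 / (M * T ^ 5) with hx
  have hx0 : 0 < x := by positivity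
  have hxM : x * (M * T ^ 5) = 1 := by
    rw [hx]
    field_simp
  have hT5 : (1 / 2) ^ 5 ≤ T ^ 5 := pow_le_pow_left₀ (by norm_num) h 5
  have hx1 : x ≤ 1 := by
    rw [hx, div_le_one (by positivity)]
    norm_num [hM] at *
    linarith
  have h1 := one_le_norm_riemannZeta_product hx0 τ
  have h2 : ‖riemannZeta (1 + x)‖ ≤ 4 / x := by
    have h3 := norm_riemannZeta_le (s := 1 + x) (by simpa using hx0)
    have h4 : ‖(1 + x : ℂ)‖ = 1 + x := by
      rw [show (1 + x : ℂ) = ((1 + x : ℝ) : ℂ) by push_cast; rfl, Complex.norm_real,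
        norm_of_nonneg (by linarith)]
    rw [add_sub_cancel_left, Complex.norm_real, norm_of_nonneg hx0.le, h4] at h3
    refine h3.trans ?_
    have h5 : 1 ≤ x⁻¹ := (one_le_inv₀ hx0).2 hx1
    rw [div_eq_mul_inv]
    linarith
  have h3 : ‖riemannZeta (1 + x + 2 * Complex.I * τ)‖ ≤ 12 * T := by
    have h3 := norm_riemannZeta_le (s := 1 + x + 2 * Complex.I * τ) (by simpa using hx0)
    have h4 : ‖(1 + x + 2 * Complex.I * τ : ℂ)‖ ≤ 2 + 2 * T := by
      have := norm_add_I_mul_le (1 + x) (2 * τ) (by linarith)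
      rw [abs_mul, abs_two] at this
      push_cast at this
      rw [show (1 + x + 2 * Complex.I * τ : ℂ) = 1 + x + Complex.I * (2 * τ) by ring]
      linarith
    have h5 : ‖(1 + x + 2 * Complex.I * τ : ℂ) - 1‖⁻¹ ≤ 1 := by
      have : 2 * T ≤ ‖(1 + x + 2 * Complex.I * τ : ℂ) - 1‖ := by
        have := Complex.abs_im_le_norm ((1 + x + 2 * Complex.I * τ : ℂ) - 1)
        simpa [abs_mul] using this
      exact inv_le_one_of_one_le₀ (by linarith)
    linarith
  set Z := ‖riemannZeta (1 + x + Complex.I * τ)‖ with hZ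
  have hZ0 : 0 ≤ Z := norm_nonneg _
  have h4 : 1 ≤ (4 / x) ^ 3 * Z ^ 4 * (12 * T) :=
    h1.trans (mul_le_mul (mul_le_mul_of_nonneg_right
      (pow_le_pow_left₀ (norm_nonneg _) h2 3) (by positivity)) h3 (norm_nonneg _) (by positivity))
  have h5 : 60 * T * x ≤ Z := by
    refine le_of_pow_le_pow_left₀ (n := 4) (by norm_num) hZ0 ?_
    have h6 : x ^ 3 ≤ 768 * T * Z ^ 4 := by
      have h7 : (4 / x) ^ 3 * Z ^ 4 * (12 * T) = 768 * T * Z ^ 4 / x ^ 3 := by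
        field_simp
        ring
      rw [h7, le_div_iff₀ (by positivity), one_mul] at h4
      exact h4
    have h8 : (60 * T * x) ^ 4 * (768 * T) = x ^ 3 := by
      have : (60 * T * x) ^ 4 * (768 * T) = x ^ 3 * (x * (M * T ^ 5)) := by
        rw [hM]
        ring
      rw [this, hxM, mul_one]
    rw [← h8] at h6
    have h9 : 0 < 768 * T := by positivity
    exact le_of_mul_le_mul_right (by linarith) h9
  have h6 := norm_riemannZeta_sub_vertical_le (τ := τ) h hx0 hx1
  have h7 := norm_sub_norm_le (riemannZeta (1 + x + Complex.I * τ))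
    (riemannZeta (1 + Complex.I * τ))
  have h8 : 30 * T * x ≤ ‖riemannZeta (1 + Complex.I * τ)‖ := by linarith
  have h9 : 30 * T * x * T ^ 4 = 30 / M := by
    have : 30 * T * x * T ^ 4 = 30 / M * (x * (M * T ^ 5)) := by
      field_simp
    rw [this, hxM, mul_one]
  rw [← h9]
  exact mul_le_mul h8 (pow_le_pow_left₀ hT0.le (by linarith) 4) (by positivity) (norm_nonneg _)

/-- A lower bound on the line `Re s = n`; for `n ≥ 2` the `3-4-1` inequality gives it directly. -/
theorem exists_le_norm_riemannZeta (n : ℕ) (hn : 1 ≤ n) :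
    ∃ c : ℝ, 0 < c ∧ ∀ τ : ℝ, (n = 1 → τ ≠ 0) →
      c ≤ ‖riemannZeta (n + Complex.I * τ)‖ * (1 + |τ|) ^ 4 := by
  rcases hn.eq_or_lt with rfl | hn
  · obtain ⟨c, hc, h⟩ := exists_le_norm_riemannZeta_one
    exact ⟨c, hc, fun τ hτ => by simpa using h τ (hτ rfl)⟩
  have hn2 : (2 : ℝ) ≤ n := by exact_mod_cast hn
  have hx : (0 : ℝ) < n - 1 := by linarith
  set A : ℝ := 3 * (1 + n) with hA
  have hz : ∀ τ : ℝ, ‖riemannZeta (n + Complex.I * τ)‖ ≤ A * (1 + |τ|) := by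
    intro τ
    have h1 := norm_riemannZeta_le (s := n + Complex.I * τ) (by simpa using hn)
    have h2 := norm_add_I_mul_le n τ (by linarith)
    have h3 : ‖(n + Complex.I * τ : ℂ) - 1‖⁻¹ ≤ 1 := by
      refine inv_le_one_of_one_le₀ ?_
      have := Complex.re_le_norm ((n + Complex.I * τ : ℂ) - 1)
      simp at this
      linarith
    have := abs_nonneg τ
    push_cast at h2
    nlinarith
  have hA0 : 0 < A := by positivity
  refine ⟨min 1 (1 / (2 * A ^ 4)), by positivity, fun τ _ => ?_⟩
  have h1 := one_le_norm_riemannZeta_product hx τ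
  have e1 : (1 + ((n - 1 : ℝ) : ℂ) : ℂ) = n := by
    push_cast
    ring
  rw [e1] at h1
  have h2 := hz 0
  have h3 := hz (2 * τ)
  rw [Complex.ofReal_zero, mul_zero, add_zero, abs_zero, add_zero, mul_one] at h2
  rw [abs_mul, abs_two] at h3
  have e2 : (n + Complex.I * ((2 * τ : ℝ) : ℂ) : ℂ) = n + 2 * Complex.I * τ := by
    push_cast
    ring
  rw [e2] at h3
  set Z := ‖riemannZeta (n + Complex.I * τ)‖ with hZ
  have hZ0 : 0 ≤ Z := norm_nonneg _
  set T := 1 + |τ| with hT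
  have hT1 : 1 ≤ T := by linarith [abs_nonneg τ]
  have h4 : 1 ≤ A ^ 3 * Z ^ 4 * (A * (2 * T)) := by
    refine h1.trans (mul_le_mul (mul_le_mul_of_nonneg_right
      (pow_le_pow_left₀ (norm_nonneg _) h2 3) (by positivity)) (h3.trans ?_) (norm_nonneg _)
      (by positivity))
    exact mul_le_mul_of_nonneg_left (by linarith) hA0.le
  have h5 : 1 / (2 * A ^ 4) ≤ Z ^ 4 * T := by
    rw [div_le_iff₀ (by positivity)]
    calc (1 : ℝ) ≤ _ := h4
      _ = _ := by ring
  rcases le_total 1 Z with h6 | h6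
  · refine (min_le_left _ _).trans ?_
    have : 1 ≤ T ^ 4 := one_le_pow₀ hT1
    nlinarith
  · refine (min_le_right _ _).trans (h5.trans ?_)
    have h7 : Z ^ 4 ≤ Z := by
      simpa using pow_le_pow_of_le_one hZ0 h6 (show 1 ≤ 4 by norm_num)
    have h8 : T ≤ T ^ 4 := by
      simpa using pow_le_pow_right₀ hT1 (show 1 ≤ 4 by norm_num)
    exact mul_le_mul h7 h8 (by linarith) hZ0

/-! ### A lower bound for the Gamma function on vertical lines -/

theorem norm_Gamma_conj_line (σ τ : ℝ) :
    ‖Complex.Gamma (σ - Complex.I * τ)‖ = ‖Complex.Gamma (σ + Complex.I * τ)‖ := by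
  have h := Complex.Gamma_conj (σ + Complex.I * τ)
  have h2 : (starRingEnd ℂ) (σ + Complex.I * τ : ℂ) = σ - Complex.I * τ := by
    simp [sub_eq_add_neg]
  rw [← h2, h, Complex.norm_conj]

theorem le_norm_Gamma_half (τ : ℝ) :
    exp (-(π / 2 * |τ|)) ≤ ‖Complex.Gamma (1 / 2 + Complex.I * τ)‖ := by
  have h1 := Complex.Gamma_mul_Gamma_one_sub (1 / 2 + Complex.I * τ)
  have h2 := norm_Gamma_conj_line (1 / 2) τ
  push_cast at h2
  have h3 : Complex.sin (π * (1 / 2 + Complex.I * τ)) = ((cosh (π * τ) : ℝ) : ℂ) := by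
    rw [show (π * (1 / 2 + Complex.I * τ) : ℂ) = (π * τ : ℂ) * Complex.I + π / 2 by ring,
      Complex.sin_add_pi_div_two, Complex.cos_mul_I]
    push_cast
    rfl
  rw [h3, show (1 - (1 / 2 + Complex.I * τ) : ℂ) = 1 / 2 - Complex.I * τ by ring] at h1
  have h4 := congrArg norm h1
  rw [norm_mul, h2, norm_div, Complex.norm_real, Complex.norm_real, norm_of_nonneg pi_pos.le,
    norm_of_nonneg (cosh_pos _).le] at h4
  have h5 : cosh (π * τ) ≤ exp (π * |τ|) := by
    rw [← cosh_abs, abs_mul, abs_of_pos pi_pos, cosh_eq]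
    have : exp (-(π * |τ|)) ≤ exp (π * |τ|) := exp_le_exp.2 (by
      have := mul_nonneg pi_pos.le (abs_nonneg τ)
      linarith)
    linarith
  refine le_of_pow_le_pow_left₀ two_ne_zero (norm_nonneg _) ?_
  rw [sq ‖_‖, h4, ← exp_nat_mul, le_div_iff₀ (cosh_pos _)]
  calc exp ((2 : ℕ) * -(π / 2 * |τ|)) * cosh (π * τ)
      ≤ exp ((2 : ℕ) * -(π / 2 * |τ|)) * exp (π * |τ|) :=
        mul_le_mul_of_nonneg_left h5 (exp_pos _).le
    _ = 1 := by
        rw [← exp_add]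
        push_cast
        ring_nf
        exact exp_zero
    _ ≤ π := by linarith [pi_gt_three]

theorem sinh_le {x : ℝ} (hx : 0 < x) : (1 + x) * sinh x ≤ 2 * (x * exp x) := by
  have h0 : sinh x = exp x * ((1 - exp (-(2 * x))) / 2) := by
    rw [sinh_eq, mul_div_assoc', mul_sub, mul_one, ← exp_add]
    ring_nf
  have h1 : 1 - exp (-(2 * x)) ≤ 2 * x := by
    have := add_one_le_exp (-(2 * x))
    linarith
  have h2 : 0 < exp (-(2 * x)) := exp_pos _
  have h3 : (1 + x) * ((1 - exp (-(2 * x))) / 2) ≤ 2 * x := by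
    rcases le_total x 1 with h | h <;> nlinarith
  rw [h0]
  have := mul_le_mul_of_nonneg_left h3 (exp_pos x).le
  nlinarith

theorem le_norm_Gamma_one (τ : ℝ) :
    1 / 2 * (1 + |τ|) ^ (1 / 2 : ℝ) * exp (-(π / 2 * |τ|)) ≤
      ‖Complex.Gamma (1 + Complex.I * τ)‖ := by
  by_cases hτ : τ = 0
  · subst hτ
    simp
    norm_num
  have hτ0 : 0 < |τ| := abs_pos.2 hτ
  have hτc : (Complex.I * τ : ℂ) ≠ 0 := by simp [hτ]
  have h1 := Complex.Gamma_mul_Gamma_one_sub (Complex.I * τ)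
  have h2 := norm_Gamma_conj_line 1 τ
  push_cast at h2
  have h3 : Complex.sin (π * (Complex.I * τ)) = ((sinh (π * τ) : ℝ) : ℂ) * Complex.I := by
    rw [show (π * (Complex.I * τ) : ℂ) = (π * τ : ℂ) * Complex.I by ring, Complex.sin_mul_I]
    push_cast
    rfl
  have h4 := Complex.Gamma_add_one (Complex.I * τ) hτc
  rw [add_comm] at h4
  have h5 : ‖Complex.Gamma (1 + Complex.I * τ)‖ ^ 2 = |τ| * (π / sinh (π * |τ|)) := by
    rw [sq]
    nth_rewrite 2 [← h2]
    rw [h4, norm_mul, mul_assoc, ← norm_mul, h1, h3]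
    have hsinh : |sinh (π * τ)| = sinh (π * |τ|) := by
      rw [abs_sinh, abs_mul, abs_of_pos pi_pos]
    rw [norm_div, norm_mul, norm_mul, Complex.norm_I, Complex.norm_real, Complex.norm_real,
      Complex.norm_real, mul_one, one_mul, norm_eq_abs, norm_eq_abs, norm_eq_abs, hsinh,
      abs_of_pos pi_pos]
  have hs0 : 0 < sinh (π * |τ|) := sinh_pos_iff.2 (by positivity)
  refine le_of_pow_le_pow_left₀ two_ne_zero (norm_nonneg _) ?_
  rw [h5, mul_div_assoc', le_div_iff₀ hs0, mul_pow, mul_pow, ← sqrt_eq_rpow,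
    sq_sqrt (by positivity), ← exp_nat_mul]
  have h6 := sinh_le (x := π * |τ|) (by positivity)
  have h7 : 1 + |τ| ≤ 1 + π * |τ| := by nlinarith [pi_gt_three]
  have h8 : exp ((2 : ℕ) * -(π / 2 * |τ|)) * exp (π * |τ|) = 1 := by
    rw [← exp_add]
    push_cast
    ring_nf
    exact exp_zero
  have h9 : (1 + |τ|) * sinh (π * |τ|) ≤ 2 * (π * |τ| * exp (π * |τ|)) :=
    (mul_le_mul_of_nonneg_right h7 hs0.le).trans h6
  have h10 := mul_le_mul_of_nonneg_left h9 (exp_pos ((2 : ℕ) * -(π / 2 * |τ|))).le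
  have h11 : exp ((2 : ℕ) * -(π / 2 * |τ|)) * (2 * (π * |τ| * exp (π * |τ|))) = 2 * (π * |τ|) := by
    rw [show exp ((2 : ℕ) * -(π / 2 * |τ|)) * (2 * (π * |τ| * exp (π * |τ|))) =
      2 * (π * |τ|) * (exp ((2 : ℕ) * -(π / 2 * |τ|)) * exp (π * |τ|)) by ring, h8, mul_one]
  have h12 : 0 < π * |τ| := by positivity
  nlinarith

/-- Stirling's lower bound for `Γ(k/2 + iτ)`. For `k = 1, 2` it follows from the reflection formula,
and the recurrence `Γ(z + 1) = z Γ(z)` leads from `k` to `k + 2`. -/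
theorem exists_le_norm_Gamma (k : ℕ) (hk : 1 ≤ k) : ∃ c : ℝ, 0 < c ∧ ∀ τ : ℝ,
    c * (1 + |τ|) ^ (((k : ℝ) - 1) / 2) * exp (-(π / 2 * |τ|)) ≤
      ‖Complex.Gamma (k / 2 + Complex.I * τ)‖ := by
  obtain ⟨j, rfl⟩ : ∃ j, k = j + 1 := ⟨k - 1, by omega⟩
  clear hk
  induction j using Nat.twoStepInduction with
  | zero =>
    refine ⟨1, one_pos, fun τ => ?_⟩
    simpa using le_norm_Gamma_half τ
  | one =>
    refine ⟨1 / 2, by norm_num, fun τ => ?_⟩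
    have := le_norm_Gamma_one τ
    norm_num at *
    exact this
  | more j ih _ =>
    obtain ⟨c, hc, h⟩ := ih
    refine ⟨c / 4, by positivity, fun τ => ?_⟩
    have hT : 0 < 1 + |τ| := by positivity
    set z : ℂ := ((j + 1 : ℕ) : ℂ) / 2 + Complex.I * τ with hz
    have hre : z.re = (j + 1) / 2 := by
      rw [hz, Complex.add_re, show (((j + 1 : ℕ) : ℂ) / 2) = (((j + 1) / 2 : ℝ) : ℂ) by
        push_cast; ring]
      simp
    have him : z.im = τ := by
      rw [hz, Complex.add_im, show (((j + 1 : ℕ) : ℂ) / 2) = (((j + 1) / 2 : ℝ) : ℂ) by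
        push_cast; ring]
      simp
    have hj : (0 : ℝ) ≤ j := Nat.cast_nonneg j
    have hz0 : z ≠ 0 := fun h0 => by
      rw [h0] at hre
      simp at hre
      linarith
    have h1 := Complex.Gamma_add_one z hz0
    have h2 : (((j + 2 + 1 : ℕ) : ℂ) / 2 + Complex.I * τ) = z + 1 := by
      rw [hz]
      push_cast
      ring
    rw [h2, h1, norm_mul]
    have h3 : (1 + |τ|) / 4 ≤ ‖z‖ := by
      have h4 := Complex.re_le_norm z
      have h5 := Complex.abs_im_le_norm z
      rw [hre] at h4
      rw [him] at h5
      linarith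
    have h4 : (1 + |τ|) ^ ((((j + 2 + 1 : ℕ) : ℝ) - 1) / 2) =
        (1 + |τ|) ^ ((((j + 1 : ℕ) : ℝ) - 1) / 2) * (1 + |τ|) := by
      rw [← rpow_add_one hT.ne']
      congr 1
      push_cast
      ring
    rw [h4]
    calc _ = (1 + |τ|) / 4 *
          (c * (1 + |τ|) ^ ((((j + 1 : ℕ) : ℝ) - 1) / 2) * exp (-(π / 2 * |τ|))) := by ring
      _ ≤ _ := mul_le_mul h3 (h τ) (by positivity) (norm_nonneg _)

end MaxParabolic

namespace MaxParabolic

/-! ### Cosets and primitive vectors -/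

/-- The last row of a matrix in `SL(m+1, ℤ)`; up to sign it determines the coset of the matrix
modulo the parabolic subgroup. -/
def lastRow {m : ℕ} (γ : SL(m + 1, ℤ)) : Fin (m + 1) → ℤ := γ.1 (Fin.last m)

theorem exists_sum_mul_lastRow_eq_one {m : ℕ} (γ : SL(m + 1, ℤ)) :
    ∃ u : Fin (m + 1) → ℤ, ∑ i, u i * lastRow γ i = 1 := by
  refine ⟨fun i => (γ⁻¹).1 i (Fin.last m), ?_⟩
  have h : γ.1 * (γ⁻¹).1 = 1 := congrArg Subtype.val (mul_inv_cancel γ)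
  have h1 := congrFun (congrFun h (Fin.last m)) (Fin.last m)
  rw [Matrix.mul_apply, Matrix.one_apply_eq] at h1
  exact (Finset.sum_congr rfl fun i _ => mul_comm _ _).trans h1

theorem lastRow_mul {m : ℕ} (p γ : SL(m + 1, ℤ)) (hp : p ∈ parabolic m) :
    lastRow (p * γ) = p.1 (Fin.last m) (Fin.last m) • lastRow γ := by
  funext j
  change (p.1 * γ.1) (Fin.last m) j = _
  rw [Matrix.mul_apply]
  exact Finset.sum_eq_single _ (fun i _ hi => by rw [hp i hi, zero_mul]) (by simp)

theorem parabolic_corner {m : ℕ} {p : SL(m + 1, ℤ)} (hp : p ∈ parabolic m) :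
    p.1 (Fin.last m) (Fin.last m) = 1 ∨ p.1 (Fin.last m) (Fin.last m) = -1 := by
  have h : p.1 * (p⁻¹).1 = 1 := congrArg Subtype.val (mul_inv_cancel p)
  have h1 := congrFun (congrFun h (Fin.last m)) (Fin.last m)
  rw [Matrix.mul_apply, Matrix.one_apply_eq, Finset.sum_eq_single (Fin.last m)
    (fun i _ hi => by rw [hp i hi, zero_mul]) (by simp)] at h1
  exact Int.eq_one_or_neg_one_of_mul_eq_one h1

theorem mul_inv_mem_parabolic {m : ℕ} {γ γ' : SL(m + 1, ℤ)} {ε : ℤ}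
    (h : lastRow γ' = ε • lastRow γ) : γ' * γ⁻¹ ∈ parabolic m := by
  intro j hj
  change (γ'.1 * (γ⁻¹).1) (Fin.last m) j = 0
  have h1 : γ.1 * (γ⁻¹).1 = 1 := congrArg Subtype.val (mul_inv_cancel γ)
  have h2 := congrFun (congrFun h1 (Fin.last m)) j
  rw [Matrix.one_apply_ne' hj, Matrix.mul_apply] at h2
  rw [Matrix.mul_apply]
  have h3 : ∀ i, γ'.1 (Fin.last m) i = ε * γ.1 (Fin.last m) i := fun i => congrFun h i
  simp only [h3, mul_assoc]
  rw [← Finset.mul_sum, h2, mul_zero]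

/-- A nonzero integer vector is a multiple of a primitive one. -/
theorem exists_eq_smul_primitive {N : ℕ} {c : Fin N → ℤ} (hc : c ≠ 0) :
    ∃ (g : ℤ) (p u : Fin N → ℤ), g ≠ 0 ∧ c = g • p ∧ ∑ i, u i * p i = 1 := by
  obtain ⟨g, hg⟩ := (IsPrincipalIdealRing.principal (Ideal.span (Set.range c))).principal
  have hmem : g ∈ Submodule.span ℤ (Set.range c) := by
    change g ∈ Ideal.span (Set.range c)
    rw [hg]
    exact Submodule.mem_span_singleton_self g
  obtain ⟨u, hu⟩ := (Submodule.mem_span_range_iff_exists_fun ℤ).1 hmem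
  have hdiv : ∀ i, ∃ a : ℤ, a * g = c i := by
    intro i
    have h1 : c i ∈ Ideal.span (Set.range c) := Ideal.subset_span (Set.mem_range_self i)
    rw [hg] at h1
    exact Submodule.mem_span_singleton.1 h1
  choose p hp using hdiv
  have hg0 : g ≠ 0 := by
    rintro rfl
    exact hc (funext fun i => by rw [← hp i, mul_zero]; rfl)
  refine ⟨g, p, u, hg0, funext fun i => ?_, ?_⟩
  · rw [← hp i]
    simp [mul_comm]
  · have h2 : g * ∑ i, u i * p i = g * 1 := by
      rw [mul_one, Finset.mul_sum]
      nth_rewrite 2 [← hu]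
      refine Finset.sum_congr rfl fun i _ => ?_
      rw [← hp i, smul_eq_mul]
      ring
    exact mul_left_cancel₀ hg0 h2

/-- A primitive vector is the last row of a matrix in `SL(m+1, ℤ)`: if the linear form `u` takes
the value one on it, then it extends any basis of the kernel of `u` to a basis of `ℤ ^ (m+1)`. -/
theorem exists_lastRow_eq {m : ℕ} (hm : 1 ≤ m) {p u : Fin (m + 1) → ℤ}
    (hup : ∑ i, u i * p i = 1) : ∃ γ : SL(m + 1, ℤ), lastRow γ = p := by
  let φ : (Fin (m + 1) → ℤ) →ₗ[ℤ] ℤ := ∑ i, u i • LinearMap.proj i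
  have hφ : ∀ v, φ v = ∑ i, u i * v i := fun v => by simp [φ]
  have hφp : φ p = 1 := by rw [hφ, hup]
  let b := Module.finBasis ℤ (LinearMap.ker φ)
  let B := Module.Basis.mkFinCons p b
    (fun a x hx h => by
      have h1 := congrArg φ h
      rw [map_add, map_smul, hφp, LinearMap.mem_ker.1 hx, map_zero] at h1
      simpa using h1)
    (fun v => ⟨-φ v, by
      rw [LinearMap.mem_ker, map_add, map_smul, hφp]
      simp⟩)
  have hcard : m = Module.finrank ℤ (LinearMap.ker φ) := by
    have := Module.finrank_eq_card_basis B
    simp at this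
    omega
  have hB0 : B 0 = p := by simp [B]
  let e : Fin (Module.finrank ℤ (LinearMap.ker φ) + 1) ≃ Fin (m + 1) :=
    (finCongr (by omega)).trans Fin.revPerm
  have he : e 0 = Fin.last m := by
    simp [e]
  let B' := B.reindex e
  have hB' : B' (Fin.last m) = p := by
    rw [Module.Basis.reindex_apply, ← he, Equiv.symm_apply_apply, hB0]
  set M : Matrix (Fin (m + 1)) (Fin (m + 1)) ℤ := Matrix.of fun i j => B' i j with hM
  have hdet : IsUnit M.det := by
    have h1 := (Pi.basisFun ℤ (Fin (m + 1))).isUnit_det B'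
    rw [Module.Basis.det_apply] at h1
    have h2 : M.transpose = (Pi.basisFun ℤ (Fin (m + 1))).toMatrix B' := by
      ext i j
      simp [hM, Module.Basis.toMatrix_apply]
    rw [← Matrix.det_transpose, h2]
    exact h1
  have h0 : Fin.last m ≠ 0 := by
    intro h
    have := congrArg Fin.val h
    simp at this
    omega
  rcases Int.isUnit_iff.1 hdet with h | h
  · exact ⟨⟨M, h⟩, hB'⟩
  · refine ⟨⟨M.updateRow 0 ((-1 : ℤ) • M 0), ?_⟩, ?_⟩
    · rw [Matrix.det_updateRow_smul, Matrix.updateRow_eq_self, h]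
      norm_num
    · change M.updateRow 0 ((-1 : ℤ) • M 0) (Fin.last m) = p
      rw [Matrix.updateRow_ne h0]
      exact hB'

/-- The cosets that index the Eisenstein series. -/
abbrev ParabolicCoset (m : ℕ) : Type := Quotient (QuotientGroup.rightRel (parabolic m))

theorem lastRow_ne_zero {m : ℕ} (γ : SL(m + 1, ℤ)) : lastRow γ ≠ 0 := by
  intro h
  obtain ⟨u, hu⟩ := exists_sum_mul_lastRow_eq_one γ
  simp [h] at hu

theorem dvd_of_smul_lastRow_eq {m : ℕ} {γ γ' : SL(m + 1, ℤ)} {k k' : ℤ}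
    (h : k • lastRow γ = k' • lastRow γ') : k' ∣ k := by
  obtain ⟨u, hu⟩ := exists_sum_mul_lastRow_eq_one γ
  refine ⟨∑ i, u i * lastRow γ' i, ?_⟩
  have h1 : k * ∑ i, u i * lastRow γ i = k' * ∑ i, u i * lastRow γ' i := by
    rw [Finset.mul_sum, Finset.mul_sum]
    refine Finset.sum_congr rfl fun i _ => ?_
    have h2 : k * lastRow γ i = k' * lastRow γ' i := congrFun h i
    linear_combination u i * h2
  rw [hu, mul_one] at h1
  exact h1

/-- Every nonzero integer vector is uniquely a nonzero multiple of the last row of the chosen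
representative of a coset. -/
theorem bijective_smul_lastRow {m : ℕ} (hm : 1 ≤ m) :
    Function.Bijective (fun p : {k : ℤ // k ≠ 0} × ParabolicCoset m =>
      (⟨p.1.1 • lastRow p.2.out, smul_ne_zero p.1.2 (lastRow_ne_zero _)⟩ :
        {c : Fin (m + 1) → ℤ // c ≠ 0})) := by
  constructor
  · rintro ⟨⟨k, hk⟩, x⟩ ⟨⟨k', hk'⟩, x'⟩ h
    have h1 : k • lastRow x.out = k' • lastRow x'.out := congrArg Subtype.val h
    obtain ⟨ε, hε⟩ := dvd_of_smul_lastRow_eq h1.symm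
    have h2 : lastRow x.out = ε • lastRow x'.out := by
      have : k • lastRow x.out = k • (ε • lastRow x'.out) := by rw [h1, hε, mul_smul]
      exact smul_right_injective _ hk this
    have h3 := mul_inv_mem_parabolic h2
    have h4 : x' = x := by
      rw [← x.out_eq, ← x'.out_eq]
      exact Quotient.sound (QuotientGroup.rightRel_apply.2 h3)
    subst h4
    have h5 : k = k' := smul_left_injective _ (lastRow_ne_zero _) h1
    subst h5
    rfl
  · rintro ⟨c, hc⟩
    obtain ⟨g, p, u, hg, rfl, hu⟩ := exists_eq_smul_primitive hc
    obtain ⟨γ, rfl⟩ := exists_lastRow_eq hm hu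
    let x : ParabolicCoset m := Quotient.mk _ γ
    have h1 : γ * x.out⁻¹ ∈ parabolic m :=
      QuotientGroup.rightRel_apply.1 (Quotient.mk_out (s := QuotientGroup.rightRel (parabolic m)) γ)
    have h2 := lastRow_mul _ x.out h1
    rw [inv_mul_cancel_right] at h2
    rcases parabolic_corner h1 with h3 | h3
    · refine ⟨⟨⟨g, hg⟩, x⟩, Subtype.ext ?_⟩
      change g • lastRow x.out = g • lastRow γ
      rw [h2, h3, one_smul]
    · refine ⟨⟨⟨-g, neg_ne_zero.2 hg⟩, x⟩, Subtype.ext ?_⟩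
      change (-g) • lastRow x.out = g • lastRow γ
      rw [h2, h3, neg_one_smul, neg_smul, smul_neg]

/-- A sum over nonzero integer vectors of a homogeneous function factors through the cosets. -/
theorem hasSum_coset {m : ℕ} (hm : 1 ≤ m) {f : (Fin (m + 1) → ℤ) → ℂ} {g : ℤ → ℂ} {G L : ℂ}
    (hf : ∀ (k : ℤ) (γ : SL(m + 1, ℤ)), k ≠ 0 → f (k • lastRow γ) = g k * f (lastRow γ))
    (hg1 : g 1 = 1) (hG : HasSum (fun k : {k : ℤ // k ≠ 0} => g k) G) (hG0 : G ≠ 0)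
    (hL : HasSum (fun c : {c : Fin (m + 1) → ℤ // c ≠ 0} => f c) L) :
    HasSum (fun x : ParabolicCoset m => f (lastRow x.out)) (L / G) := by
  let e := Equiv.ofBijective _ (bijective_smul_lastRow hm)
  have h1 : HasSum (fun p : {k : ℤ // k ≠ 0} × ParabolicCoset m =>
      g p.1 * f (lastRow p.2.out)) L :=
    (e.hasSum_iff.2 hL).congr_fun fun p => (hf p.1 _ p.1.2).symm
  have h2 : Summable fun x : ParabolicCoset m => f (lastRow x.out) := by
    have := h1.summable.comp_injective (i := fun x : ParabolicCoset m =>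
      ((⟨1, one_ne_zero⟩ : {k : ℤ // k ≠ 0}), x)) (fun x y h => (Prod.mk.inj h).2)
    refine this.congr fun x => ?_
    simp [hg1]
  have h3 := (hG.mul h2.hasSum h1.summable).unique h1
  have h4 : L / G = ∑' x : ParabolicCoset m, f (lastRow x.out) := by
    rw [← h3, mul_div_cancel_left₀ _ hG0]
  rw [h4]
  exact h2.hasSum

/-- The sum of `|k| ^ (-2s)` over nonzero integers. -/
theorem hasSum_int_cpow {s : ℂ} (hs : 1 / 2 < s.re) :
    HasSum (fun k : {k : ℤ // k ≠ 0} => ((((k : ℝ) ^ 2)⁻¹ : ℝ) : ℂ) ^ s)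
      (2 * riemannZeta (2 * s)) := by
  have hs2 : 1 < (2 * s).re := by
    simp
    linarith
  have hs0 : s ≠ 0 := fun h => by
    rw [h] at hs
    norm_num at hs
  have key : ∀ j : ℕ, ((((j : ℝ) ^ 2)⁻¹ : ℝ) : ℂ) ^ s = 1 / (j : ℂ) ^ (2 * s) := by
    intro j
    have h0 : (0 : ℝ) ≤ (j : ℝ)⁻¹ := by positivity
    have h1 : (((j : ℝ) ^ 2)⁻¹ : ℝ) = (j : ℝ)⁻¹ * (j : ℝ)⁻¹ := by
      rw [sq, mul_inv]
    rw [h1, Complex.ofReal_mul, Complex.mul_cpow_ofReal_nonneg h0 h0]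
    rcases eq_or_ne (j : ℂ) 0 with h | h
    · have : (j : ℝ) = 0 := by exact_mod_cast h
      simp [h, this, hs0]
    · rw [← Complex.cpow_add _ _ (by simpa using h), ← two_mul, Complex.ofReal_inv,
        Complex.ofReal_natCast, Complex.inv_cpow _ _
          (by simp [Complex.natCast_arg, Real.pi_ne_zero.symm]), one_div]
  have hz : HasSum (fun j : ℕ => ((((j : ℝ) ^ 2)⁻¹ : ℝ) : ℂ) ^ s) (riemannZeta (2 * s)) := by
    simp only [key]
    rw [zeta_eq_tsum_one_div_nat_cpow hs2]
    exact (Complex.summable_one_div_nat_cpow.2 hs2).hasSum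
  have hz1 : HasSum (fun j : ℕ => ((((((-((j : ℤ) + 1) : ℤ) : ℝ) ^ 2)⁻¹ : ℝ) : ℂ)) ^ s)
      (riemannZeta (2 * s)) := by
    have h1 := (hasSum_nat_add_iff' 1).2 hz
    rw [Finset.sum_range_one] at h1
    simp only [Nat.cast_zero, ne_eq, OfNat.ofNat_ne_zero, not_false_eq_true, zero_pow, inv_zero,
      Complex.ofReal_zero, Complex.zero_cpow hs0, sub_zero] at h1
    refine h1.congr_fun fun j => ?_
    push_cast
    rw [neg_sq]
  have hint : HasSum (fun k : ℤ => ((((k : ℝ) ^ 2)⁻¹ : ℝ) : ℂ) ^ s)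
      (riemannZeta (2 * s) + riemannZeta (2 * s)) :=
    HasSum.of_nat_of_neg_add_one (by simpa only [Int.cast_natCast] using hz)
      (by simpa only using hz1)
  rw [two_mul]
  have hsupp : Function.support (fun k : ℤ => ((((k : ℝ) ^ 2)⁻¹ : ℝ) : ℂ) ^ s) ⊆ {k | k ≠ 0} := by
    intro k hk hk0
    subst hk0
    simp [hs0] at hk
  exact (hasSum_subtype_iff_of_support_subset hsupp).2 hint

end MaxParabolic

namespace MaxParabolic

open Real Complex

/-! ### The Eisenstein series as an Epstein zeta function -/

/-- The positive diagonal `Y` rescaled to have determinant one. -/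
noncomputable def unimodular {N : ℕ} (Y : Fin N → ℝ) (i : Fin N) : ℝ :=
  Y i * (∏ j, Y j) ^ (-(1 / N : ℝ))

theorem unimodular_pos {N : ℕ} {Y : Fin N → ℝ} (hY : ∀ i, 0 < Y i) (i : Fin N) :
    0 < unimodular Y i :=
  mul_pos (hY i) (rpow_pos_of_pos (Finset.prod_pos fun j _ => hY j) _)

theorem prod_unimodular {N : ℕ} (hN : N ≠ 0) {Y : Fin N → ℝ} (hY : ∀ i, 0 < Y i) :
    ∏ i, unimodular Y i = 1 := by
  have hD : 0 < ∏ j, Y j := Finset.prod_pos fun j _ => hY j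
  have hN0 : (N : ℝ) ≠ 0 := Nat.cast_ne_zero.2 hN
  simp only [unimodular]
  rw [Finset.prod_mul_distrib, Finset.prod_const, Finset.card_univ, Fintype.card_fin,
    ← rpow_mul_natCast hD.le, neg_mul, one_div_mul_cancel hN0, rpow_neg_one,
    mul_inv_cancel₀ hD.ne']

theorem primalForm_smul {N : ℕ} (η : Fin N → ℝ) (X : Fin N → Fin N → ℝ) (k : ℤ)
    (c : Fin N → ℤ) : primalForm η X (k • c) = (k : ℝ) ^ 2 * primalForm η X c := by
  simp only [primalForm, Finset.mul_sum]
  refine Finset.sum_congr rfl fun j _ => ?_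
  have h : ∑ i, (if i < j then ((k • c) i : ℝ) * X i j else 0) =
      k * ∑ i, (if i < j then (c i : ℝ) * X i j else 0) := by
    rw [Finset.mul_sum]
    refine Finset.sum_congr rfl fun i _ => ?_
    split_ifs
    · simp only [Pi.smul_apply, smul_eq_mul, Int.cast_mul]
      ring
    · rw [mul_zero]
  rw [h]
  simp only [Pi.smul_apply, smul_eq_mul, Int.cast_mul]
  ring

theorem primalForm_unimodular {N : ℕ} (Y : Fin N → ℝ) (X : Fin N → Fin N → ℝ) (c : Fin N → ℤ) :
    primalForm (unimodular Y) X c = ((∏ j, Y j) ^ (-(1 / N : ℝ))) ^ 2 * primalForm Y X c := by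
  simp only [primalForm, unimodular, Finset.mul_sum]
  exact Finset.sum_congr rfl fun j _ => by ring

theorem lastRow_mul_iwasawa {m : ℕ} (Y : Fin (m + 1) → ℝ) (x : Fin (m + 1) → Fin (m + 1) → ℝ)
    (γ : SL(m + 1, ℤ)) (j : Fin (m + 1)) :
    (γ.1.map (Int.cast : ℤ → ℝ) * (iwasawaX x * Matrix.diagonal Y)) (Fin.last m) j =
      Y j * ((lastRow γ j : ℝ) + ∑ i, if i < j then (lastRow γ i : ℝ) * x i j else 0) := by
  rw [← Matrix.mul_assoc, Matrix.mul_diagonal, mul_comm, Matrix.mul_apply]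
  congr 1
  have h : ∀ i, (γ.1.map (Int.cast : ℤ → ℝ)) (Fin.last m) i * iwasawaX x i j =
      (if i = j then (lastRow γ i : ℝ) else 0) +
        if i < j then (lastRow γ i : ℝ) * x i j else 0 := by
    intro i
    change (lastRow γ i : ℝ) * (if i = j then 1 else if i < j then x i j else 0) = _
    by_cases h1 : i = j
    · simp [h1]
    · by_cases h2 : i < j <;> simp [h1, h2]
  rw [Finset.sum_congr rfl fun i _ => h i, Finset.sum_add_distrib, Finset.sum_ite_eq' Finset.univ j]
  simp

/-- The value of `Det (γ z)` in terms of the quadratic form of determinant one attached to `z`. -/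
theorem detAct_eq {m n : ℕ} (hN : m + 1 = 2 * n) {Y : Fin (m + 1) → ℝ} (hY : ∀ i, 0 < Y i)
    (x : Fin (m + 1) → Fin (m + 1) → ℝ) (γ : SL(m + 1, ℤ)) :
    detAct (iwasawaX x * Matrix.diagonal Y) γ =
      (primalForm (unimodular Y) x (lastRow γ))⁻¹ ^ n := by
  have hD : 0 < ∏ j, Y j := Finset.prod_pos fun j _ => hY j
  have hdet : (γ.1.map (Int.cast : ℤ → ℝ)).det = 1 := by
    have h := (RingHom.map_det (Int.castRingHom ℝ) γ.1).symm
    rw [γ.2, map_one] at h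
    exact h
  have hQ : ∑ j, ((γ.1.map (Int.cast : ℤ → ℝ) * (iwasawaX x * Matrix.diagonal Y)) (Fin.last m) j)
      ^ 2 = primalForm Y x (lastRow γ) :=
    Finset.sum_congr rfl fun j _ => by rw [lastRow_mul_iwasawa, mul_pow]
  have hQ0 : 0 ≤ primalForm Y x (lastRow γ) :=
    Finset.sum_nonneg fun j _ => mul_nonneg (sq_nonneg _) (sq_nonneg _)
  have hpow : (((∏ j, Y j) ^ (-(1 / (m + 1 : ℕ) : ℝ))) ^ 2) ^ n = (∏ j, Y j)⁻¹ := by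
    rw [← pow_mul, ← hN, ← rpow_mul_natCast hD.le, neg_mul, one_div_mul_cancel (by positivity),
      rpow_neg_one]
  have hsq : √(primalForm Y x (lastRow γ)) ^ (m + 1) = primalForm Y x (lastRow γ) ^ n := by
    rw [congrArg (√(primalForm Y x (lastRow γ)) ^ ·) hN]
    simp only [pow_mul, Real.sq_sqrt hQ0]
  rw [detAct, iwasawaDet, hQ, hsq, Matrix.det_mul, hdet, one_mul,
    Matrix.det_mul, det_iwasawaX, one_mul, Matrix.det_diagonal, abs_of_pos hD,
    primalForm_unimodular, inv_pow, mul_pow, hpow, mul_inv, inv_inv, div_eq_mul_inv]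

theorem ofReal_pow_cpow {r : ℝ} (hr : 0 ≤ r) (n : ℕ) (s : ℂ) :
    (((r ^ n : ℝ)) : ℂ) ^ s = (r : ℂ) ^ (n * s) := by
  rw [cpow_nat_mul]
  induction n with
  | zero => simp
  | succ n ih =>
    rw [pow_succ, ofReal_mul, mul_cpow_ofReal_nonneg (pow_nonneg hr n) hr, ih, pow_succ]

theorem eisensteinTerm_eq {m n : ℕ} (hN : m + 1 = 2 * n) {Y : Fin (m + 1) → ℝ}
    (hY : ∀ i, 0 < Y i) (x : Fin (m + 1) → Fin (m + 1) → ℝ) (s : ℂ) (a : ParabolicCoset m) :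
    eisensteinTerm (iwasawaX x * Matrix.diagonal Y) s a =
      (π : ℂ) ^ (n * s) *
        ((π * primalForm (unimodular Y) x (lastRow a.out) : ℝ) : ℂ)⁻¹ ^ (n * s) := by
  have h0 : 0 < primalForm (unimodular Y) x (lastRow a.out) :=
    (isTriFormZero_primalForm _ _).pos (unimodular_pos hY) (lastRow_ne_zero _)
  rw [← ofReal_inv, ← mul_cpow_ofReal_nonneg pi_pos.le (by positivity), ← ofReal_mul, mul_inv,
    mul_inv_cancel_left₀ pi_ne_zero, ← ofReal_pow_cpow (by positivity), ← detAct_eq hN hY]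
  conv_lhs => rw [← a.out_eq]
  rfl

theorem completedRiemannZeta_two_mul {t : ℂ} (ht : 0 < t.re) :
    completedRiemannZeta (2 * t) = (π : ℂ) ^ (-t) * Complex.Gamma t * riemannZeta (2 * t) := by
  have h1 : 0 < (2 * t).re := by simpa using ht
  have h2 : Gammaℝ (2 * t) = (π : ℂ) ^ (-t) * Complex.Gamma t := by
    rw [Gammaℝ_def, mul_div_cancel_left₀ _ two_ne_zero, ← mul_neg,
      mul_div_cancel_left₀ _ two_ne_zero]
  rw [riemannZeta_def_of_ne_zero (fun h => by simp [h] at h1), ← h2,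
    mul_div_cancel₀ _ (Gammaℝ_ne_zero_of_re_pos h1)]

/-- The completed Eisenstein series is the Mellin transform of a theta function. -/
theorem hasSum_eisensteinTerm {m n : ℕ} (hN : m + 1 = 2 * n) (hn : 1 ≤ n)
    {Y : Fin (m + 1) → ℝ} (hY : ∀ i, 0 < Y i) (x : Fin (m + 1) → Fin (m + 1) → ℝ)
    {ω : ℂ} (hω : 0 < ω.re) {s : ℂ} (hs : 1 < s.re) :
    HasSum (eisensteinTerm (iwasawaX x * Matrix.diagonal Y) s)
      ((thetaPair hN hn (unimodular_pos hY) (prod_unimodular m.succ_ne_zero hY) x hω).Λ (n * s) *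
        (ω⁻¹ ^ (n * s))⁻¹ / (2 * completedRiemannZeta (2 * (n * s)))) := by
  have hn1 : (1 : ℝ) ≤ n := by exact_mod_cast hn
  have hre : ((n : ℂ) * s).re = n * s.re := by simp
  have hns : (n : ℝ) < (n * s).re := by
    rw [hre]
    nlinarith
  have hns0 : 0 < ((n : ℂ) * s).re := by linarith
  have hω0 : ω ≠ 0 := fun h => by simp [h] at hω
  set t : ℂ := n * s with ht
  set Q := primalForm (unimodular Y) x with hQ
  have hΓ : Complex.Gamma t ≠ 0 := Complex.Gamma_ne_zero_of_re_pos hns0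
  have hc : ω⁻¹ ^ t ≠ 0 := (cpow_ne_zero_iff_of_exponent_ne_zero
    (fun h => by simp [h] at hns0)).2 (inv_ne_zero hω0)
  have hL := (hasSum_thetaPair_Λ x hN hn (unimodular_pos hY)
    (prod_unimodular m.succ_ne_zero hY) hω hns).mul_left (ω⁻¹ ^ t * Complex.Gamma t)⁻¹
  simp only [inv_mul_cancel_left₀ (mul_ne_zero hc hΓ)] at hL
  have hG := hasSum_int_cpow (s := t) (by linarith)
  have h2t : 1 < (2 * t).re := by
    simp only [mul_re, re_ofNat, im_ofNat, zero_mul, sub_zero]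
    linarith
  have hG0 : 2 * riemannZeta (2 * t) ≠ 0 :=
    mul_ne_zero two_ne_zero (riemannZeta_ne_zero_of_one_le_re h2t.le)
  have hsum := hasSum_coset (by omega) (f := fun c => ((π * Q c : ℝ) : ℂ)⁻¹ ^ t)
    (g := fun k => ((((k : ℝ) ^ 2)⁻¹ : ℝ) : ℂ) ^ t) (fun k γ hk => ?_) (by simp) hG hG0 hL
  · have h2 : (π : ℂ) ^ t ≠ 0 := (cpow_ne_zero_iff_of_exponent_ne_zero
      (fun h => by simp [h] at hns0)).2 (ofReal_ne_zero.2 pi_ne_zero)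
    have h3 : (thetaPair hN hn (unimodular_pos hY) (prod_unimodular m.succ_ne_zero hY) x hω).Λ t *
        (ω⁻¹ ^ t)⁻¹ / (2 * completedRiemannZeta (2 * t)) = (π : ℂ) ^ t * ((ω⁻¹ ^ t *
        Complex.Gamma t)⁻¹ * (thetaPair hN hn (unimodular_pos hY)
        (prod_unimodular m.succ_ne_zero hY) x hω).Λ t / (2 * riemannZeta (2 * t))) := by
      rw [completedRiemannZeta_two_mul hns0, cpow_neg]
      field_simp
    rw [h3]
    exact (hsum.mul_left ((π : ℂ) ^ t)).congr_fun fun a => eisensteinTerm_eq hN hY x s a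
  · simp only [hQ, primalForm_smul]
    have h0 : 0 ≤ primalForm (unimodular Y) x (lastRow γ) :=
      ((isTriFormZero_primalForm _ _).pos (unimodular_pos hY) (lastRow_ne_zero _)).le
    rw [← ofReal_inv, ← ofReal_inv, ← mul_cpow_ofReal_nonneg (by positivity) (by positivity),
      ← ofReal_mul]
    congr 2
    rw [mul_left_comm, mul_inv]

/-- A meromorphic function has a normal form on `ℂ`, which is analytic and takes the same values
where the function is analytic. -/
theorem exists_meromorphicNFOn_eq {F : ℂ → ℂ} (hF : ∀ w, MeromorphicAt F w) :
    ∃ E : ℂ → ℂ, MeromorphicNFOn E Set.univ ∧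
      ∀ w, AnalyticAt ℂ F w → AnalyticAt ℂ E w ∧ E w = F w := by
  have hF' : MeromorphicOn F Set.univ := fun w _ => hF w
  refine ⟨toMeromorphicNFOn F Set.univ, meromorphicNFOn_toMeromorphicNFOn F Set.univ,
    fun w hw => ?_⟩
  have h1 := (hw.meromorphicNFAt.eventuallyEq_nhdsNE_iff_eventuallyEq_nhds
    (meromorphicNFOn_toMeromorphicNFOn F Set.univ (Set.mem_univ w))).1
      (hF'.toMeromorphicNFOn_eq_self_on_nhdsNE (Set.mem_univ w)).symm
  exact ⟨hw.congr h1, h1.eq_of_nhds.symm⟩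

/-- The function `(1 - s) ξ(s)`, where `ξ` is the completed Riemann zeta function; unlike `ξ`
in Mathlib, it has the correct value `-1` at the pole `s = 1` of `ξ`. -/
noncomputable def regularizedZeta (s : ℂ) : ℂ :=
  (1 - s) * completedRiemannZeta₀ s - (1 - s) / s - 1

theorem regularizedZeta_eq {s : ℂ} (hs : s ≠ 1) :
    regularizedZeta s = (1 - s) * completedRiemannZeta s := by
  have h : 1 - s ≠ 0 := sub_ne_zero.2 hs.symm
  rw [completedRiemannZeta_eq, regularizedZeta]
  field_simp

theorem regularizedZeta_ne_zero {s : ℂ} (hs : 1 ≤ s.re) : regularizedZeta s ≠ 0 := by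
  rcases eq_or_ne s 1 with rfl | h
  · simp [regularizedZeta]
  · have h1 : s ≠ 0 := fun h => by
      rw [h] at hs
      norm_num at hs
    have h2 := riemannZeta_ne_zero_of_one_le_re hs
    rw [riemannZeta_def_of_ne_zero h1] at h2
    rw [regularizedZeta_eq h]
    exact mul_ne_zero (sub_ne_zero.2 h.symm) (div_ne_zero_iff.1 h2).1

theorem analyticAt_regularizedZeta {s : ℂ} (hs : s ≠ 0) : AnalyticAt ℂ regularizedZeta s := by
  have h : AnalyticAt ℂ completedRiemannZeta₀ s := differentiable_completedZeta₀.analyticAt s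
  unfold regularizedZeta
  fun_prop (disch := assumption)

theorem meromorphicAt_regularizedZeta (s : ℂ) : MeromorphicAt regularizedZeta s := by
  have h : MeromorphicAt completedRiemannZeta₀ s :=
    (differentiable_completedZeta₀.analyticAt s).meromorphicAt
  unfold regularizedZeta
  fun_prop

theorem meromorphicAt_Λ (P : WeakFEPair ℂ) (s : ℂ) : MeromorphicAt P.Λ s := by
  have h : MeromorphicAt P.Λ₀ s := (P.differentiable_Λ₀.analyticAt s).meromorphicAt
  change MeromorphicAt (fun s => P.Λ₀ s - (1 / s) • P.f₀ - (P.ε / (P.k - s)) • P.g₀) s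
  fun_prop

theorem analyticAt_Λ (P : WeakFEPair ℂ) {s : ℂ} (hs : s ≠ 0) (hs' : (P.k : ℂ) - s ≠ 0) :
    AnalyticAt ℂ P.Λ s := by
  have h : AnalyticAt ℂ P.Λ₀ s := P.differentiable_Λ₀.analyticAt s
  change AnalyticAt ℂ (fun s => P.Λ₀ s - (1 / s) • P.f₀ - (P.ε / (P.k - s)) • P.g₀) s
  fun_prop (disch := assumption)

/-- The Eisenstein series has a meromorphic continuation, which every rotated theta function
computes on the critical line. At the one point of this line where `2 n w` is the pole of the zeta
function, the Eisenstein series vanishes. -/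
theorem exists_isEisensteinSeries {m n : ℕ} (hN : m + 1 = 2 * n) (hn : 1 ≤ n)
    {Y : Fin (m + 1) → ℝ} (hY : ∀ i, 0 < Y i) (x : Fin (m + 1) → Fin (m + 1) → ℝ)
    {ω : ℂ} (hω : 0 < ω.re) :
    ∃ E : ℂ → ℂ, IsEisensteinSeries (iwasawaX x * Matrix.diagonal Y) E ∧
      ∀ w : ℂ, w.re = 1 / 2 → AnalyticAt ℂ E w ∧
        E w = (1 - 2 * (n * w)) *
          (thetaPair hN hn (unimodular_pos hY) (prod_unimodular m.succ_ne_zero hY) x hω).Λ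
            (n * w) * (ω⁻¹ ^ (n * w))⁻¹ / (2 * regularizedZeta (2 * (n * w))) := by
  have hn1 : (1 : ℝ) ≤ n := by exact_mod_cast hn
  have hre : ∀ s : ℂ, ((n : ℂ) * s).re = n * s.re := fun s => by simp
  have hre2 : ∀ s : ℂ, (2 * ((n : ℂ) * s)).re = 2 * (n * s.re) := fun s => by simp
  have hω0 : ω ≠ 0 := fun h => by simp [h] at hω
  set P := thetaPair hN hn (unimodular_pos hY) (prod_unimodular m.succ_ne_zero hY) x hω with hP
  have hk : (P.k : ℂ) = n := by simp [hP, thetaPair]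
  have hc : ∀ s : ℂ, ω⁻¹ ^ s ≠ 0 := fun s => by
    rw [cpow_def_of_ne_zero (inv_ne_zero hω0)]
    exact Complex.exp_ne_zero _
  have hpow : ∀ w : ℂ, AnalyticAt ℂ (fun s : ℂ => (ω⁻¹ ^ (n * s))⁻¹) w := by
    intro w
    have h1 : AnalyticAt ℂ (fun s : ℂ => ω⁻¹ ^ (n * s)) w := by
      simp only [cpow_def_of_ne_zero (inv_ne_zero hω0)]
      fun_prop
    exact h1.inv (hc _)
  set F : ℂ → ℂ := fun s => (1 - 2 * (n * s)) * P.Λ (n * s) * (ω⁻¹ ^ (n * s))⁻¹ /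
    (2 * regularizedZeta (2 * (n * s))) with hF
  have hmero : ∀ w, MeromorphicAt F w := by
    intro w
    have h1 : MeromorphicAt (fun s : ℂ => P.Λ (n * s)) w :=
      (meromorphicAt_Λ P _).comp_analyticAt (by fun_prop)
    have h2 : MeromorphicAt (fun s : ℂ => regularizedZeta (2 * (n * s))) w :=
      (meromorphicAt_regularizedZeta _).comp_analyticAt (by fun_prop)
    have h3 := (hpow w).meromorphicAt
    simp only [hF]
    fun_prop
  have han : ∀ w : ℂ, w.re ≠ 1 → 1 / 2 ≤ w.re → AnalyticAt ℂ F w := by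
    intro w hw1 hw
    have h0 : 1 ≤ (2 * ((n : ℂ) * w)).re := by
      rw [hre2]
      nlinarith
    have h1 : AnalyticAt ℂ (fun s : ℂ => P.Λ (n * s)) w := by
      refine AnalyticAt.fun_comp (g := P.Λ) (f := fun s : ℂ => n * s)
        (analyticAt_Λ P (s := n * w) (fun h => ?_) (fun h => ?_)) (by fun_prop)
      · rw [h] at h0
        norm_num at h0
      · rw [hk] at h
        have h3 := congrArg re h
        rw [sub_re, hre, natCast_re, zero_re] at h3
        apply hw1
        nlinarith
    have h2 : AnalyticAt ℂ (fun s : ℂ => regularizedZeta (2 * (n * s))) w := by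
      refine AnalyticAt.fun_comp (g := regularizedZeta) (f := fun s : ℂ => 2 * (n * s))
        (analyticAt_regularizedZeta fun h => ?_) (by fun_prop)
      rw [h] at h0
      norm_num at h0
    have h3 := hpow w
    have h4 : 2 * regularizedZeta (2 * (n * w)) ≠ 0 :=
      mul_ne_zero two_ne_zero (regularizedZeta_ne_zero h0)
    simp only [hF]
    fun_prop (disch := assumption)
  obtain ⟨E, hE, hEF⟩ := exists_meromorphicNFOn_eq hmero
  refine ⟨E, ⟨fun s hs => ?_, hE⟩, fun w hw => hEF w (han w (by rw [hw]; norm_num) hw.ge)⟩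
  rw [(hEF s (han s hs.ne' (by linarith))).2]
  have h0 : 1 < (2 * ((n : ℂ) * s)).re := by
    rw [hre2]
    nlinarith
  have h1 : 2 * ((n : ℂ) * s) ≠ 1 := fun h => by
    rw [h] at h0
    norm_num at h0
  have h2 : 1 - 2 * ((n : ℂ) * s) ≠ 0 := sub_ne_zero.2 h1.symm
  have h3 : F s = P.Λ (n * s) * (ω⁻¹ ^ (n * s))⁻¹ / (2 * completedRiemannZeta (2 * (n * s))) := by
    simp only [hF]
    rw [regularizedZeta_eq h1, mul_left_comm 2 (1 - 2 * ((n : ℂ) * s)), mul_assoc _ (P.Λ _),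
      mul_div_mul_left _ _ h2]
  rw [h3]
  exact hasSum_eisensteinTerm hN hn hY x hω hs

end MaxParabolic

namespace MaxParabolic

open Real

/-! ### The bound on the critical line -/

theorem one_add_two_mul_pow_four_le {u : ℝ} (hu : 0 ≤ u) :
    (1 + 2 * u) ^ 4 ≤ 16 * 8 ^ 4 * exp (π / 4 * u) := by
  have h1 : (1 + u) / 8 ≤ exp (u / 8) := by linarith [add_one_le_exp (u / 8)]
  have h2 : exp (u / 8) ^ 4 ≤ exp (π / 4 * u) := by
    rw [← exp_nat_mul, exp_le_exp]
    push_cast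
    nlinarith [two_le_pi]
  have h3 := (pow_le_pow_left₀ (by positivity) h1 4).trans h2
  have h4 : (1 + 2 * u) ^ 4 ≤ (2 * (1 + u)) ^ 4 := pow_le_pow_left₀ (by positivity) (by linarith) 4
  calc (1 + 2 * u) ^ 4 ≤ (2 * (1 + u)) ^ 4 := h4
    _ = 16 * 8 ^ 4 * ((1 + u) / 8) ^ 4 := by ring
    _ ≤ _ := by gcongr

theorem norm_inv_cpow_exp {θ : ℝ} (hθ : |θ| < π) (s : ℂ) :
    ‖((Complex.exp (θ * Complex.I))⁻¹ ^ s)⁻¹‖ = exp (-(θ * s.im)) := by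
  have h := abs_lt.1 hθ
  have hlog : Complex.log (Complex.exp (θ * Complex.I))⁻¹ = -(θ * Complex.I) := by
    rw [← Complex.exp_neg, Complex.log_exp]
    · simp
      linarith
    · simp
      linarith
  rw [Complex.cpow_def_of_ne_zero (inv_ne_zero (Complex.exp_ne_zero _)), hlog, ← Complex.exp_neg,
    Complex.norm_exp]
  simp

/-- The completed zeta factor of the Eisenstein series is bounded below on the critical line. -/
theorem exists_le_norm_completedRiemannZeta (n : ℕ) (hn : 1 ≤ n) :
    ∃ c : ℝ, 0 < c ∧ ∀ w : ℂ, w.re = 1 / 2 → 2 * (n * w) ≠ 1 →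
      c * (1 + n * |w.im|) ^ (((n : ℝ) - 1) / 2) * exp (-(π / 2 * (n * |w.im|))) ≤
        ‖completedRiemannZeta (2 * (n * w))‖ * (1 + 2 * (n * |w.im|)) ^ 4 := by
  have hn1 : (1 : ℝ) ≤ n := by exact_mod_cast hn
  obtain ⟨c₁, hc₁, h₁⟩ := exists_le_norm_Gamma n hn
  obtain ⟨c₂, hc₂, h₂⟩ := exists_le_norm_riemannZeta n hn
  refine ⟨π ^ (-((n : ℝ) / 2)) * c₁ * c₂, by positivity, fun w hw hw1 => ?_⟩
  have hwt : w = 1 / 2 + Complex.I * w.im := by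
    apply Complex.ext <;> simp [hw]
  set t := w.im with ht
  have habs1 : |(n : ℝ) * t| = n * |t| := by rw [abs_mul, abs_of_nonneg (by positivity)]
  have habs2 : |2 * ((n : ℝ) * t)| = 2 * (n * |t|) := by
    rw [abs_mul, habs1, abs_of_nonneg (by positivity)]
  have hnw : (n : ℂ) * w = n / 2 + Complex.I * ((n * t : ℝ) : ℂ) := by
    rw [hwt]
    push_cast
    ring
  have h2nw : 2 * ((n : ℂ) * w) = n + Complex.I * ((2 * (n * t) : ℝ) : ℂ) := by
    rw [hnw]
    push_cast
    ring
  have hre : ((n : ℂ) * w).re = n / 2 := by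
    rw [hnw]
    simp
  have e1 := h₁ (n * t)
  have e2 := h₂ (2 * (n * t)) fun h1 h0 => hw1 (by rw [h2nw, h0, h1]; simp)
  rw [habs1, ← hnw] at e1
  rw [habs2, ← h2nw] at e2
  have hpi : ‖(π : ℂ) ^ (-(n * w))‖ = π ^ (-((n : ℝ) / 2)) := by
    rw [Complex.norm_cpow_eq_rpow_re_of_pos pi_pos, Complex.neg_re, hre]
  rw [completedRiemannZeta_two_mul (by rw [hre]; positivity), norm_mul, norm_mul, hpi]
  have := mul_le_mul e1 e2 hc₂.le (norm_nonneg _)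
  have := mul_le_mul_of_nonneg_left this (rpow_nonneg pi_pos.le (-((n : ℝ) / 2)))
  linarith

/-- The bound on the critical line in terms of the weights of the quadratic form and its dual. The
rotation by `π / 4` gains a factor `exp (-π n |t| / 4)`, which absorbs the loss of a power of `t`
in the lower bound for the zeta function; the growth of `1 / Γ` is that of the bound. -/
theorem exists_norm_eisenstein_le {m n : ℕ} (hN : m + 1 = 2 * n) (hn : 1 ≤ n) :
    ∃ K : ℝ, 0 ≤ K ∧ ∀ (Y : Fin (m + 1) → ℝ) (x : Fin (m + 1) → Fin (m + 1) → ℝ) (B : ℝ),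
      (∀ i, 0 < Y i) → Antitone (unimodular Y) → 0 ≤ B →
      (∀ i, exp (-B) ≤ unimodular Y i) → (∀ i, unimodular Y i ≤ exp B) →
      ∃ E : ℂ → ℂ, IsEisensteinSeries (iwasawaX x * Matrix.diagonal Y) E ∧
        ∀ w : ℂ, w.re = 1 / 2 → AnalyticAt ℂ E w ∧
          ‖E w‖ ≤ K * (exp (π / 2 * n * ‖w‖) / ‖w‖ ^ (((n : ℝ) - 1) / 2)) *
            ((1 + ∑ j, triWeight n (unimodular Y) j +
              ∑ j, triWeight n (fun i => (unimodular Y i.rev)⁻¹) j) * (1 + B)) := by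
  have hn1 : (1 : ℝ) ≤ n := by exact_mod_cast hn
  have hκ : 0 < √2 / 2 := by positivity
  have hκ1 : √2 / 2 ≤ 1 := by
    have : √2 ≤ 2 := by
      rw [sqrt_le_left (by norm_num)]
      norm_num
    linarith
  obtain ⟨K, hK, hΛ⟩ := exists_norm_thetaPair_Λ_le hN hn hκ hκ1
  obtain ⟨c, hc, hξ⟩ := exists_le_norm_completedRiemannZeta n hn
  refine ⟨K * (16 * 8 ^ 4) / (2 * c), by positivity, fun Y x B hY hanti hB hB1 hB2 => ?_⟩
  obtain ⟨E, hE, hEw⟩ := exists_isEisensteinSeries hN hn hY x (ω := 1) (by simp)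
  refine ⟨E, hE, fun w hw => ⟨(hEw w hw).1, ?_⟩⟩
  have hη := unimodular_pos hY
  set W := (1 + ∑ j, triWeight n (unimodular Y) j +
    ∑ j, triWeight n (fun i => (unimodular Y i.rev)⁻¹) j) * (1 + B) with hW
  have hW0 : 0 ≤ W := by
    have h1 : 0 ≤ ∑ j, triWeight n (unimodular Y) j :=
      Finset.sum_nonneg fun j _ => (triWeight_pos n hη j).le
    have h2 : 0 ≤ ∑ j, triWeight n (fun i => (unimodular Y i.rev)⁻¹) j :=
      Finset.sum_nonneg fun j _ => (triWeight_pos n (fun i => inv_pos.2 (hη _)) j).le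
    positivity
  have hRHS : 0 ≤ K * (16 * 8 ^ 4) / (2 * c) *
      (exp (π / 2 * n * ‖w‖) / ‖w‖ ^ (((n : ℝ) - 1) / 2)) * W := by positivity
  rcases eq_or_ne (2 * ((n : ℂ) * w)) 1 with h1 | h1
  · rw [(hEw w hw).2, h1]
    simpa using hRHS
  obtain ⟨θ, hθ1, hθ2, hθ3⟩ : ∃ θ : ℝ, |θ| < π ∧ cos θ = √2 / 2 ∧ θ * w.im = π / 4 * |w.im| := by
    rcases le_total 0 w.im with h | h
    · exact ⟨π / 4, by rw [abs_of_pos (by positivity)]; linarith [pi_pos], cos_pi_div_four,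
        by rw [abs_of_nonneg h]⟩
    · exact ⟨-(π / 4), by rw [abs_neg, abs_of_pos (by positivity)]; linarith [pi_pos],
        by rw [cos_neg, cos_pi_div_four], by rw [abs_of_nonpos h]; ring⟩
  set ω := Complex.exp (θ * Complex.I) with hωdef
  have hωre : ω.re = √2 / 2 := by rw [hωdef, Complex.exp_ofReal_mul_I_re, hθ2]
  have hω : 0 < ω.re := by rw [hωre]; positivity
  have hω1 : ‖ω‖ = 1 := Complex.norm_exp_ofReal_mul_I θ
  obtain ⟨E', hE', hEw'⟩ := exists_isEisensteinSeries hN hn hY x hω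
  obtain rfl := hE.unique hE'
  rw [(hEw' w hw).2, regularizedZeta_eq h1,
    mul_left_comm 2 (1 - 2 * ((n : ℂ) * w)), mul_assoc (1 - 2 * ((n : ℂ) * w)),
    mul_div_mul_left _ _ (sub_ne_zero.2 h1.symm), norm_div, norm_mul, norm_mul,
    norm_inv_cpow_exp hθ1]
  have hs : ((n : ℂ) * w).re = n / 2 := by simp [hw, div_eq_mul_inv]
  have hL := hΛ _ hη (prod_unimodular m.succ_ne_zero hY) x ω hω B _ hanti hωre hω1 hB hB1 hB2 hs
  rw [← hW] at hL
  have hξw := hξ w hw h1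
  set u : ℝ := n * |w.im| with hu
  have hu0 : 0 ≤ u := by positivity
  have him : θ * ((n : ℂ) * w).im = π / 4 * u := by
    have : ((n : ℂ) * w).im = n * w.im := by simp
    rw [this, hu]
    linear_combination (n : ℝ) * hθ3
  rw [him]
  set Z := ‖completedRiemannZeta (2 * (n * w))‖ with hZ
  have hZ0 : 0 < Z := by
    have h2 : 0 < Z * (1 + 2 * u) ^ 4 := lt_of_lt_of_le (by positivity) hξw
    exact pos_of_mul_pos_left h2 (by positivity)
  have hw0 : 0 < ‖w‖ := by
    have := Complex.re_le_norm w
    linarith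
  have hwu : ‖w‖ ≤ 1 + u := by
    have h2 := Complex.norm_le_abs_re_add_abs_im w
    rw [hw, abs_of_pos (by norm_num)] at h2
    nlinarith [abs_nonneg w.im]
  have huw : u ≤ n * ‖w‖ := by
    rw [hu]
    gcongr
    exact Complex.abs_im_le_norm w
  have hpw : ‖w‖ ^ (((n : ℝ) - 1) / 2) ≤ (1 + u) ^ (((n : ℝ) - 1) / 2) :=
    rpow_le_rpow hw0.le hwu (by linarith)
  have hpw0 : 0 < ‖w‖ ^ (((n : ℝ) - 1) / 2) := rpow_pos_of_pos hw0 _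
  have hloss := one_add_two_mul_pow_four_le hu0
  have hgain : exp (-(π / 4 * u)) * ‖w‖ ^ (((n : ℝ) - 1) / 2) * c ≤
      16 * 8 ^ 4 * exp (π / 2 * n * ‖w‖) * Z := by
    have h3 : c * ‖w‖ ^ (((n : ℝ) - 1) / 2) * exp (-(π / 2 * u)) ≤
        Z * (16 * 8 ^ 4 * exp (π / 4 * u)) := by
      refine le_trans ?_ (hξw.trans (by gcongr))
      gcongr
    have h4 := mul_le_mul_of_nonneg_right h3 (exp_pos (π / 4 * u)).le
    have h5 : exp (-(π / 2 * u)) * exp (π / 4 * u) = exp (-(π / 4 * u)) := by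
      rw [← exp_add]
      ring_nf
    have h6 : exp (π / 4 * u) * exp (π / 4 * u) ≤ exp (π / 2 * n * ‖w‖) := by
      rw [← exp_add, exp_le_exp]
      have := mul_le_mul_of_nonneg_left huw (by positivity : 0 ≤ π / 2)
      linarith
    calc exp (-(π / 4 * u)) * ‖w‖ ^ (((n : ℝ) - 1) / 2) * c
        = c * ‖w‖ ^ (((n : ℝ) - 1) / 2) * exp (-(π / 2 * u)) * exp (π / 4 * u) := by
          rw [← h5]
          ring
      _ ≤ Z * (16 * 8 ^ 4 * exp (π / 4 * u)) * exp (π / 4 * u) := h4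
      _ = 16 * 8 ^ 4 * (exp (π / 4 * u) * exp (π / 4 * u)) * Z := by ring
      _ ≤ _ := by gcongr
  rw [Complex.norm_ofNat, div_le_iff₀ (by positivity)]
  calc _ ≤ K * W * exp (-(π / 4 * u)) := by gcongr
    _ = K * W / (‖w‖ ^ (((n : ℝ) - 1) / 2) * c) *
        (exp (-(π / 4 * u)) * ‖w‖ ^ (((n : ℝ) - 1) / 2) * c) := by
        field_simp
    _ ≤ K * W / (‖w‖ ^ (((n : ℝ) - 1) / 2) * c) * (16 * 8 ^ 4 * exp (π / 2 * n * ‖w‖) * Z) := by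
        gcongr
    _ = _ := by
        field_simp

end MaxParabolic

namespace MaxParabolic

open Real

/-! ### The weights as monomials in the Iwasawa coordinates -/

/-- The diagonal entries of the matrix `y` of the Iwasawa form, in logarithmic coordinates. -/
noncomputable def expHeight (m : ℕ) (L : ℕ → ℝ) (i : Fin (m + 1)) : ℝ :=
  ∏ l ∈ Finset.Icc 1 (m - (i : ℕ)), exp (L l)

theorem expHeight_eq (m : ℕ) (L : ℕ → ℝ) (i : Fin (m + 1)) :
    expHeight m L i = exp (∑ l ∈ Finset.Icc 1 m, (if l ≤ m - (i : ℕ) then 1 else 0) * L l) := by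
  rw [expHeight, ← exp_sum]
  congr 1
  simp only [ite_mul, one_mul, zero_mul]
  rw [← Finset.sum_filter]
  refine Finset.sum_congr (Finset.ext fun l => ?_) fun _ _ => rfl
  simp only [Finset.mem_filter, Finset.mem_Icc]
  omega

theorem sum_fin_ite_le (m j : ℕ) (p : ℕ → Prop) [DecidablePred p] (a b : ℝ) :
    ∑ i : Fin (m + 1), (if j ≤ (i : ℕ) then a * (if p i then 1 else 0) + b else 0) =
      a * ((Finset.Icc j m).filter p).card + (m + 1 - j : ℕ) * b := by
  rw [← Finset.sum_range (fun i : ℕ => if j ≤ i then a * (if p i then 1 else 0) + b else 0),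
    ← Finset.sum_filter, Finset.sum_add_distrib, ← Finset.mul_sum, Finset.sum_boole,
    Finset.sum_const, nsmul_eq_mul]
  have h : (Finset.range (m + 1)).filter (fun i => j ≤ i) = Finset.Icc j m := by
    ext i
    simp only [Finset.mem_filter, Finset.mem_range, Finset.mem_Icc]
    omega
  rw [h, Nat.card_Icc]

theorem prod_expHeight (m : ℕ) (L : ℕ → ℝ) :
    ∏ i, expHeight m L i = exp (∑ l ∈ Finset.Icc 1 m, ((m : ℝ) + 1 - l) * L l) := by
  simp only [expHeight_eq]
  rw [← exp_sum, Finset.sum_comm]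
  congr 1
  refine Finset.sum_congr rfl fun l hl => ?_
  have hl := Finset.mem_Icc.1 hl
  rw [← Finset.sum_mul]
  congr 1
  have h := sum_fin_ite_le m 0 (fun i => l ≤ m - i) 1 0
  simp only [Nat.zero_le, if_true, one_mul, add_zero, mul_zero] at h
  rw [h]
  have h2 : (Finset.Icc 0 m).filter (fun i => l ≤ m - i) = Finset.Icc 0 (m - l) := by
    ext i
    simp only [Finset.mem_filter, Finset.mem_Icc]
    omega
  rw [h2, Nat.card_Icc, Nat.sub_zero, Nat.cast_add, Nat.cast_sub hl.2]
  push_cast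
  ring

theorem unimodular_expHeight (m : ℕ) (L : ℕ → ℝ) (i : Fin (m + 1)) :
    unimodular (expHeight m L) i = exp (∑ l ∈ Finset.Icc 1 m,
      ((if l ≤ m - (i : ℕ) then 1 else 0) - ((m : ℝ) + 1 - l) / (m + 1)) * L l) := by
  rw [unimodular, prod_expHeight, expHeight_eq, ← exp_mul, ← exp_add, Finset.sum_mul,
    ← Finset.sum_add_distrib]
  congr 1
  refine Finset.sum_congr rfl fun l _ => ?_
  push_cast
  ring

theorem inv_unimodular_expHeight_rev (m : ℕ) (L : ℕ → ℝ) (i : Fin (m + 1)) :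
    (unimodular (expHeight m L) i.rev)⁻¹ = exp (∑ l ∈ Finset.Icc 1 m,
      (((m : ℝ) + 1 - l) / (m + 1) - (if l ≤ (i : ℕ) then 1 else 0)) * L l) := by
  rw [unimodular_expHeight, ← exp_neg, ← Finset.sum_neg_distrib]
  congr 1
  refine Finset.sum_congr rfl fun l _ => ?_
  have h : m - (i.rev : ℕ) = i := by
    rw [Fin.val_rev]
    have := i.2
    omega
  rw [h]
  ring

theorem triWeight_exp {m : ℕ} (n : ℕ) {η : Fin (m + 1) → ℝ} (S : Finset ℕ)
    (a : Fin (m + 1) → ℕ → ℝ) (L : ℕ → ℝ) (hη : ∀ i, η i = exp (∑ l ∈ S, a i l * L l))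
    (j : Fin (m + 1)) :
    triWeight n η j = exp (∑ l ∈ S, (-(∑ i : Fin (m + 1), if (j : ℕ) ≤ i then a i l else 0) -
      (n - (m + 1 - (j : ℕ)) : ℕ) * a j l) * L l) := by
  have h1 : ∀ i, (if j ≤ i then (η i)⁻¹ else 1) =
      exp (-(if (j : ℕ) ≤ i then ∑ l ∈ S, a i l * L l else 0)) := by
    intro i
    by_cases h : j ≤ i
    · rw [if_pos h, if_pos (Fin.le_def.1 h), hη, exp_neg]
    · rw [if_neg h, if_neg (fun h' => h (Fin.le_def.2 h')), neg_zero, exp_zero]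
  rw [triWeight, Finset.prod_congr rfl fun i _ => h1 i, ← exp_sum, hη, ← exp_neg, ← exp_nat_mul,
    ← exp_add]
  congr 1
  simp only [sub_mul, Finset.sum_sub_distrib, neg_mul, Finset.sum_neg_distrib, Finset.sum_mul,
    mul_neg, Finset.mul_sum, mul_assoc]
  rw [Finset.sum_comm]
  rw [sub_eq_add_neg]
  congr 2
  refine Finset.sum_congr rfl fun i _ => ?_
  split_ifs
  · rfl
  · simp

theorem monomial_eq_exp (N r : ℕ) (L : ℕ → ℝ) (a b : ℝ) (hr : r ≤ N - 1) :
    (∏ j ∈ Finset.Icc 1 r, exp (L j) ^ j) ^ a *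
      (∏ j ∈ Finset.Icc (r + 1) (N - 1), exp (L j) ^ (N - j)) ^ b =
    exp (∑ l ∈ Finset.Icc 1 (N - 1), (if l ≤ r then l * a else ((N : ℝ) - l) * b) * L l) := by
  simp only [← exp_nat_mul, ← exp_sum, ← exp_mul, ← exp_add]
  congr 1
  rw [Finset.sum_mul, Finset.sum_mul]
  simp only [ite_mul]
  rw [Finset.sum_ite]
  have h1 : (Finset.Icc 1 (N - 1)).filter (fun l => l ≤ r) = Finset.Icc 1 r := by
    ext l
    simp only [Finset.mem_filter, Finset.mem_Icc]
    omega
  have h2 : (Finset.Icc 1 (N - 1)).filter (fun l => ¬l ≤ r) = Finset.Icc (r + 1) (N - 1) := by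
    ext l
    simp only [Finset.mem_filter, Finset.mem_Icc]
    omega
  rw [h1, h2]
  congr 1
  · exact Finset.sum_congr rfl fun l _ => by ring
  · refine Finset.sum_congr rfl fun l hl => ?_
    rw [Nat.cast_sub (by have := (Finset.mem_Icc.1 hl).2; omega)]
    ring

/-- Each of the two monomials in a summand of `monomialSum` is at most the whole sum. -/
theorem monomials_le_monomialSum {n : ℕ} (L : ℕ → ℝ) {k : ℕ} (hk : k ∈ Finset.Icc 1 (2 * n)) :
    exp (∑ l ∈ Finset.Icc 1 (2 * n - 1),
      (if l ≤ 2 * n - k then (l : ℝ) * (1 / 2) else (2 * n - l) * (1 / 2)) * L l) ≤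
        monomialSum n (fun l => exp (L l)) ∧
    exp (∑ l ∈ Finset.Icc 1 (2 * n - 1),
      (if l ≤ 2 * n - k then (l : ℝ) * (((k : ℝ) - 1) / (2 * n)) else
        (2 * n - l) * ((2 * (n : ℝ) - k + 1) / (2 * n))) * L l) ≤
        monomialSum n (fun l => exp (L l)) := by
  have h1 := Finset.mem_Icc.1 hk
  have h2 : ∀ a b : ℝ, _ := fun a b => monomial_eq_exp (2 * n) (2 * n - k) L a b (by omega)
  push_cast at h2
  have h3 : exp (∑ l ∈ Finset.Icc 1 (2 * n - 1),
      (if l ≤ 2 * n - k then (l : ℝ) * (1 / 2) else (2 * n - l) * (1 / 2)) * L l) +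
    exp (∑ l ∈ Finset.Icc 1 (2 * n - 1),
      (if l ≤ 2 * n - k then (l : ℝ) * (((k : ℝ) - 1) / (2 * n)) else
        (2 * n - l) * ((2 * (n : ℝ) - k + 1) / (2 * n))) * L l) ≤
        monomialSum n (fun l => exp (L l)) := by
    rw [← h2, ← h2]
    refine Finset.single_le_sum (f := fun k : ℕ =>
      (∏ j ∈ Finset.Icc 1 (2 * n - k), exp (L j) ^ j) ^ (1 / 2 : ℝ) *
        (∏ j ∈ Finset.Icc (2 * n - k + 1) (2 * n - 1), exp (L j) ^ (2 * n - j)) ^ (1 / 2 : ℝ) +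
      (∏ j ∈ Finset.Icc 1 (2 * n - k), exp (L j) ^ j) ^ (((k : ℝ) - 1) / (2 * n)) *
        (∏ j ∈ Finset.Icc (2 * n - k + 1) (2 * n - 1), exp (L j) ^ (2 * n - j)) ^
          ((2 * (n : ℝ) - k + 1) / (2 * n))) (fun k _ => ?_) hk
    positivity
  constructor
  · linarith [exp_pos (∑ l ∈ Finset.Icc 1 (2 * n - 1),
      (if l ≤ 2 * n - k then (l : ℝ) * (((k : ℝ) - 1) / (2 * n)) else
        (2 * n - l) * ((2 * (n : ℝ) - k + 1) / (2 * n))) * L l)]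
  · linarith [exp_pos (∑ l ∈ Finset.Icc 1 (2 * n - 1),
      (if l ≤ 2 * n - k then (l : ℝ) * (1 / 2) else (2 * n - l) * (1 / 2)) * L l)]

/-- The weights of the form are the monomials with `k = j + 1`, of the first kind when
`2 n - j ≤ n` and of the second kind otherwise. -/
theorem triWeight_primal_le {m n : ℕ} (hN : m + 1 = 2 * n) (L : ℕ → ℝ) (j : Fin (m + 1)) :
    triWeight n (unimodular (expHeight m L)) j ≤ monomialSum n (fun l => exp (L l)) := by
  have hm : m = 2 * n - 1 := by omega
  have hmR : (m : ℝ) + 1 = 2 * n := by exact_mod_cast hN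
  have hj := j.2
  have hn0 : (n : ℝ) ≠ 0 := by
    rw [Nat.cast_ne_zero]
    omega
  have hmem : (j : ℕ) + 1 ∈ Finset.Icc 1 (2 * n) := Finset.mem_Icc.2 ⟨by omega, by omega⟩
  rw [triWeight_exp n _ _ L (unimodular_expHeight m L)]
  have hA : ((m + 1 - (j : ℕ) : ℕ) : ℝ) + j = 2 * n := by
    exact_mod_cast (by omega : m + 1 - (j : ℕ) + j = 2 * n)
  have hsum : ∀ l ∈ Finset.Icc 1 m, (∑ i : Fin (m + 1), if (j : ℕ) ≤ i then
      ((if l ≤ m - (i : ℕ) then 1 else 0) - ((m : ℝ) + 1 - l) / (m + 1)) else 0) =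
      ((m - l + 1 - j : ℕ) : ℝ) - (2 * n - j) * ((2 * n - l) / (2 * n)) := by
    intro l hl
    have hl := Finset.mem_Icc.1 hl
    have h := sum_fin_ite_le m j (fun i => l ≤ m - i) 1 (-(((m : ℝ) + 1 - l) / (m + 1)))
    have h2 : (Finset.Icc (j : ℕ) m).filter (fun i => l ≤ m - i) = Finset.Icc (j : ℕ) (m - l) := by
      ext i
      simp only [Finset.mem_filter, Finset.mem_Icc]
      omega
    simp only [one_mul, ← sub_eq_add_neg, mul_neg] at h
    rw [h, h2, Nat.card_Icc, hmR, ← hA]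
    ring
  have hpos : ∀ l : ℕ, l ≤ m - (j : ℕ) → 1 ≤ l → ((m - l + 1 - j : ℕ) : ℝ) = 2 * n - l - j := by
    intro l hl _
    have : ((m - l + 1 - j : ℕ) : ℝ) + l + j = 2 * n := by
      exact_mod_cast (by omega : m - l + 1 - j + l + j = 2 * n)
    linarith
  rcases le_or_gt (m + 1 - (j : ℕ)) n with h | h
  · refine le_trans (le_of_eq ?_) (monomials_le_monomialSum L hmem).1
    have hB : ((n - (m + 1 - (j : ℕ)) : ℕ) : ℝ) = j - n := by
      have : ((n - (m + 1 - (j : ℕ)) : ℕ) : ℝ) + n = j := by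
        exact_mod_cast (by omega : n - (m + 1 - (j : ℕ)) + n = j)
      linarith
    rw [← hm]
    congr 1
    refine Finset.sum_congr rfl fun l hl => congrArg (· * L l) ?_
    rw [hsum l hl, hB, hmR]
    have hl := Finset.mem_Icc.1 hl
    by_cases hlj : l ≤ m - (j : ℕ)
    · rw [if_pos hlj, if_pos (by omega), hpos l hlj hl.1]
      field_simp
      ring
    · rw [if_neg hlj, if_neg (by omega), show m - l + 1 - (j : ℕ) = 0 by omega]
      push_cast
      field_simp
      ring
  · refine le_trans (le_of_eq ?_) (monomials_le_monomialSum L hmem).2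
    have hB : n - (m + 1 - (j : ℕ)) = 0 := by omega
    rw [← hm]
    congr 1
    refine Finset.sum_congr rfl fun l hl => congrArg (· * L l) ?_
    rw [hsum l hl, hB, hmR]
    have hl := Finset.mem_Icc.1 hl
    by_cases hlj : l ≤ m - (j : ℕ)
    · rw [if_pos hlj, if_pos (by omega), hpos l hlj hl.1]
      push_cast
      field_simp
      ring
    · rw [if_neg hlj, if_neg (by omega), show m - l + 1 - (j : ℕ) = 0 by omega]
      push_cast
      field_simp
      ring

/-- The weights of the dual form are monomials too: with `A = 2 n - j`, the one of the first kind
with `k = A` when `A ≤ n`, the one of the second kind with `k = A + 1` when `n < A < 2 n`, and `1`,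
which is the one of the second kind with `k = 1`, when `A = 2 n`. -/
theorem triWeight_dual_le {m n : ℕ} (hN : m + 1 = 2 * n) (L : ℕ → ℝ) (j : Fin (m + 1)) :
    triWeight n (fun i => (unimodular (expHeight m L) i.rev)⁻¹) j ≤
      monomialSum n (fun l => exp (L l)) := by
  have hm : m = 2 * n - 1 := by omega
  have hmR : (m : ℝ) + 1 = 2 * n := by exact_mod_cast hN
  have hj := j.2
  have hn0 : (n : ℝ) ≠ 0 := by
    rw [Nat.cast_ne_zero]
    omega
  rw [triWeight_exp n _ _ L (inv_unimodular_expHeight_rev m L)]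
  have hA : ((m + 1 - (j : ℕ) : ℕ) : ℝ) + j = 2 * n := by
    exact_mod_cast (by omega : m + 1 - (j : ℕ) + j = 2 * n)
  have hsum : ∀ l : ℕ, (∑ i : Fin (m + 1), if (j : ℕ) ≤ i then
      (((m : ℝ) + 1 - l) / (m + 1) - (if l ≤ (i : ℕ) then 1 else 0)) else 0) =
      (2 * n - j) * ((2 * n - l) / (2 * n)) - ((m + 1 - max (j : ℕ) l : ℕ) : ℝ) := by
    intro l
    have h := sum_fin_ite_le m j (fun i => l ≤ i) (-1) (((m : ℝ) + 1 - l) / (m + 1))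
    have h2 : (Finset.Icc (j : ℕ) m).filter (fun i => l ≤ i) = Finset.Icc (max (j : ℕ) l) m := by
      ext i
      simp only [Finset.mem_filter, Finset.mem_Icc]
      omega
    simp only [neg_mul, one_mul, neg_add_eq_sub] at h
    rw [h, h2, Nat.card_Icc, hmR, ← hA]
    ring
  have hle : ∀ l : ℕ, l ≤ j → ((m + 1 - max (j : ℕ) l : ℕ) : ℝ) = 2 * n - j := by
    intro l hl
    rw [max_eq_left hl]
    linarith
  have hgt : ∀ l : ℕ, (j : ℕ) ≤ l → l ≤ m → ((m + 1 - max (j : ℕ) l : ℕ) : ℝ) = 2 * n - l := by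
    intro l hl hlm
    have : ((m + 1 - max (j : ℕ) l : ℕ) : ℝ) + l = 2 * n := by
      exact_mod_cast (by omega : m + 1 - max (j : ℕ) l + l = 2 * n)
    linarith
  rcases le_or_gt (m + 1 - (j : ℕ)) n with h | h
  · refine le_trans (le_of_eq ?_) (monomials_le_monomialSum L (k := m + 1 - (j : ℕ))
      (Finset.mem_Icc.2 ⟨by omega, by omega⟩)).1
    have hB : ((n - (m + 1 - (j : ℕ)) : ℕ) : ℝ) = j - n := by
      have : ((n - (m + 1 - (j : ℕ)) : ℕ) : ℝ) + n = j := by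
        exact_mod_cast (by omega : n - (m + 1 - (j : ℕ)) + n = j)
      linarith
    rw [← hm]
    congr 1
    refine Finset.sum_congr rfl fun l hl => congrArg (· * L l) ?_
    rw [hsum l, hB, hmR]
    have hl := Finset.mem_Icc.1 hl
    by_cases hlj : l ≤ (j : ℕ)
    · rw [if_pos hlj, if_pos (by omega), hle l hlj]
      field_simp
      ring
    · rw [if_neg hlj, if_neg (by omega), hgt l (by omega) hl.2]
      field_simp
      ring
  · have hB : n - (m + 1 - (j : ℕ)) = 0 := by omega
    rcases Nat.eq_zero_or_pos (j : ℕ) with hj0 | hj0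
    · refine le_trans (le_of_eq ?_) (monomials_le_monomialSum L (k := 1)
        (Finset.mem_Icc.2 ⟨le_rfl, by omega⟩)).2
      rw [← hm]
      congr 1
      refine Finset.sum_congr rfl fun l hl => congrArg (· * L l) ?_
      have hl := Finset.mem_Icc.1 hl
      rw [hsum l, hB, hmR, if_pos (by omega : l ≤ m), hgt l (by omega) hl.2, hj0]
      push_cast
      field_simp
      ring
    · refine le_trans (le_of_eq ?_) (monomials_le_monomialSum L (k := m + 1 - (j : ℕ) + 1)
        (Finset.mem_Icc.2 ⟨by omega, by omega⟩)).2
      rw [← hm]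
      congr 1
      refine Finset.sum_congr rfl fun l hl => congrArg (· * L l) ?_
      have hl := Finset.mem_Icc.1 hl
      have hA' : ((m + 1 - (j : ℕ) + 1 : ℕ) : ℝ) = 2 * n - j + 1 := by
        push_cast
        linarith
      rw [hsum l, hB, hmR, hA']
      -- the two formulas for the exponent of `y l` agree at `l = j`
      rcases lt_trichotomy l (j : ℕ) with hlj | hlj | hlj
      · rw [if_pos (by omega : l ≤ 2 * n - (m + 1 - (j : ℕ) + 1)), hle l hlj.le]
        push_cast
        field_simp
        ring
      · rw [if_neg (by omega : ¬l ≤ 2 * n - (m + 1 - (j : ℕ) + 1)), hle l hlj.le, ← hlj]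
        push_cast
        field_simp
        ring
      · rw [if_neg (by omega : ¬l ≤ 2 * n - (m + 1 - (j : ℕ) + 1)), hgt l hlj.le hl.2]
        push_cast
        field_simp
        ring

theorem one_le_monomialSum {n : ℕ} (hn : 1 ≤ n) (L : ℕ → ℝ) :
    1 ≤ monomialSum n (fun l => exp (L l)) := by
  have h := (monomials_le_monomialSum L (n := n) (k := 1) (Finset.mem_Icc.2 ⟨le_rfl, by omega⟩)).2
  refine le_trans (le_of_eq ?_) h
  rw [eq_comm, exp_eq_one_iff]
  refine Finset.sum_eq_zero fun l hl => ?_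
  rw [if_pos (Finset.mem_Icc.1 hl).2]
  simp

theorem antitone_unimodular_expHeight {m : ℕ} {L : ℕ → ℝ} (hL : ∀ l ∈ Finset.Icc 1 m, 0 ≤ L l) :
    Antitone (unimodular (expHeight m L)) := by
  intro i i' hii
  rw [unimodular_expHeight, unimodular_expHeight, exp_le_exp]
  refine Finset.sum_le_sum fun l hl => mul_le_mul_of_nonneg_right ?_ (hL l hl)
  have := Fin.le_def.1 hii
  gcongr
  split_ifs
  · exact le_rfl
  · omega
  · exact zero_le_one
  · exact le_rfl

theorem exp_neg_sum_le_unimodular_le {m : ℕ} {L : ℕ → ℝ} (hL : ∀ l ∈ Finset.Icc 1 m, 0 ≤ L l)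
    (i : Fin (m + 1)) : exp (-(∑ l ∈ Finset.Icc 1 m, L l)) ≤ unimodular (expHeight m L) i ∧
      unimodular (expHeight m L) i ≤ exp (∑ l ∈ Finset.Icc 1 m, L l) := by
  have hc : ∀ l ∈ Finset.Icc 1 m, 0 ≤ ((m : ℝ) + 1 - l) / (m + 1) ∧
      ((m : ℝ) + 1 - l) / (m + 1) ≤ 1 := by
    intro l hl
    have h2 : (l : ℝ) ≤ m := by exact_mod_cast (Finset.mem_Icc.1 hl).2
    constructor
    · apply div_nonneg <;> linarith [Nat.cast_nonneg (α := ℝ) l]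
    · rw [div_le_one (by positivity)]
      linarith [Nat.cast_nonneg (α := ℝ) l]
  rw [unimodular_expHeight, exp_le_exp, exp_le_exp, ← Finset.sum_neg_distrib]
  constructor
  · refine Finset.sum_le_sum fun l hl => ?_
    have := hc l hl
    have h1 : (-1 : ℝ) ≤ (if l ≤ m - (i : ℕ) then 1 else 0) - ((m : ℝ) + 1 - l) / (m + 1) := by
      split_ifs <;> linarith
    linarith [mul_le_mul_of_nonneg_right h1 (hL l hl)]
  · refine Finset.sum_le_sum fun l hl => ?_
    have := hc l hl
    have h1 : (if l ≤ m - (i : ℕ) then 1 else 0) - ((m : ℝ) + 1 - l) / (m + 1) ≤ 1 := by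
      split_ifs <;> linarith
    linarith [mul_le_mul_of_nonneg_right h1 (hL l hl)]

end MaxParabolic

theorem proposition3p4 (n : ℕ) (hn : 1 ≤ n) :
    ∃ C : ℝ, 0 < C ∧
      ∀ (x : Fin (2 * n - 1 + 1) → Fin (2 * n - 1 + 1) → ℝ) (y : ℕ → ℝ),
        (∀ i ∈ Finset.Icc 1 (2 * n - 1), 1 ≤ y i) →
        ∃ E : ℂ → ℂ,
          MaxParabolic.IsEisensteinSeries
            (MaxParabolic.iwasawaX x * MaxParabolic.iwasawaY (2 * n - 1 + 1) y) E ∧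
          ∀ w : ℂ, w.re = 1 / 2 →
            AnalyticAt ℂ E w ∧
            ‖E w‖ ≤ C * (Real.exp (Real.pi / 2 * n * ‖w‖) / ‖w‖ ^ (((n : ℝ) - 1) / 2)) *
              MaxParabolic.monomialSum n y *
              (1 + Real.log (∏ j ∈ Finset.Icc 1 (2 * n - 1), y j)) := by
  have hN : 2 * n - 1 + 1 = 2 * n := by omega
  obtain ⟨K, hK, hbound⟩ := MaxParabolic.exists_norm_eisenstein_le hN hn
  refine ⟨K * (1 + 4 * n) + 1, by positivity, fun x y hy => ?_⟩
  set L : ℕ → ℝ := fun l => Real.log (y l) with hLdef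
  have hL : ∀ l ∈ Finset.Icc 1 (2 * n - 1), 0 ≤ L l := fun l hl => Real.log_nonneg (hy l hl)
  have hyL : ∀ l ∈ Finset.Icc 1 (2 * n - 1), y l = Real.exp (L l) := fun l hl =>
    (Real.exp_log (lt_of_lt_of_le one_pos (hy l hl))).symm
  have hY : MaxParabolic.iwasawaY (2 * n - 1 + 1) y =
      Matrix.diagonal (MaxParabolic.expHeight (2 * n - 1) L) := by
    rw [MaxParabolic.iwasawaY]
    congr 1
    funext i
    refine Finset.prod_congr rfl fun l hl => hyL l ?_
    simp only [Finset.mem_Icc] at hl ⊢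
    omega
  have hS : MaxParabolic.monomialSum n y =
      MaxParabolic.monomialSum n (fun l => Real.exp (L l)) := by
    refine Finset.sum_congr rfl fun k hk => ?_
    have hk := Finset.mem_Icc.1 hk
    have h1 : ∏ j ∈ Finset.Icc 1 (2 * n - k), y j ^ j =
        ∏ j ∈ Finset.Icc 1 (2 * n - k), Real.exp (L j) ^ j :=
      Finset.prod_congr rfl fun l hl => by
        rw [hyL l]
        simp only [Finset.mem_Icc] at hl ⊢
        omega
    have h2 : ∏ j ∈ Finset.Icc (2 * n - k + 1) (2 * n - 1), y j ^ (2 * n - j) =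
        ∏ j ∈ Finset.Icc (2 * n - k + 1) (2 * n - 1), Real.exp (L j) ^ (2 * n - j) :=
      Finset.prod_congr rfl fun l hl => by
        rw [hyL l]
        simp only [Finset.mem_Icc] at hl ⊢
        omega
    rw [h1, h2]
  have hlog : Real.log (∏ j ∈ Finset.Icc 1 (2 * n - 1), y j) =
      ∑ l ∈ Finset.Icc 1 (2 * n - 1), L l :=
    Real.log_prod fun l hl => (lt_of_lt_of_le one_pos (hy l hl)).ne'
  have hB : 0 ≤ ∑ l ∈ Finset.Icc 1 (2 * n - 1), L l := Finset.sum_nonneg hL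
  obtain ⟨E, hE, hEw⟩ := hbound (MaxParabolic.expHeight (2 * n - 1) L) x _
    (fun i => Finset.prod_pos fun l _ => Real.exp_pos _)
    (MaxParabolic.antitone_unimodular_expHeight hL) hB
    (fun i => (MaxParabolic.exp_neg_sum_le_unimodular_le hL i).1)
    (fun i => (MaxParabolic.exp_neg_sum_le_unimodular_le hL i).2)
  rw [hY, hS, hlog]
  refine ⟨E, hE, fun w hw => ⟨(hEw w hw).1, (hEw w hw).2.trans ?_⟩⟩
  set S := MaxParabolic.monomialSum n (fun l => Real.exp (L l)) with hSdef
  have hS1 : 1 ≤ S := MaxParabolic.one_le_monomialSum hn L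
  have hcard : ((2 * n - 1 + 1 : ℕ) : ℝ) = 2 * n := by rw [hN]; push_cast; ring
  have h1 := Finset.sum_le_card_nsmul Finset.univ _ S fun j _ =>
    MaxParabolic.triWeight_primal_le hN L j
  have h2 := Finset.sum_le_card_nsmul Finset.univ _ S fun j _ =>
    MaxParabolic.triWeight_dual_le hN L j
  rw [Finset.card_univ, Fintype.card_fin, nsmul_eq_mul, hcard] at h1 h2
  set T := Real.exp (Real.pi / 2 * n * ‖w‖) / ‖w‖ ^ (((n : ℝ) - 1) / 2) with hT
  have hT0 : 0 ≤ T := by positivity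
  calc _ ≤ K * T * (((1 + 4 * n) * S) * (1 + ∑ l ∈ Finset.Icc 1 (2 * n - 1), L l)) := by
        gcongr
        linarith
    _ = K * (1 + 4 * n) * T * S * (1 + ∑ l ∈ Finset.Icc 1 (2 * n - 1), L l) := by ring
    _ ≤ _ := by
        gcongr
        linarith
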